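/- Let $\Gamma$ be a countably infinite (discrete) group with identity $\mathbf 1$, let $k\ge 1$ be an integer, identified with $\{0,\dots,k-1\}$, and let $S\subset\Gamma$ be finite. *Definitions.* A $k$-pattern is a map $p\colon F\to k$ with $F=\mathrm{dom}(p)\subset\Gamma$ finite; it occurs in a coloring $f\colon X\to k$ of a set with a $\Gamma$-action if there is $x\in X$ with $f(\gamma\cdot x)=p(\gamma)$ for all $\gamma\in F$. An $S$-labeled graph is a simple graph with a label $\lambda(x,y)\in S\cup S^{-1}$ for every ordered pair of adjacent vertices such that $\lambda(y,x)=\lambda(x,y)^{-1}$; homomorphisms of $S$-labeled graphs preserve adjacency and labels. The Cayley graph $G(\Gamma,S)$ has vertex set $\Gamma$, distinct $x,y$ being adjacent with $\lambda(x,y)=\sigma$ if $y=\sigma x$ with $\sigma\in S\cup S^{-1}$; $G(F,S)$ is its subgraph induced by $F$. A pattern $p\colon F\to k$ is $S$-connected if $G(F,S)$ is connected (in particular $F\neq\varnothing$), and it occurs in a coloring $f\colon V(G)\to k$ of an $S$-labeled graph $G$ if $f\circ\phi=p$ for some homomorphism $\phi\colon G(F,S)\to G$. A coloring is $\mathscr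 P$-avoiding if no $p\in\mathscr P$ occurs in it. $\mathrm{Free}(2^\Gamma)$ is the set of points with trivial stabilizer in $2^\Gamma$ under the action $(\gamma\cdot x)(\delta)=x(\delta\gamma)$. $\log^* n$ is the number of times the (binary) logarithm must be applied to $n$ before the result is at most $1$. For a finite set $D\subset\Gamma$ with $S\cup S^{-1}\cup\{\mathbf 1\}\subseteq D$, $H_{D,n}$ is the $S$-labeled graph whose vertices are the injections $D\to\{0,\dots,n-1\}$, with an edge labeled $\sigma\in S\cup S^{-1}$ from $q$ to $q'\ne q$ if and only if $q(\delta)=q'(\delta')$ whenever $\delta,\delta'\in D$ and $\delta=\delta'\sigma$. In the deterministic $\mathsf{LOCAL}$ model on an $n$-vertex $S$-labeled graph, the vertices carry distinct identifiers from $\{1,\dots,n\}$; every vertex initially knows $n$ and its identifier, and all vertices run the same algorithm. In each round all vertices synchronously send a message to their neighbors and update their states from the messages received and the labels of the edges along which they arrived; at the end every vertex outputs a color. Local computation and message size are unrestricted, and the output must be correct for every assignment of identifiers. **Theorem.** Let $\mathscr P$ be a finite set of $S$-connected $k$-patterns. The following are equivalent: 1. $\mathrm{Free}(2^\Gamma)$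 has a continuous $\mathscr P$-avoiding $k$-coloring. 2. Every free zero-dimensional Polish $\Gamma$-space has a continuous $\mathscr P$-avoiding $k$-coloring. 3. There is a deterministic $\mathsf{LOCAL}$ algorithm that, on every $n$-vertex $S$-labeled subgraph (not necessarily induced) of $G(\Gamma,S)$, outputs a $\mathscr P$-avoiding $k$-coloring in $O(\log^* n)$ rounds. Moreover, let $F_0\subseteq F_1\subseteq\cdots$ be finite subsets of $\Gamma$ with union $\Gamma$, each containing $S\cup S^{-1}\cup\{\mathbf 1\}$, and let $n_i$ be integers with $n_i\ge |F_i|^{2\log^* n_i}$ such that $D_i:=F_i^{\log^* n_i}$ contains $S\cup S^{-1}\cup\{\mathbf 1\}$ (which is automatic if $n_i\ge2$). Then (1)–(3) are also equivalent to each of: 4. Some graph $H_{D_i,n_i}$ has a $\mathscr P$-avoiding $k$-coloring. 5. All but finitely many of the graphs $H_{D_i,n_i}$ have a $\mathscr P$-avoiding $k$-coloring. -/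

import Mathlib

open scoped Pointwise

universe u

namespace ContinuousLocal

/-! ### Patterns and group actions -/

/-- A `k`-pattern: a partial map from `Γ` to `{0, …, k-1}` with finite domain. -/
structure Pattern (Γ : Type u) (k : ℕ) where
  dom : Set Γ
  finite_dom : dom.Finite
  val : dom → Fin k

/-- The pattern `p` occurs in the coloring `f` of a set `X` on which `Γ` acts. -/
def Pattern.OccursIn {Γ : Type u} [Group Γ] {k : ℕ} {X : Type*} [MulAction Γ X]
    (p : Pattern Γ k) (f : X → Fin k) : Prop :=
  ∃ x : X, ∀ γ : p.dom, f ((γ : Γ) • x) = p.val γ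

/-- `X` has a continuous `k`-coloring in which no pattern of `P` occurs. -/
def HasContinuousAvoidingColoring {Γ : Type u} [Group Γ] {k : ℕ} (P : Set (Pattern Γ k))
    (X : Type*) [TopologicalSpace X] [MulAction Γ X] : Prop :=
  ∃ f : X → Fin k, Continuous f ∧ ∀ p ∈ P, ¬ p.OccursIn f

/-- A topological space is zero-dimensional if its clopen sets form a base. -/
def IsZeroDimensional (X : Type*) [TopologicalSpace X] : Prop :=
  TopologicalSpace.IsTopologicalBasis {s : Set X | IsClopen s}

/-- An action is free if all point stabilizers are trivial. -/
def IsFreeAction (Γ : Type*) [Group Γ] (X : Type*) [MulAction Γ X] : Prop :=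
  ∀ x : X, MulAction.stabilizer Γ x = ⊥

/-- The Bernoulli shift `k^Γ`, with the product topology. -/
def Shift (Γ : Type u) (k : ℕ) : Type u := Γ → Fin k

instance (Γ : Type u) (k : ℕ) : TopologicalSpace (Shift Γ k) :=
  inferInstanceAs (TopologicalSpace (Γ → Fin k))

/-- The shift action `(γ • x) δ = x (δ * γ)`. -/
instance (Γ : Type u) [Group Γ] (k : ℕ) : MulAction Γ (Shift Γ k) where
  smul γ x := fun δ => x (δ * γ)
  one_smul x := funext fun δ => congrArg x (mul_one δ)
  mul_smul γ γ' x := funext fun δ => congrArg x (mul_assoc δ γ γ').symm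

/-- The free part of an action: the invariant set of points with trivial stabilizer. -/
def freePart (Γ : Type*) [Group Γ] (X : Type*) [MulAction Γ X] : SubMulAction Γ X where
  carrier := {x | MulAction.stabilizer Γ x = ⊥}
  smul_mem' γ x hx := by
    have hx' : MulAction.stabilizer Γ x = ⊥ := hx
    change MulAction.stabilizer Γ (γ • x) = ⊥
    rw [MulAction.stabilizer_smul_eq_stabilizer_map_conj, hx', Subgroup.map_bot]

/-! ### Labeled graphs -/

/-- An `S`-labeled graph on the vertex set `V`. The values of `label` at nonadjacent pairs
carry no information. -/
structure LabeledGraph {Γ : Type u} [Group Γ] (S : Set Γ) (V : Type*) where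
  graph : SimpleGraph V
  label : V → V → Γ
  label_mem : ∀ {x y}, graph.Adj x y → label x y ∈ S ∪ S⁻¹
  label_symm : ∀ {x y}, graph.Adj x y → label y x = (label x y)⁻¹

namespace LabeledGraph

variable {Γ : Type u} [Group Γ] {S : Set Γ} {V W : Type*}

/-- A (not necessarily induced) subgraph, with the inherited labels. -/
def ofSubgraph (G : LabeledGraph S V) (H : G.graph.Subgraph) : LabeledGraph S H.verts where
  graph := H.coe
  label x y := G.label x y
  label_mem h := G.label_mem (H.coe_adj_sub _ _ h)
  label_symm h := G.label_symm (H.coe_adj_sub _ _ h)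

/-- The subgraph induced by a set of vertices, with the inherited labels. -/
def induce (G : LabeledGraph S V) (U : Set V) : LabeledGraph S U where
  graph := G.graph.induce U
  label x y := G.label x y
  label_mem {x y} h := G.label_mem (show G.graph.Adj x y from h)
  label_symm {x y} h := G.label_symm (show G.graph.Adj x y from h)

/-- Homomorphisms preserve adjacency and labels. -/
def IsHom (G : LabeledGraph S V) (H : LabeledGraph S W) (φ : V → W) : Prop :=
  ∀ x y, G.graph.Adj x y →
    H.graph.Adj (φ x) (φ y) ∧ H.label (φ x) (φ y) = G.label x y

end LabeledGraph

/-- The Cayley graph `G(Γ, S)` of the left multiplication action: distinct `x`, `y` are adjacent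
if `y = σ * x` with `σ ∈ S ∪ S⁻¹`, and the label is this `σ`. -/
def cayleyGraph {Γ : Type u} [Group Γ] (S : Set Γ) : LabeledGraph S Γ where
  graph :=
    { Adj := fun x y => x ≠ y ∧ ∃ σ ∈ S ∪ S⁻¹, y = σ * x
      symm := ⟨by
        rintro x y ⟨hne, σ, hσ, rfl⟩
        refine ⟨hne.symm, σ⁻¹, ?_, by simp⟩
        rcases hσ with h | h
        · exact Or.inr (by simpa using h)
        · exact Or.inl h⟩
      loopless := ⟨fun x h => h.1 rfl⟩ }
  label x y := y * x⁻¹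
  label_mem := by
    rintro x y ⟨-, σ, hσ, rfl⟩
    simpa using hσ
  label_symm := by
    intro x y _
    simp

/-- A pattern is `S`-connected if its domain induces a (nonempty) connected subgraph of the
Cayley graph. -/
def Pattern.IsConnected {Γ : Type u} [Group Γ] (S : Set Γ) {k : ℕ} (p : Pattern Γ k) : Prop :=
  ((cayleyGraph S).induce p.dom).graph.Connected

/-- The pattern `p` occurs in the coloring `f` of the `S`-labeled graph `G`. -/
def Pattern.OccursInGraph {Γ : Type u} [Group Γ] {S : Set Γ} {k : ℕ} {V : Type*}
    (p : Pattern Γ k) (G : LabeledGraph S V) (f : V → Fin k) : Prop :=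
  ∃ φ : p.dom → V, ((cayleyGraph S).induce p.dom).IsHom G φ ∧ ∀ γ, f (φ γ) = p.val γ

/-- No pattern of `P` occurs in the coloring `f` of `G`. -/
def AvoidsOnGraph {Γ : Type u} [Group Γ] {S : Set Γ} {k : ℕ} {V : Type*}
    (P : Set (Pattern Γ k)) (G : LabeledGraph S V) (f : V → Fin k) : Prop :=
  ∀ p ∈ P, ¬ p.OccursInGraph G f

/-! ### The iterated logarithm -/

/-- The least number of applications of the binary logarithm that take `n` to a value at
most `1`. -/
noncomputable def logStar (n : ℕ) : ℕ :=
  sInf {i : ℕ | (Real.logb 2)^[i] (n : ℝ) ≤ 1}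

/-! ### The finite graphs `H_{D,n}` -/

/-- Compatibility of two maps along `σ`. -/
def Compatible {Γ : Type u} [Group Γ] {D : Set Γ} {n : ℕ} (σ : Γ) (q q' : D ↪ Fin n) : Prop :=
  ∀ δ δ' : D, (δ : Γ) = δ' * σ → q δ = q' δ'

theorem Compatible.symm {Γ : Type u} [Group Γ] {D : Set Γ} {n : ℕ} {σ : Γ} {q q' : D ↪ Fin n}
    (h : Compatible σ q q') : Compatible σ⁻¹ q' q := by
  intro δ δ' e
  exact (h δ' δ (by rw [e]; simp)).symm

theorem Compatible.unique {Γ : Type u} [Group Γ] {S D : Set Γ} (hD : S ∪ S⁻¹ ∪ {1} ⊆ D) {n : ℕ}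
    {σ τ : Γ} (hσ : σ ∈ S ∪ S⁻¹) (hτ : τ ∈ S ∪ S⁻¹) {q q' : D ↪ Fin n}
    (h : Compatible σ q q') (h' : Compatible τ q q') : σ = τ := by
  have e := h ⟨σ, hD (Or.inl hσ)⟩ ⟨1, hD (Or.inr rfl)⟩ (by simp)
  have e' := h' ⟨τ, hD (Or.inl hτ)⟩ ⟨1, hD (Or.inr rfl)⟩ (by simp)
  exact congrArg Subtype.val (q.injective (e.trans e'.symm))

theorem inv_mem_union_inv {Γ : Type u} [Group Γ] {S : Set Γ} {σ : Γ} (h : σ ∈ S ∪ S⁻¹) :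
    σ⁻¹ ∈ S ∪ S⁻¹ := by
  rcases h with h | h
  · exact Or.inr (by simpa using h)
  · exact Or.inl h

open Classical in
/-- The `S`-labeled graph `H_{D,n}`: its vertices are the injections `D → {0, …, n-1}`, and there
is an edge with label `σ ∈ S ∪ S⁻¹` from `q` to `q' ≠ q` if `q` and `q'` are `σ`-compatible. Such
a `σ` is unique by `Compatible.unique`. -/
noncomputable def tileGraph {Γ : Type u} [Group Γ] (S : Set Γ) (D : Set Γ)
    (hD : S ∪ S⁻¹ ∪ {1} ⊆ D) (n : ℕ) : LabeledGraph S (D ↪ Fin n) where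
  graph :=
    { Adj := fun q q' => q ≠ q' ∧ ∃ σ ∈ S ∪ S⁻¹, Compatible σ q q'
      symm := ⟨fun _ _ ⟨hne, σ, hσ, h⟩ => ⟨hne.symm, σ⁻¹, inv_mem_union_inv hσ, h.symm⟩⟩
      loopless := ⟨fun _ h => h.1 rfl⟩ }
  label q q' := if h : ∃ σ ∈ S ∪ S⁻¹, Compatible σ q q' then h.choose else 1
  label_mem := by
    rintro q q' ⟨-, h⟩
    rw [dif_pos h]
    exact h.choose_spec.1
  label_symm := by
    rintro q q' ⟨-, h⟩
    have h' : ∃ σ ∈ S ∪ S⁻¹, Compatible σ q' q :=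
      ⟨h.choose⁻¹, inv_mem_union_inv h.choose_spec.1, h.choose_spec.2.symm⟩
    rw [dif_pos h, dif_pos h']
    exact Compatible.unique hD h'.choose_spec.1 (inv_mem_union_inv h.choose_spec.1)
      h'.choose_spec.2 h.choose_spec.2.symm

/-! ### The `LOCAL` model -/

/-- A deterministic algorithm in the `LOCAL` model, for graphs whose edges carry labels in `Γ`,
with outputs in `{0, …, k-1}`. Local computations, states and messages are unrestricted. Every
vertex starts from the number `n` of vertices and its own identifier. In every round it
broadcasts a message to its neighbors, and then updates its state from the messages that it
received, each paired with the label of the edge along which it arrived. -/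
structure LocalAlgorithm (Γ : Type u) (k : ℕ) where
  State : Type u
  Msg : Type u
  init : (n : ℕ) → (ident : ℕ) → State
  send : State → Msg
  update : State → Set (Γ × Msg) → State
  output : State → Fin k

namespace LocalAlgorithm

variable {Γ : Type u} [Group Γ] {S : Set Γ} {k : ℕ} {V : Type*}

/-- The state of a vertex after `t` rounds on the graph `G`. -/
def stateAfter (A : LocalAlgorithm Γ k) (n : ℕ) (G : LabeledGraph S V) (ident : V → ℕ) :
    ℕ → V → A.State
  | 0, x => A.init n (ident x)
  | t + 1, x => A.update (A.stateAfter n G ident t x)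
      {m | ∃ y, G.graph.Adj x y ∧ m = (G.label x y, A.send (A.stateAfter n G ident t y))}

/-- The coloring computed in `t` rounds. -/
def run (A : LocalAlgorithm Γ k) (n : ℕ) (G : LabeledGraph S V) (ident : V → ℕ) (t : ℕ) (x : V) :
    Fin k :=
  A.output (A.stateAfter n G ident t x)

/-- Within `T n` rounds, `A` produces a `P`-avoiding coloring on every `n`-vertex `S`-labeled
subgraph of the Cayley graph, for every assignment of distinct identifiers from `{1, …, n}`. -/
def Solves (A : LocalAlgorithm Γ k) (S : Set Γ) (P : Set (Pattern Γ k)) (T : ℕ → ℕ) : Prop :=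
  ∀ (n : ℕ) (H : (cayleyGraph S).graph.Subgraph), H.verts.Finite → H.verts.ncard = n →
    ∀ ident : H.verts → ℕ, Function.Injective ident → (∀ x, ident x ∈ Set.Icc 1 n) →
      AvoidsOnGraph P ((cayleyGraph S).ofSubgraph H)
        (A.run n ((cayleyGraph S).ofSubgraph H) ident (T n))

end LocalAlgorithm

end ContinuousLocal

/-!
The graphs `H_{D,n}` mediate between algorithms and continuous colorings. A local algorithm with
few rounds only sees a small ball, so its identifiers may repeat far apart; reading them off an
injective coloring of a large set `D` turns the algorithm into an avoiding coloring of `H_{D,n}`.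
Conversely, such a coloring is pulled back along any coloring of a space, or of a labeled graph,
that is injective on translates of `D`. Greedy recoloring provides a continuous one on free
zero-dimensional spaces, and Cole–Vishkin color reduction provides one in `O(log* n)` rounds.

To reach some `H_{D,n}` from condition (2), apply the condition to the compact space of families
of proper six-colorings of `Γ`. By compactness the resulting continuous coloring depends on
finitely many coordinates, and Cole–Vishkin reduction computes these from the colors of a set `D`
so small that `n = 6 ^ (card D) ^ 2` colors can still be reduced.

To reach (2) from (1), it suffices to map a free zero-dimensional space equivariantly into a
closed subset of the shift on which finitely many elements are detected not to be periods. For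
this, the colors of well separated markers are written near the markers, at positions that are so
generic that different levels and different markers interfere in only a bounded number of places,
which the redundancy of the code tolerates.
-/

namespace ContinuousLocal

/-! ### Color reduction -/

section Growth

open Filter

theorem eventually_mul_pow_lt_two_pow (C d : ℕ) :
    ∀ᶠ n : ℕ in atTop, C * (n + 1) ^ d < 2 ^ n := by
  have ho : (fun n : ℕ => ((n + 1 : ℕ) : ℝ) ^ d) =o[atTop] fun n : ℕ => (2 : ℝ) ^ (n + 1) :=
    (isLittleO_pow_const_const_pow_of_one_lt d one_lt_two).comp_tendsto (tendsto_add_atTop_nat 1)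
  have hc : (0 : ℝ) < 1 / (2 * (C + 1)) := by positivity
  filter_upwards [ho.def hc] with n hn
  rw [Real.norm_of_nonneg (by positivity), Real.norm_of_nonneg (by positivity)] at hn
  have hlt : (C : ℝ) * ((n + 1 : ℕ) : ℝ) ^ d < 2 ^ n := calc
    (C : ℝ) * ((n + 1 : ℕ) : ℝ) ^ d < (C + 1) * ((n + 1 : ℕ) : ℝ) ^ d := by gcongr; linarith
    _ ≤ (C + 1) * (1 / (2 * (C + 1)) * 2 ^ (n + 1)) := by gcongr
    _ = 2 ^ n := by field_simp; ring
  exact_mod_cast hlt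

end Growth

section ColeVishkin

/-- The lowest position in which the binary expansions of `a` and `b` differ, and `0` if `a = b`. -/
noncomputable def firstDiff (a b : ℕ) : ℕ :=
  sInf {i | a.testBit i ≠ b.testBit i}

theorem testBit_firstDiff_ne {a b : ℕ} (h : a ≠ b) :
    a.testBit (firstDiff a b) ≠ b.testBit (firstDiff a b) := by
  obtain ⟨i, hi⟩ : ∃ i, a.testBit i ≠ b.testBit i := by
    contrapose! h
    exact Nat.eq_of_testBit_eq h
  exact Nat.sInf_mem (s := {i | a.testBit i ≠ b.testBit i}) ⟨i, hi⟩

theorem firstDiff_lt {a b l : ℕ} (hl : 0 < l) (ha : a < 2 ^ l) (hb : b < 2 ^ l) :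
    firstDiff a b < l := by
  obtain rfl | hab := eq_or_ne a b
  · simpa [firstDiff] using hl
  · by_contra! hle
    have hp := Nat.pow_le_pow_right (n := 2) two_pos hle
    exact testBit_firstDiff_ne hab <| by
      rw [Nat.testBit_lt_two_pow (ha.trans_le hp), Nat.testBit_lt_two_pow (hb.trans_le hp)]

/-- The Cole–Vishkin step for a vertex of color `a` whose successor has color `b`: the new color
encodes the first position in which the two colors differ, with the bit of `a` there. -/
noncomputable def cvStep (a b : ℕ) : ℕ :=
  Nat.bit (a.testBit (firstDiff a b)) (firstDiff a b)

theorem cvStep_ne {a b : ℕ} (h : a ≠ b) (c : ℕ) : cvStep a b ≠ cvStep b c := fun heq => by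
  have hbit := congrArg Nat.bodd heq
  have hpos := congrArg Nat.div2 heq
  simp only [cvStep, Nat.bodd_bit, Nat.div2_bit] at hbit hpos
  exact testBit_firstDiff_ne h (hbit.trans (congrArg b.testBit hpos.symm))

theorem cvStep_lt {a b l : ℕ} (hl : 0 < l) (ha : a < 2 ^ l) (hb : b < 2 ^ l) :
    cvStep a b < 2 * l := by
  have hlt := firstDiff_lt hl ha hb
  have hbit := (a.testBit (firstDiff a b)).toNat_lt
  rw [cvStep, Nat.bit_val]
  omega

/-- The number of colors that a Cole–Vishkin step leaves of `a` colors. -/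
def cvBound (a : ℕ) : ℕ := 2 * Nat.clog 2 a

theorem cvBound_mono : Monotone cvBound := fun _ _ h =>
  Nat.mul_le_mul_left 2 (Nat.clog_mono_right 2 h)

theorem two_le_cvBound {a : ℕ} (h : 2 ≤ a) : 2 ≤ cvBound a :=
  Nat.le_mul_of_pos_right 2 (Nat.clog_pos one_lt_two h)

theorem two_le_cvBound_iterate {m : ℕ} (hm : 2 ≤ m) (t : ℕ) : 2 ≤ cvBound^[t] m := by
  induction t with
  | zero => exact hm
  | succ t ih => rw [Function.iterate_succ_apply']; exact two_le_cvBound ih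

theorem cvStep_lt_cvBound {a b m : ℕ} (hm : 2 ≤ m) (ha : a < m) (hb : b < m) :
    cvStep a b < cvBound m :=
  cvStep_lt (Nat.clog_pos one_lt_two hm) (ha.trans_le (Nat.le_pow_clog one_lt_two m))
    (hb.trans_le (Nat.le_pow_clog one_lt_two m))

/-- The color at the start of a path with colors `u 0, u 1, …` after `t` Cole–Vishkin steps. -/
noncomputable def cvIter : ℕ → (ℕ → ℕ) → ℕ
  | 0, u => u 0
  | t + 1, u => cvStep (cvIter t u) (cvIter t fun j => u (j + 1))

theorem cvIter_congr {t : ℕ} {u v : ℕ → ℕ} (h : ∀ j ≤ t, u j = v j) : cvIter t u = cvIter t v := by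
  induction t generalizing u v with
  | zero => exact h 0 le_rfl
  | succ t ih =>
    rw [cvIter, cvIter, ih fun j hj => h j (by omega), ih fun j hj => h (j + 1) (by omega)]

theorem cvIter_ne {t : ℕ} {u : ℕ → ℕ} (h : u 0 ≠ u 1) :
    cvIter t u ≠ cvIter t fun j => u (j + 1) := by
  induction t with
  | zero => exact h
  | succ t ih => exact cvStep_ne ih _

theorem cvIter_lt {m : ℕ} (hm : 2 ≤ m) {t : ℕ} {u : ℕ → ℕ} (h : ∀ j ≤ t, u j < m) :
    cvIter t u < cvBound^[t] m := by
  induction t generalizing u with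
  | zero => exact h 0 le_rfl
  | succ t ih =>
    rw [Function.iterate_succ_apply']
    exact cvStep_lt_cvBound (two_le_cvBound_iterate hm t) (ih fun j hj => h j (by omega))
      (ih fun j hj => h (j + 1) (by omega))

theorem cvBound_le_six {a : ℕ} (h : a ≤ 6) : cvBound a ≤ 6 :=
  (cvBound_mono h).trans <| Nat.mul_le_mul_left 2 (Nat.clog_le_of_le_pow (by norm_num : 6 ≤ 2 ^ 3))

theorem two_mul_add_two_le_two_pow {n : ℕ} (hn : 3 ≤ n) : 2 * n + 2 ≤ 2 ^ n := by
  induction n, hn using Nat.le_induction with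
  | base => norm_num
  | succ n hn ih => rw [pow_succ]; omega

theorem cvBound_lt {a : ℕ} (h : 7 ≤ a) : cvBound a < a := by
  have hclog : Nat.clog 2 a ≤ (a - 1) / 2 := Nat.clog_le_of_le_pow (by
    have := two_mul_add_two_le_two_pow (n := (a - 1) / 2) (by omega)
    omega)
  unfold cvBound
  omega

theorem cvBound_iterate_le_six {a t : ℕ} (h : a ≤ t + 6) : cvBound^[t] a ≤ 6 := by
  induction t generalizing a with
  | zero => simpa using h
  | succ t ih =>
    rw [Function.iterate_succ_apply]
    apply ih
    obtain h6 | h7 : a ≤ 6 ∨ 7 ≤ a := by omega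
    · exact (cvBound_le_six h6).trans (by omega)
    · have := cvBound_lt h7
      omega

theorem cvBound_two_pow (l : ℕ) : cvBound (2 ^ l) = 2 * l := by
  rw [cvBound, Nat.clog_pow 2 l one_lt_two]

theorem cvBound_le_logb (a : ℕ) : (cvBound a : ℝ) ≤ 2 * (Real.logb 2 a + 1) := by
  have hclog : (Nat.clog 2 a : ℝ) ≤ Nat.log 2 a + 1 := by
    exact_mod_cast Nat.clog_le_of_le_pow (Nat.lt_pow_succ_log_self one_lt_two a).le
  have hlog : (Nat.log 2 a : ℝ) ≤ Real.logb 2 a := Real.natLog_le_logb a 2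
  unfold cvBound
  push_cast
  linarith

/-- The first step brings the number of colors below `2 ^ x`, where `t = 2 * x + 2`, and the second
below `2 * x + 1`. -/
theorem exists_cvBound_iterate_two_pow_le (C : ℕ) :
    ∃ t, cvBound^[t] (2 ^ (C * (t + 1) ^ 2)) ≤ 6 := by
  obtain ⟨x, hx⟩ := (eventually_mul_pow_lt_two_pow (18 * C) 2).exists
  refine ⟨2 * x + 2, ?_⟩
  have hfirst : cvBound (2 ^ (C * (2 * x + 2 + 1) ^ 2)) ≤ 2 ^ x := calc
    cvBound (2 ^ (C * (2 * x + 2 + 1) ^ 2)) = 2 * (C * (2 * x + 2 + 1) ^ 2) := cvBound_two_pow _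
    _ ≤ 2 * (C * (3 * (x + 1)) ^ 2) := by gcongr; omega
    _ = 18 * C * (x + 1) ^ 2 := by ring
    _ ≤ 2 ^ x := hx.le
  have hsecond : cvBound (cvBound (2 ^ (C * (2 * x + 2 + 1) ^ 2))) ≤ 2 * x :=
    (cvBound_mono hfirst).trans_eq (cvBound_two_pow x)
  rw [Function.iterate_add_apply]
  exact cvBound_iterate_le_six (hsecond.trans (Nat.le_add_right _ _))

end ColeVishkin

section LogStar

theorem logb_two_le_sub_one {r : ℝ} (hr : 2 ≤ r) : Real.logb 2 r ≤ r - 1 := by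
  rw [Real.logb_le_iff_le_rpow one_lt_two (by linarith)]
  have := one_add_mul_self_le_rpow_one_add (s := 1) (by norm_num) (p := r - 1) (by linarith)
  norm_num at this
  linarith

theorem exists_logb_iterate_le_one (i : ℕ) {r : ℝ} (hr : r ≤ i + 1) :
    ∃ j ≤ i, (Real.logb 2)^[j] r ≤ 1 := by
  induction i generalizing r with
  | zero => exact ⟨0, le_rfl, by simpa using hr⟩
  | succ i ih =>
    obtain hr1 | hr1 := le_or_gt r 1
    · exact ⟨0, by omega, hr1⟩
    obtain hr2 | hr2 := le_or_gt r 2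
    · have hlog : Real.logb 2 r ≤ Real.logb 2 2 :=
        Real.logb_le_logb_of_le one_lt_two (by linarith) hr2
      exact ⟨1, by omega, by simpa using hlog⟩
    · push_cast at hr
      obtain ⟨j, hj, h⟩ := ih (r := Real.logb 2 r) (by linarith [logb_two_le_sub_one hr2.le])
      exact ⟨j + 1, by omega, h⟩

theorem logb_iterate_logStar_le_one (n : ℕ) : (Real.logb 2)^[logStar n] (n : ℝ) ≤ 1 := by
  obtain ⟨j, -, h⟩ := exists_logb_iterate_le_one n (r := n) (by linarith)
  exact Nat.sInf_mem (s := {i : ℕ | (Real.logb 2)^[i] (n : ℝ) ≤ 1}) ⟨j, h⟩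

theorem one_lt_logb_iterate {n i : ℕ} (h : i < logStar n) : 1 < (Real.logb 2)^[i] (n : ℝ) :=
  not_le.1 (Nat.notMem_of_lt_sInf h)

theorem one_le_logStar {n : ℕ} (h : 2 ≤ n) : 1 ≤ logStar n := by
  by_contra! hlt
  have hle := logb_iterate_logStar_le_one n
  rw [Nat.lt_one_iff.1 hlt, Function.iterate_zero_apply] at hle
  have : n ≤ 1 := by exact_mod_cast hle
  omega

theorem logStar_two_pow_two_pow_le (m : ℕ) : logStar (2 ^ 2 ^ m) ≤ m + 2 := by
  obtain ⟨j, hj, h⟩ := exists_logb_iterate_le_one m (r := m) (by linarith)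
  have hmem : (Real.logb 2)^[j + 2] ((2 ^ 2 ^ m : ℕ) : ℝ) ≤ 1 := by
    have hlog : Real.logb 2 ((2 ^ 2 ^ m : ℕ) : ℝ) = 2 ^ m := by
      push_cast
      simp [Real.logb_pow]
    have hlog' : Real.logb 2 ((2 : ℝ) ^ m) = m := by simp [Real.logb_pow]
    rwa [Function.iterate_succ_apply, Function.iterate_succ_apply, hlog, hlog']
  exact (Nat.sInf_le (s := {i : ℕ | (Real.logb 2)^[i] ((2 ^ 2 ^ m : ℕ) : ℝ) ≤ 1}) hmem).trans
    (by omega)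

theorem two_mul_logb_add_four_le {A : ℝ} (hA : 16 ≤ A) : 2 * Real.logb 2 A + 4 ≤ A := by
  have hlog : Real.logb 2 (A / 8) ≤ A / 8 - 1 := logb_two_le_sub_one (by linarith)
  have hlog8 : Real.logb 2 8 = 3 := by
    rw [show (8 : ℝ) = 2 ^ 3 by norm_num, Real.logb_pow]
    simp
  rw [Real.logb_div (by positivity) (by norm_num), hlog8] at hlog
  linarith

theorem cvBound_le_mul_logb_add_one {A r : ℝ} (hA : 16 ≤ A) (hr : 1 < r) {a : ℕ}
    (ha : a ≤ A * (r + 1)) : cvBound a ≤ A * (Real.logb 2 r + 1) := by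
  have hlogr : 0 ≤ Real.logb 2 r := Real.logb_nonneg one_lt_two hr.le
  obtain rfl | ha0 := a.eq_zero_or_pos
  · simp only [cvBound, Nat.clog_zero_right, mul_zero, Nat.cast_zero]
    positivity
  have hlog : Real.logb 2 a ≤ Real.logb 2 A + (1 + Real.logb 2 r) := calc
    Real.logb 2 a ≤ Real.logb 2 (A * (2 * r)) :=
      Real.logb_le_logb_of_le one_lt_two (by exact_mod_cast ha0) (ha.trans (by gcongr; linarith))
    _ = Real.logb 2 A + (1 + Real.logb 2 r) := by
      rw [Real.logb_mul (by positivity) (by positivity),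
        Real.logb_mul (by positivity) (by positivity), Real.logb_self_eq_one one_lt_two]
  nlinarith [cvBound_le_logb a, two_mul_logb_add_four_le hA]

theorem cvBound_iterate_le_logb_iterate {A n i : ℕ} (hA : 16 ≤ A) (hi : i ≤ logStar n) :
    (cvBound^[i] (A * (n + 1)) : ℝ) ≤ A * ((Real.logb 2)^[i] n + 1) := by
  induction i with
  | zero => simp
  | succ i ih =>
    rw [Function.iterate_succ_apply', Function.iterate_succ_apply']
    exact cvBound_le_mul_logb_add_one (by exact_mod_cast hA) (one_lt_logb_iterate hi)
      (ih (by omega))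

theorem exists_cvBound_iterate_logStar_le (A : ℕ) :
    ∃ c, ∀ n, cvBound^[logStar n + c] (A * (n + 1)) ≤ 6 := by
  wlog hA : 16 ≤ A generalizing A
  · obtain ⟨c, hc⟩ := this 16 le_rfl
    exact ⟨c, fun n => (cvBound_mono.iterate _ (by gcongr; omega)).trans (hc n)⟩
  refine ⟨2 * A, fun n => ?_⟩
  have hle : cvBound^[logStar n] (A * (n + 1)) ≤ 2 * A := by
    have hreal : (cvBound^[logStar n] (A * (n + 1)) : ℝ) ≤ 2 * A := calc
      (cvBound^[logStar n] (A * (n + 1)) : ℝ)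
        ≤ A * ((Real.logb 2)^[logStar n] n + 1) := cvBound_iterate_le_logb_iterate hA le_rfl
      _ ≤ A * (1 + 1) := by gcongr; exact logb_iterate_logStar_le_one n
      _ = 2 * A := by ring
    exact_mod_cast hreal
  rw [add_comm, Function.iterate_add_apply]
  exact cvBound_iterate_le_six (by omega)

end LogStar

/-! ### Continuous colorings from colorings of `H_{D,n}` -/

section TileGraph

variable {Γ : Type u} [Group Γ] {S : Set Γ} {k n : ℕ} {V W Z : Type*}

theorem LabeledGraph.IsHom.comp {G : LabeledGraph S V} {H : LabeledGraph S W} {K : LabeledGraph S Z}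
    {φ : V → W} {ψ : W → Z} (hψ : H.IsHom K ψ) (hφ : G.IsHom H φ) : G.IsHom K (ψ ∘ φ) :=
  fun x y hxy =>
    ⟨(hψ _ _ (hφ x y hxy).1).1, (hψ _ _ (hφ x y hxy).1).2.trans (hφ x y hxy).2⟩

theorem AvoidsOnGraph.comp {P : Set (Pattern Γ k)} {G : LabeledGraph S V} {H : LabeledGraph S W}
    {φ : V → W} {f : W → Fin k} (hf : AvoidsOnGraph P H f) (hφ : G.IsHom H φ) :
    AvoidsOnGraph P G (f ∘ φ) := by
  rintro p hp ⟨ψ, hψ, h⟩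
  exact hf p hp ⟨φ ∘ ψ, hφ.comp hψ, h⟩

theorem mul_inv_mem_of_adj {x y : Γ} (h : (cayleyGraph S).graph.Adj x y) :
    y * x⁻¹ ∈ S ∪ S⁻¹ :=
  (cayleyGraph S).label_mem h

theorem mul_inv_ne_one_of_adj {x y : Γ} (h : (cayleyGraph S).graph.Adj x y) : y * x⁻¹ ≠ 1 :=
  fun e => h.1 (mul_inv_eq_one.1 e).symm

theorem mul_inv_mem_pow_length {U : Set Γ} {a b : U}
    (w : ((cayleyGraph S).induce U).graph.Walk a b) :
    (b : Γ) * (a : Γ)⁻¹ ∈ (S ∪ S⁻¹ ∪ {1}) ^ w.length := by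
  induction w with
  | nil => simp
  | @cons a b c hab w ih =>
    have hba : (b : Γ) * (a : Γ)⁻¹ ∈ S ∪ S⁻¹ ∪ {1} := Or.inl (mul_inv_mem_of_adj hab)
    simpa only [SimpleGraph.Walk.length_cons, pow_succ, mul_assoc, inv_mul_cancel_left] using
      Set.mul_mem_mul ih hba

variable {D : Set Γ} {q q' : D ↪ Fin n} {σ : Γ}

theorem Compatible.ne (hσD : σ ∈ D) (hD : 1 ∈ D) (hσ : σ ≠ 1) (h : Compatible σ q q') :
    q ≠ q' := by
  rintro rfl
  have e := h ⟨σ, hσD⟩ ⟨1, hD⟩ (by simp)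
  exact hσ (congrArg Subtype.val (q.injective e))

variable (hD : S ∪ S⁻¹ ∪ {1} ⊆ D)

theorem tileGraph_label (hσ : σ ∈ S ∪ S⁻¹) (h : Compatible σ q q') :
    (tileGraph S D hD n).label q q' = σ := by
  have hex : ∃ σ ∈ S ∪ S⁻¹, Compatible σ q q' := ⟨σ, hσ, h⟩
  simp only [tileGraph, dif_pos hex]
  exact Compatible.unique hD hex.choose_spec.1 hσ hex.choose_spec.2 h

theorem compatible_tileGraph_label (h : (tileGraph S D hD n).graph.Adj q q') :
    Compatible ((tileGraph S D hD n).label q q') q q' := by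
  obtain ⟨-, σ, hσ, hc⟩ := h
  rwa [tileGraph_label hD hσ hc]

theorem isHom_tileGraph {G : LabeledGraph S V} {φ : V → (D ↪ Fin n)}
    (hne : ∀ x y, G.graph.Adj x y → G.label x y ≠ 1)
    (hφ : ∀ x y, G.graph.Adj x y → Compatible (G.label x y) (φ x) (φ y)) :
    G.IsHom (tileGraph S D hD n) φ := fun x y hxy =>
  ⟨⟨(hφ x y hxy).ne (hD (Or.inl (G.label_mem hxy))) (hD (Or.inr rfl)) (hne x y hxy), _,
      G.label_mem hxy, hφ x y hxy⟩,
    tileGraph_label hD (G.label_mem hxy) (hφ x y hxy)⟩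

/-- A homomorphism from a connected pattern to `H_{D,n}` comes from a single coloring of `Γ`, as
far as the sets `D` around the points of the pattern overlap. -/
theorem LabeledGraph.IsHom.tileGraph_apply_eq {p : Pattern Γ k} (hp : p.IsConnected S)
    {φ : p.dom → (D ↪ Fin n)}
    (hφ : ((cayleyGraph S).induce p.dom).IsHom (tileGraph S D hD n) φ) (ε : Γ)
    (hε : ∀ γ : p.dom, ε * (γ : Γ)⁻¹ ∈ D) (γ γ' : p.dom) :
    φ γ ⟨ε * (γ : Γ)⁻¹, hε γ⟩ = φ γ' ⟨ε * (γ' : Γ)⁻¹, hε γ'⟩ := by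
  obtain ⟨w⟩ := hp.preconnected γ γ'
  induction w with
  | nil => rfl
  | @cons a b c hab _ ih =>
    rw [← ih]
    obtain ⟨hadj, hlabel⟩ := hφ a b hab
    have hc := compatible_tileGraph_label hD hadj
    rw [hlabel] at hc
    refine hc _ _ ?_
    change ε * (a : Γ)⁻¹ = ε * (b : Γ)⁻¹ * ((b : Γ) * (a : Γ)⁻¹)
    group

end TileGraph

section FreeAction

variable {Γ : Type u} [Group Γ] {X : Type*} [MulAction Γ X]

theorem IsFreeAction.eq_of_smul_eq (hfree : IsFreeAction Γ X) {a b : Γ} {x : X}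
    (h : a • x = b • x) : a = b :=
  have := isCancelSMul_iff_stabilizer_eq_bot.2 hfree
  IsCancelSMul.right_cancel _ _ _ h

theorem IsFreeAction.smul_ne (hfree : IsFreeAction Γ X) {a : Γ} (ha : a ≠ 1) (x : X) :
    a • x ≠ x := fun h => ha (hfree.eq_of_smul_eq (h.trans (one_smul Γ x).symm))

theorem continuous_iff_eventually_eq {X Y : Type*} [TopologicalSpace X] [TopologicalSpace Y]
    [DiscreteTopology Y] {f : X → Y} : Continuous f ↔ ∀ x, ∀ᶠ y in nhds x, f y = f x :=
  (IsLocallyConstant.iff_continuous f).symm.trans (IsLocallyConstant.iff_eventually_eq f)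

end FreeAction

section Greedy

variable {Γ : Type u} [Group Γ] {X : Type*} [MulAction Γ X]

theorem exists_le_card_forall_ne {ι : Type*} (R : Finset ι) (f : ι → ℕ) :
    ∃ i ≤ R.card, ∀ r ∈ R, f r ≠ i := by
  obtain ⟨i, hi, hfree⟩ := Finset.exists_mem_notMem_of_card_lt_card
    (s := R.image f) (t := Finset.range (R.card + 1)) (by
      simpa [Nat.lt_succ_iff] using Finset.card_image_le)
  exact ⟨i, Nat.lt_succ_iff.1 (Finset.mem_range.1 hi),
    fun r hr e => hfree (Finset.mem_image.2 ⟨r, hr, e⟩)⟩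

open Classical in
/-- The points whose color in `b` is at least `m` are recolored greedily, in the order given by `b`:
each gets the least color that no earlier point of its neighborhood `R • x` has received. -/
noncomputable def greedyColoring (R : Finset Γ) (b : X → ℕ) (m : ℕ) (x : X) : ℕ :=
  if b x < m then b x
  else sInf {i | ∀ r ∈ R, ∀ _ : b (r • x) < b x, greedyColoring R b m (r • x) ≠ i}
termination_by b x

variable {R : Finset Γ} {b : X → ℕ} {m : ℕ}

theorem greedyColoring_of_lt {x : X} (h : b x < m) : greedyColoring R b m x = b x := by
  rw [greedyColoring, if_pos h]

theorem greedyColoring_of_le {x : X} (h : m ≤ b x) : greedyColoring R b m x =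
    sInf {i | ∀ r ∈ R, b (r • x) < b x → greedyColoring R b m (r • x) ≠ i} := by
  rw [greedyColoring, if_neg h.not_gt]

theorem greedyColoring_le_card {x : X} (h : m ≤ b x) : greedyColoring R b m x ≤ R.card := by
  rw [greedyColoring_of_le h]
  obtain ⟨i, hi, hfree⟩ := exists_le_card_forall_ne R fun r => greedyColoring R b m (r • x)
  have hmem : i ∈ {i | ∀ r ∈ R, b (r • x) < b x → greedyColoring R b m (r • x) ≠ i} :=
    fun r hr _ => hfree r hr
  exact (Nat.sInf_le hmem).trans hi

theorem greedyColoring_ne_of_lt {x : X} {r : Γ} (hr : r ∈ R) (hb : b (r • x) < b x) :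
    greedyColoring R b m (r • x) ≠ greedyColoring R b m x := by
  obtain hlt | hle := lt_or_ge (b x) m
  · rw [greedyColoring_of_lt hlt, greedyColoring_of_lt (hb.trans hlt)]
    exact hb.ne
  · rw [greedyColoring_of_le hle]
    obtain ⟨i, -, hfree⟩ := exists_le_card_forall_ne R fun r => greedyColoring R b m (r • x)
    exact Nat.sInf_mem (s := {i | ∀ r ∈ R, b (r • x) < b x → greedyColoring R b m (r • x) ≠ i})
      ⟨i, fun r hr _ => hfree r hr⟩ r hr hb

theorem greedyColoring_ne (hR : ∀ r ∈ R, r⁻¹ ∈ R) (hb : ∀ x, ∀ r ∈ R, b (r • x) ≠ b x) (x : X)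
    {r : Γ} (hr : r ∈ R) : greedyColoring R b m (r • x) ≠ greedyColoring R b m x := by
  obtain hlt | hgt := (hb x r hr).lt_or_gt
  · exact greedyColoring_ne_of_lt hr hlt
  · simpa using (greedyColoring_ne_of_lt (m := m) (x := r • x) (hR r hr) (by simpa using hgt)).symm

theorem exists_greedyColoring_eq {x : X} (h : m ≤ b x) {i : ℕ} (hi : i < greedyColoring R b m x) :
    ∃ r ∈ R, greedyColoring R b m (r • x) = i := by
  rw [greedyColoring_of_le h] at hi
  have hnot : ¬ ∀ r ∈ R, b (r • x) < b x → greedyColoring R b m (r • x) ≠ i :=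
    Nat.notMem_of_lt_sInf hi
  push Not at hnot
  obtain ⟨r, hr, -, e⟩ := hnot
  exact ⟨r, hr, e⟩

theorem greedyColoring_congr {x y : X} (hxy : b y = b x) (hb : ∀ r ∈ R, b (r • y) = b (r • x))
    (h : ∀ r ∈ R, b (r • x) < b x → greedyColoring R b m (r • y) = greedyColoring R b m (r • x)) :
    greedyColoring R b m y = greedyColoring R b m x := by
  obtain hlt | hle := lt_or_ge (b x) m
  · rw [greedyColoring_of_lt hlt, greedyColoring_of_lt (hxy ▸ hlt), hxy]
  · rw [greedyColoring_of_le hle, greedyColoring_of_le (hxy ▸ hle), hxy]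
    congr 1
    ext i
    refine forall₂_congr fun r hr => ?_
    rw [hb r hr]
    exact forall_congr' fun hlt => by rw [h r hr hlt]

variable [TopologicalSpace X] [ContinuousConstSMul Γ X]

theorem continuous_greedyColoring (hb : Continuous b) : Continuous (greedyColoring R b m) := by
  rw [continuous_iff_eventually_eq] at hb ⊢
  intro x
  induction hv : b x using Nat.strong_induction_on generalizing x with
  | _ v ih =>
    have hR : ∀ᶠ y in nhds x, ∀ r ∈ R, b (r • y) = b (r • x) ∧ (b (r • x) < b x →
        greedyColoring R b m (r • y) = greedyColoring R b m (r • x)) := by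
      rw [Filter.eventually_all_finset]
      intro r _
      have hr : Filter.Tendsto (fun y : X => r • y) (nhds x) (nhds (r • x)) :=
        (continuous_const_smul r).continuousAt
      refine (hr.eventually (hb _)).and ?_
      by_cases hlt : b (r • x) < b x
      · filter_upwards [hr.eventually (ih _ (hv ▸ hlt) (r • x) rfl)] with y hy _ using hy
      · exact Filter.Eventually.of_forall fun y h => absurd h hlt
    filter_upwards [hR, hb x] with y hy hyx
    exact greedyColoring_congr hyx (fun r hr => (hy r hr).1) fun r hr => (hy r hr).2

theorem exists_continuous_nat_of_clopen_nhds {X : Type*} [TopologicalSpace X] [LindelofSpace X]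
    [Nonempty X] {U : X → Set X} (hU : ∀ x, IsClopen (U x)) (hmem : ∀ x, x ∈ U x) :
    ∃ (b : X → ℕ) (e : ℕ → X), Continuous b ∧ ∀ x, x ∈ U (e (b x)) := by
  classical
  obtain ⟨s, hs, hcover⟩ :=
    countable_cover_nhds fun x => (hU x).isOpen.mem_nhds (hmem x)
  have hne : s.Nonempty := by
    obtain ⟨y, hy, -⟩ := Set.mem_iUnion₂.1 (hcover ▸ Set.mem_univ (Classical.arbitrary X))
    exact ⟨y, hy⟩
  obtain ⟨e, rfl⟩ := hs.exists_eq_range hne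
  have hex : ∀ x, ∃ i, x ∈ U (e i) := fun x => by
    simpa using (hcover ▸ Set.mem_univ x : x ∈ ⋃ y ∈ Set.range e, U y)
  refine ⟨fun x => Nat.find (hex x), e, continuous_iff_eventually_eq.2 fun x => ?_,
    fun x => Nat.find_spec (hex x)⟩
  have hbefore : ∀ᶠ y in nhds x, ∀ i ∈ Finset.range (Nat.find (hex x)), y ∉ U (e i) := by
    rw [Filter.eventually_all_finset]
    exact fun i hi =>
      (hU (e i)).compl.isOpen.mem_nhds (Nat.find_min (hex x) (Finset.mem_range.1 hi))
  filter_upwards [hbefore, (hU _).isOpen.mem_nhds (Nat.find_spec (hex x))] with y hy hy'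
  exact (Nat.find_eq_iff _).2 ⟨hy', fun i hi => hy i (Finset.mem_range.2 hi)⟩

theorem exists_clopen_nhd_smul_notMem [T2Space X] (hX : IsZeroDimensional X)
    (hfree : IsFreeAction Γ X) {R : Finset Γ} (hR : (1 : Γ) ∉ R) (x : X) :
    ∃ U : Set X, IsClopen U ∧ x ∈ U ∧ ∀ y ∈ U, ∀ r ∈ R, r • y ∉ U := by
  have hsep : ∀ r ∈ R, ∃ V ∈ nhds x, ∀ y ∈ V, r • y ∉ V := fun r hr => by
    obtain ⟨A, B, hA, hB, hxA, hxB, hdisj⟩ :=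
      t2_separation (hfree.smul_ne (ne_of_mem_of_not_mem hr hR) x)
    refine ⟨B ∩ (fun y => r • y) ⁻¹' A, Filter.inter_mem (hB.mem_nhds hxB)
      ((hA.preimage (continuous_const_smul r)).mem_nhds hxA), ?_⟩
    rintro y ⟨-, hy⟩ ⟨hy', -⟩
    exact Set.disjoint_left.1 hdisj hy hy'
  choose! V hV hV' using hsep
  obtain ⟨U, hU, hxU, hUV⟩ := hX.mem_nhds_iff.1 ((Filter.biInter_finset_mem R).2 hV)
  exact ⟨U, hU, hxU, fun y hy r hr hry =>
    hV' r hr y (Set.mem_iInter₂.1 (hUV hy) r hr) (Set.mem_iInter₂.1 (hUV hry) r hr)⟩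

variable [LindelofSpace X] [T2Space X]

theorem exists_continuous_nat_coloring (hX : IsZeroDimensional X) (hfree : IsFreeAction Γ X)
    {R : Finset Γ} (hR : (1 : Γ) ∉ R) :
    ∃ b : X → ℕ, Continuous b ∧ ∀ x, ∀ r ∈ R, b (r • x) ≠ b x := by
  cases isEmpty_or_nonempty X
  · exact ⟨fun _ => 0, continuous_const, isEmptyElim⟩
  choose U hU hmem hUR using exists_clopen_nhd_smul_notMem hX hfree hR
  obtain ⟨b, e, hb, hbe⟩ := exists_continuous_nat_of_clopen_nhds hU hmem
  exact ⟨b, hb, fun x r hr h => hUR _ x (hbe x) r hr (h ▸ hbe (r • x))⟩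

/-- In the coloring found here the points of color `0` form a maximal `R`-independent set. -/
theorem exists_continuous_coloring (hX : IsZeroDimensional X) (hfree : IsFreeAction Γ X)
    {R : Finset Γ} (hR : (1 : Γ) ∉ R) (hinv : ∀ r ∈ R, r⁻¹ ∈ R) :
    ∃ c : X → ℕ, Continuous c ∧ (∀ x, ∀ r ∈ R, c (r • x) ≠ c x) ∧ (∀ x, c x ≤ R.card) ∧
      ∀ x, c x ≠ 0 → ∃ r ∈ R, c (r • x) = 0 := by
  obtain ⟨b, hb, hbR⟩ := exists_continuous_nat_coloring hX hfree hR
  exact ⟨greedyColoring R b 0, continuous_greedyColoring hb,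
    fun x _ hr => greedyColoring_ne hinv hbR x hr, fun x => greedyColoring_le_card (Nat.zero_le _),
    fun x hx => exists_greedyColoring_eq (Nat.zero_le _) (Nat.pos_of_ne_zero hx)⟩

end Greedy

section Orbit

variable {Γ : Type u} [Group Γ] {S D : Set Γ} {k n : ℕ} {X : Type*} [MulAction Γ X]

/-- The coloring of `D • x`, viewed as an injective coloring of `D`. -/
def orbitTile (c : X → Fin n) (hc : ∀ x, Set.InjOn (fun δ : Γ => c (δ • x)) D) (x : X) :
    D ↪ Fin n :=
  ⟨fun δ => c ((δ : Γ) • x), (hc x).injective⟩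

variable {c : X → Fin n} (hc : ∀ x, Set.InjOn (fun δ : Γ => c (δ • x)) D)

theorem compatible_orbitTile (x : X) (γ γ' : Γ) :
    Compatible (γ' * γ⁻¹) (orbitTile c hc (γ • x)) (orbitTile c hc (γ' • x)) := fun δ δ' e => by
  change c ((δ : Γ) • γ • x) = c ((δ' : Γ) • γ' • x)
  rw [e, smul_smul, smul_smul, mul_assoc, inv_mul_cancel_right]

theorem not_occursIn_orbitTile {P : Set (Pattern Γ k)} (hD : S ∪ S⁻¹ ∪ {1} ⊆ D)
    {f : (D ↪ Fin n) → Fin k} (hf : AvoidsOnGraph P (tileGraph S D hD n) f) :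
    ∀ p ∈ P, ¬ p.OccursIn (f ∘ orbitTile c hc) := by
  rintro p hp ⟨x, hx⟩
  exact hf p hp ⟨fun γ => orbitTile c hc ((γ : Γ) • x),
    isHom_tileGraph hD (fun _ _ h => mul_inv_ne_one_of_adj h)
      fun γ γ' _ => compatible_orbitTile hc x γ γ', hx⟩

theorem continuous_comp_orbitTile [TopologicalSpace X] [ContinuousConstSMul Γ X] (hD : D.Finite)
    (hcont : Continuous c) {Y : Type*} [TopologicalSpace Y] (f : (D ↪ Fin n) → Y) :
    Continuous (f ∘ orbitTile c hc) := by
  refine ((IsLocallyConstant.iff_eventually_eq _).2 fun x => ?_ : IsLocallyConstant _).continuous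
  have hD' : ∀ᶠ y in nhds x, ∀ δ ∈ D, c (δ • y) = c (δ • x) :=
    (Filter.eventually_all_finite hD).2 fun δ _ =>
      continuous_iff_eventually_eq.1 (hcont.comp (continuous_const_smul δ)) x
  filter_upwards [hD'] with y hy
  exact congrArg f (Function.Embedding.ext fun δ => hy δ δ.2)

theorem hasContinuousAvoidingColoring_of_tileGraph {P : Set (Pattern Γ k)} (hfin : D.Finite)
    (hD : S ∪ S⁻¹ ∪ {1} ⊆ D) (hn : D.ncard ^ 2 ≤ n) {f : (D ↪ Fin n) → Fin k}
    (hf : AvoidsOnGraph P (tileGraph S D hD n) f) [TopologicalSpace X] [LindelofSpace X]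
    [T2Space X] [ContinuousConstSMul Γ X] (hX : IsZeroDimensional X) (hfree : IsFreeAction Γ X) :
    HasContinuousAvoidingColoring P X := by
  classical
  obtain ⟨E, rfl⟩ := hfin.exists_finset_coe
  rw [Set.ncard_coe_finset] at hn
  have hone : (1 : Γ) ∈ E * E⁻¹ := by
    have : (1 : Γ) ∈ E := hD (Or.inr rfl)
    simpa using Finset.mul_mem_mul this (Finset.inv_mem_inv this)
  have hcard : ((E * E⁻¹).erase 1).card < n := calc
    ((E * E⁻¹).erase 1).card < (E * E⁻¹).card := Finset.card_erase_lt_of_mem hone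
    _ ≤ E.card * E⁻¹.card := Finset.card_mul_le
    _ ≤ n := by rwa [Finset.card_inv, ← sq]
  have hinv : ∀ r ∈ (E * E⁻¹).erase 1, r⁻¹ ∈ (E * E⁻¹).erase 1 := fun r hr => by
    rw [Finset.mem_erase] at hr ⊢
    exact ⟨inv_ne_one.2 hr.1, by simpa using Finset.inv_mem_inv hr.2⟩
  obtain ⟨c, hc, hne, hle, -⟩ := exists_continuous_coloring hX hfree (by simp) hinv
  have hinj : ∀ x, Set.InjOn (fun δ : Γ => (⟨c (δ • x), (hle _).trans_lt hcard⟩ : Fin n)) E := by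
    intro x δ hδ δ' hδ' h
    by_contra hδδ'
    refine hne (δ' • x) (δ * δ'⁻¹) (Finset.mem_erase.2 ⟨mul_inv_eq_one.not.2 hδδ',
      Finset.mul_mem_mul hδ (Finset.inv_mem_inv hδ')⟩) ?_
    simpa [mul_smul] using h
  have hcont : Continuous fun x => (⟨c x, (hle x).trans_lt hcard⟩ : Fin n) :=
    continuous_iff_eventually_eq.2 fun x => by
      filter_upwards [continuous_iff_eventually_eq.1 hc x] with y hy using Fin.ext hy
  exact ⟨_, continuous_comp_orbitTile hinj hfin hcont f, not_occursIn_orbitTile hinj hD hf⟩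

end Orbit

/-! ### Colorings of `H_{D,n}` from local algorithms -/

section Balls

variable {Γ : Type u} [Group Γ] {S : Set Γ} {k : ℕ}

theorem finite_pow {B : Set Γ} (hB : B.Finite) (n : ℕ) : (B ^ n).Finite := by
  classical
  lift B to Finset Γ using hB
  rw [← Finset.coe_pow]
  exact Finset.finite_toSet _

theorem ncard_pow_le {B : Set Γ} (hB : B.Finite) (n : ℕ) : (B ^ n).ncard ≤ B.ncard ^ n := by
  classical
  lift B to Finset Γ using hB
  rw [← Finset.coe_pow, Set.ncard_coe_finset, Set.ncard_coe_finset]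
  exact Finset.card_pow_le

theorem sq_ncard_pow_le {B : Set Γ} (hB : B.Finite) {l m : ℕ} (h : B.ncard ^ (2 * l) ≤ m) :
    (B ^ l).ncard ^ 2 ≤ m := calc
  (B ^ l).ncard ^ 2 ≤ (B.ncard ^ l) ^ 2 := Nat.pow_le_pow_left (ncard_pow_le hB l) 2
  _ = B.ncard ^ (2 * l) := by rw [← pow_mul, mul_comm]
  _ ≤ m := h

theorem monotone_ball_pow (S : Set Γ) : Monotone fun i : ℕ => (S ∪ S⁻¹ ∪ {1}) ^ i :=
  fun _ _ h => Set.pow_subset_pow_right (Or.inr rfl) h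

theorem one_mem_ball_pow (S : Set Γ) (i : ℕ) : 1 ∈ (S ∪ S⁻¹ ∪ {1}) ^ i :=
  Set.one_mem_pow (Or.inr rfl)

theorem exists_subset_of_monotone {α : Type*} {F : ℕ → Set α} (hF : Monotone F) {V : Set α}
    (hV : V.Finite) (h : V ⊆ ⋃ i, F i) : ∃ i, V ⊆ F i := by
  lift V to Finset α using hV
  exact hF.directed_le.exists_mem_subset_of_finset_subset_biUnion h

/-- Connected patterns, of which there are finitely many, have bounded radius. -/
theorem exists_pattern_radius {P : Set (Pattern Γ k)} (hP : P.Finite)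
    (hconn : ∀ p ∈ P, p.IsConnected S) :
    ∃ r : ℕ, ∀ p ∈ P, ∀ γ ∈ p.dom, ∀ γ' ∈ p.dom, γ * γ'⁻¹ ∈ (S ∪ S⁻¹ ∪ {1}) ^ r := by
  have hfin : (⋃ p ∈ P, p.dom * p.dom⁻¹).Finite :=
    hP.biUnion fun p _ => p.finite_dom.mul p.finite_dom.inv
  obtain ⟨r, hr⟩ := exists_subset_of_monotone (monotone_ball_pow S) hfin (by
    refine Set.iUnion₂_subset fun p hp v hv => ?_
    obtain ⟨γ, hγ, δ, hδ, rfl⟩ := Set.mem_mul.1 hv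
    obtain ⟨w⟩ := (hconn p hp).preconnected ⟨δ⁻¹, Set.mem_inv.1 hδ⟩ ⟨γ, hγ⟩
    exact Set.mem_iUnion.2 ⟨w.length, by simpa using mul_inv_mem_pow_length w⟩)
  exact ⟨r, fun p hp γ hγ δ hδ =>
    hr (Set.mem_iUnion₂.2 ⟨p, hp, Set.mul_mem_mul hγ (Set.inv_mem_inv.2 hδ)⟩)⟩

end Balls

section Locality

variable {Γ : Type u} [Group Γ] {S : Set Γ} {k : ℕ} {P : Set (Pattern Γ k)}

theorem induce_cayleyGraph_adj_mul_right {U U' : Set Γ} {x y : U} {x' y' : U'} {γ : Γ}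
    (hx : (x' : Γ) = x * γ) (hy : (y' : Γ) = y * γ) :
    ((cayleyGraph S).induce U').graph.Adj x' y' ↔ ((cayleyGraph S).induce U).graph.Adj x y := by
  change (cayleyGraph S).graph.Adj x' y' ↔ (cayleyGraph S).graph.Adj x y
  simp only [cayleyGraph, hx, hy, ne_eq, mul_left_inj, ← mul_assoc]

theorem induce_cayleyGraph_label_mul_right {U U' : Set Γ} {x y : U} {x' y' : U'} {γ : Γ}
    (hx : (x' : Γ) = x * γ) (hy : (y' : Γ) = y * γ) :
    ((cayleyGraph S).induce U').label x' y' = ((cayleyGraph S).induce U).label x y := by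
  simp only [LabeledGraph.induce, cayleyGraph, hx, hy, mul_inv_rev, mul_assoc, mul_inv_cancel_left]

/-- The state after `t` rounds depends only on the labels and identifiers in the ball of
radius `t`; right translations are the automorphisms of the Cayley graph. -/
theorem LocalAlgorithm.stateAfter_congr (A : LocalAlgorithm Γ k) (n : ℕ) {U U' : Set Γ}
    {ident : U → ℕ} {ident' : U' → ℕ} {γ : Γ} {t : ℕ} {u : U} {u' : U'} (hu : (u' : Γ) = u * γ)
    (h : ∀ v ∈ (S ∪ S⁻¹ ∪ {1}) ^ t, ∃ (x : U) (x' : U'), (x : Γ) = v * u ∧ (x' : Γ) = x * γ ∧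
      ident x = ident' x') :
    A.stateAfter n ((cayleyGraph S).induce U) ident t u =
      A.stateAfter n ((cayleyGraph S).induce U') ident' t u' := by
  induction t generalizing u u' with
  | zero =>
    obtain ⟨x, x', hx, hx', e⟩ := h 1 (one_mem_ball_pow S 0)
    obtain rfl : x = u := Subtype.ext (hx.trans (one_mul _))
    obtain rfl : x' = u' := Subtype.ext (hx'.trans hu.symm)
    simp only [stateAfter, e]
  | succ t ih =>
    have hneighbor : ∀ y : Γ, (cayleyGraph S).graph.Adj u y → ∃ (x : U) (x' : U'), (x : Γ) = y ∧
        (x' : Γ) = x * γ ∧ A.stateAfter n ((cayleyGraph S).induce U) ident t x =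
          A.stateAfter n ((cayleyGraph S).induce U') ident' t x' := fun y hy => by
      have hstep : ∀ v ∈ (S ∪ S⁻¹ ∪ {1}) ^ t, v * (y * (u : Γ)⁻¹) ∈ (S ∪ S⁻¹ ∪ {1}) ^ (t + 1) :=
        fun v hv => pow_succ (S ∪ S⁻¹ ∪ {1}) t ▸
          Set.mul_mem_mul hv (Or.inl (mul_inv_mem_of_adj hy))
      obtain ⟨x, x', hx, hx', -⟩ := h _ (hstep 1 (one_mem_ball_pow S t))
      obtain rfl : (x : Γ) = y := by rw [hx, one_mul, inv_mul_cancel_right]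
      refine ⟨x, x', rfl, hx', ih hx' fun v hv => ?_⟩
      obtain ⟨z, z', hz, hz', e⟩ := h _ (hstep v hv)
      exact ⟨z, z', by rw [hz, mul_assoc, inv_mul_cancel_right], hz', e⟩
    simp only [stateAfter, ih hu fun v hv => h v (monotone_ball_pow S t.le_succ hv)]
    congr 1
    ext m
    constructor
    · rintro ⟨y, hy, rfl⟩
      obtain ⟨x, x', hxy, hx', e⟩ := hneighbor y hy
      obtain rfl : x = y := Subtype.ext hxy
      exact ⟨x', (induce_cayleyGraph_adj_mul_right hu hx').2 hy,
        Prod.ext (induce_cayleyGraph_label_mul_right (S := S) hu hx').symm (congrArg A.send e)⟩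
    · rintro ⟨y', hy, rfl⟩
      have hadj : (cayleyGraph S).graph.Adj u (y' * γ⁻¹) :=
        (induce_cayleyGraph_adj_mul_right (U := Set.univ) (x := ⟨(u : Γ), Set.mem_univ _⟩)
          (y := ⟨(y' : Γ) * γ⁻¹, Set.mem_univ _⟩) hu (inv_mul_cancel_right _ _).symm).1 hy
      obtain ⟨x, x', hx, hx', e⟩ := hneighbor _ hadj
      obtain rfl : x' = y' := Subtype.ext (by rw [hx', hx, inv_mul_cancel_right])
      exact ⟨x, (induce_cayleyGraph_adj_mul_right hu hx').1 hy,
        Prod.ext (induce_cayleyGraph_label_mul_right (S := S) hu hx') (congrArg A.send e.symm)⟩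

theorem LocalAlgorithm.Solves.avoidsOnGraph_induce {A : LocalAlgorithm Γ k} {T : ℕ → ℕ}
    (hA : A.Solves S P T) {U : Finset Γ} {ident : ↥(U : Set Γ) → ℕ}
    (hinj : Function.Injective ident) (hident : ∀ x, ident x ∈ Set.Icc 1 U.card) :
    AvoidsOnGraph P ((cayleyGraph S).induce U)
      (A.run U.card ((cayleyGraph S).induce U) ident (T U.card)) := by
  have hgraph : (cayleyGraph S).ofSubgraph ((⊤ : (cayleyGraph S).graph.Subgraph).induce U) =
      (cayleyGraph S).induce (U : Set Γ) := by
    have hadj : ((⊤ : (cayleyGraph S).graph.Subgraph).induce (U : Set Γ)).coe =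
        (cayleyGraph S).graph.induce (U : Set Γ) := by
      ext x y
      exact ⟨fun h => h.2.2, fun h => ⟨x.2, y.2, h⟩⟩
    simp only [LabeledGraph.ofSubgraph, LabeledGraph.induce, hadj]
    rfl
  exact hgraph ▸ hA U.card ((⊤ : (cayleyGraph S).graph.Subgraph).induce U) U.finite_toSet
    (Set.ncard_coe_finset U) ident hinj hident

theorem exists_equiv_finset_extend {α ι : Type*} [Infinite α] {n : ℕ} (q : ι ↪ Fin n)
    (i : ι ↪ α) : ∃ (U : Finset α) (e : Fin n ≃ U), U.card = n ∧ ∀ d, (e (q d) : α) = i d := by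
  classical
  have := Finite.of_injective q q.injective
  cases nonempty_fintype ι
  obtain ⟨U, hU, hcard⟩ := Infinite.exists_superset_card_eq (Finset.univ.map i) n (by
    simpa using Fintype.card_le_of_embedding q)
  have hextend : ∀ d, Function.extend q i (fun _ => Classical.arbitrary α) (q d) = i d :=
    fun d => q.injective.extend_apply _ _ d
  obtain ⟨e, he⟩ := Set.MapsTo.exists_equiv_extend_of_card_eq (α := Fin n) (t := U)
    (s := Set.range q) (f := Function.extend q i fun _ => Classical.arbitrary α)
    (by rw [Fintype.card_fin, hcard])
    (by
      rintro _ ⟨d, rfl⟩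
      rw [hextend]
      exact hU (Finset.mem_map_of_mem i (Finset.mem_univ d)))
    (by
      rintro _ ⟨d, rfl⟩ _ ⟨d', rfl⟩ h
      rw [hextend, hextend] at h
      exact congrArg q (i.injective h))
  exact ⟨U, e, hcard, fun d => (he _ ⟨d, rfl⟩).trans (hextend d)⟩

variable [Infinite Γ] {A : LocalAlgorithm Γ k} {T : ℕ → ℕ} {r : ℕ}

/-- A pattern occurring in `H_{D,n}` can be unrolled in `Γ`, with the colors of the tile around one
of its points as identifiers. -/
theorem exists_tileGraph_coloring_of_solves (hconn : ∀ p ∈ P, p.IsConnected S)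
    (hA : A.Solves S P T)
    (hr : ∀ p ∈ P, ∀ γ ∈ p.dom, ∀ γ' ∈ p.dom, γ * γ'⁻¹ ∈ (S ∪ S⁻¹ ∪ {1}) ^ r) (n : ℕ) {D : Set Γ}
    (hD : S ∪ S⁻¹ ∪ {1} ⊆ D) (hsub : (S ∪ S⁻¹ ∪ {1}) ^ (T n + r) ⊆ D) :
    ∃ f, AvoidsOnGraph P (tileGraph S D hD n) f := by
  refine ⟨fun q => A.run n ((cayleyGraph S).induce D) (fun δ => (q δ : ℕ) + 1) (T n)
    ⟨1, hD (Or.inr rfl)⟩, ?_⟩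
  rintro p hp ⟨φ, hφ, hval⟩
  obtain ⟨γ₀⟩ := (hconn p hp).nonempty
  obtain ⟨U, e, rfl, he⟩ := exists_equiv_finset_extend (φ γ₀)
    ((Function.Embedding.subtype D).trans (mulRightEmbedding (γ₀ : Γ)))
  have hmem : ∀ u ∈ (S ∪ S⁻¹ ∪ {1}) ^ T U.card, ∀ γ γ' : p.dom, u * γ * (γ' : Γ)⁻¹ ∈ D :=
    fun u hu γ γ' => hsub (by
      rw [pow_add, mul_assoc]
      exact Set.mul_mem_mul hu (hr p hp γ γ.2 γ' γ'.2))
  have hball : ∀ γ : p.dom, ∀ u ∈ (S ∪ S⁻¹ ∪ {1}) ^ T U.card, ∀ hu : u ∈ D,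
      (e (φ γ ⟨u, hu⟩) : Γ) = u * γ := fun γ u huT hu => by
    have h := hφ.tileGraph_apply_eq hD (hconn p hp) (u * γ) (hmem u huT γ) γ γ₀
    simp only [mul_inv_cancel_right] at h
    rw [h, he]
    exact inv_mul_cancel_right _ _
  have hone : ∀ γ : p.dom, (e (φ γ ⟨1, hD (Or.inr rfl)⟩) : Γ) = γ := fun γ => by
    rw [hball γ 1 (one_mem_ball_pow S _), one_mul]
  refine hA.avoidsOnGraph_induce (U := U) (ident := fun x => (e.symm x : ℕ) + 1) ?_ ?_ p hp
    ⟨fun γ => ⟨γ, hone γ ▸ (e _).2⟩, fun γ γ' h => ⟨h, rfl⟩, fun γ => ?_⟩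
  · exact (add_left_injective 1).comp (Fin.val_injective.comp e.symm.injective)
  · exact fun x => ⟨Nat.le_add_left _ _, (e.symm x).2⟩
  · rw [← hval γ]
    refine (congrArg A.output (A.stateAfter_congr _ (γ := γ) (one_mul _).symm fun v hv => ?_)).symm
    have hvD : v ∈ D := by simpa only [mul_inv_cancel_right] using hmem v hv γ γ
    exact ⟨⟨v, hvD⟩, e (φ γ ⟨v, hvD⟩), (mul_one v).symm, hball γ v hv hvD,
      by rw [Equiv.symm_apply_apply]⟩

theorem exists_nat_bound_of_isBigO
    (h : (fun n => (T n : ℝ)) =O[Filter.atTop] (fun n => (logStar n : ℝ))) :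
    ∃ C N : ℕ, ∀ n ≥ N, T n ≤ C * logStar n := by
  obtain ⟨c, hc⟩ := h.bound
  obtain ⟨N, hN⟩ := Filter.eventually_atTop.1 hc
  refine ⟨⌈c⌉₊, N, fun n hn => ?_⟩
  have hcn := hN n hn
  rw [Real.norm_natCast, Real.norm_natCast] at hcn
  have hceil : c * (logStar n : ℝ) ≤ ⌈c⌉₊ * logStar n := by
    gcongr
    exact Nat.le_ceil c
  exact_mod_cast hcn.trans hceil

/-- On `n = 2 ^ 2 ^ m` vertices `A` only sees balls of radius `O(m)`, which have `2 ^ O(m)`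
elements. -/
theorem exists_tileGraph_of_solves (hS : S.Finite) (hP : P.Finite)
    (hconn : ∀ p ∈ P, p.IsConnected S)
    (hT : (fun n => (T n : ℝ)) =O[Filter.atTop] (fun n => (logStar n : ℝ))) (hA : A.Solves S P T) :
    ∃ (D : Set Γ) (hD : S ∪ S⁻¹ ∪ {1} ⊆ D) (n : ℕ), D.Finite ∧ D.ncard ^ 2 ≤ n ∧
      ∃ f, AvoidsOnGraph P (tileGraph S D hD n) f := by
  obtain ⟨r, hr⟩ := exists_pattern_radius hP hconn
  obtain ⟨C, N, hC⟩ := exists_nat_bound_of_isBigO hT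
  have hB : (S ∪ S⁻¹ ∪ {1}).Finite := (hS.union hS.inv).union (Set.finite_singleton 1)
  have hmono := monotone_ball_pow S
  set B := S ∪ S⁻¹ ∪ {1}
  obtain ⟨m, hm, hexp⟩ := ((Filter.eventually_ge_atTop N).and
    (eventually_mul_pow_lt_two_pow (2 * B.ncard * (2 * C + r + 1)) 1)).exists
  have hTm : T (2 ^ 2 ^ m) ≤ C * (m + 2) :=
    (hC _ (hm.trans (Nat.lt_two_pow_self.trans Nat.lt_two_pow_self).le)).trans
      (Nat.mul_le_mul_left C (logStar_two_pow_two_pow_le m))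
  have hradius : T (2 ^ 2 ^ m) + r + 1 ≤ (2 * C + r + 1) * (m + 1) := by nlinarith
  have hcard : B.ncard ^ (2 * (T (2 ^ 2 ^ m) + r + 1)) ≤ 2 ^ 2 ^ m := calc
    B.ncard ^ (2 * (T (2 ^ 2 ^ m) + r + 1)) ≤ (2 ^ B.ncard) ^ (2 * ((2 * C + r + 1) * (m + 1))) :=
      (Nat.pow_le_pow_left Nat.lt_two_pow_self.le _).trans
        (Nat.pow_le_pow_right (by positivity) (by gcongr))
    _ = 2 ^ (2 * B.ncard * (2 * C + r + 1) * (m + 1) ^ 1) := by rw [← pow_mul]; congr 1; ring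
    _ ≤ 2 ^ 2 ^ m := Nat.pow_le_pow_right two_pos hexp.le
  have hball : B ⊆ B ^ (T (2 ^ 2 ^ m) + r + 1) := by
    simpa only [pow_one] using hmono (Nat.le_add_left 1 (T (2 ^ 2 ^ m) + r))
  exact ⟨B ^ (T (2 ^ 2 ^ m) + r + 1), hball, 2 ^ 2 ^ m, finite_pow hB _,
    sq_ncard_pow_le hB hcard,
    exists_tileGraph_coloring_of_solves hconn hA hr _ _ (hmono (Nat.le_succ _))⟩

theorem finite_not_tileGraph_of_solves (hS : S.Finite) (hP : P.Finite)
    (hconn : ∀ p ∈ P, p.IsConnected S)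
    (hT : (fun n => (T n : ℝ)) =O[Filter.atTop] (fun n => (logStar n : ℝ))) (hA : A.Solves S P T)
    {F : ℕ → Set Γ} {m : ℕ → ℕ} (hFfin : ∀ i, (F i).Finite) (hF : Monotone F)
    (hFu : ⋃ i, F i = Set.univ) (hm : ∀ i, (F i).ncard ^ (2 * logStar (m i)) ≤ m i)
    (hD : ∀ i, S ∪ S⁻¹ ∪ {1} ⊆ F i ^ logStar (m i)) :
    {i | ¬ ∃ f, AvoidsOnGraph P (tileGraph S (F i ^ logStar (m i)) (hD i) (m i)) f}.Finite := by
  obtain ⟨r, hr⟩ := exists_pattern_radius hP hconn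
  obtain ⟨C, N, hC⟩ := exists_nat_bound_of_isBigO hT
  have hB : (S ∪ S⁻¹ ∪ {1}).Finite := (hS.union hS.inv).union (Set.finite_singleton 1)
  have hex : ∀ V : Set Γ, V.Finite → ∃ i, V ⊆ F i := fun V hV =>
    exists_subset_of_monotone hF hV (hFu ▸ Set.subset_univ V)
  obtain ⟨i₁, hi₁⟩ := hex _ (finite_pow hB (C + r))
  obtain ⟨V, hV⟩ := Infinite.exists_subset_card_eq Γ (N + 1)
  obtain ⟨i₂, hi₂⟩ := hex _ V.finite_toSet
  refine (Set.finite_lt_nat (max i₁ i₂)).subset fun i hi =>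
    Set.mem_ofPred_eq ▸ not_le.1 fun hle => hi ?_
  refine exists_tileGraph_coloring_of_solves hconn hA hr (m i) (hD i) ?_
  obtain hzero | hpos := Nat.eq_zero_or_pos (logStar (m i))
  · have hsub : S ∪ S⁻¹ ∪ {1} ⊆ 1 := by simpa [hzero] using hD i
    simpa [hzero] using Set.pow_subset_pow_left (n := T (m i) + r) hsub
  · have hN : N ≤ m i := by
      have hVi : N + 1 ≤ (F i).ncard := by
        rw [← hV, ← Set.ncard_coe_finset]
        exact Set.ncard_le_ncard (hi₂.trans (hF ((le_max_right _ _).trans hle))) (hFfin i)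
      calc N ≤ (F i).ncard ^ 1 := by rw [pow_one]; exact (Nat.le_succ N).trans hVi
        _ ≤ (F i).ncard ^ (2 * logStar (m i)) := Nat.pow_le_pow_right (by lia) (by lia)
        _ ≤ m i := hm i
    calc (S ∪ S⁻¹ ∪ {1}) ^ (T (m i) + r) ⊆ (S ∪ S⁻¹ ∪ {1}) ^ ((C + r) * logStar (m i)) :=
          monotone_ball_pow S (by have := hC _ hN; nlinarith)
      _ = ((S ∪ S⁻¹ ∪ {1}) ^ (C + r)) ^ logStar (m i) := pow_mul _ _ _
      _ ⊆ F i ^ logStar (m i) :=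
          Set.pow_subset_pow_left (hi₁.trans (hF ((le_max_left _ _).trans hle)))

end Locality

/-! ### Colorings of `H_{D,n}` from continuous colorings of the color space -/

theorem exists_finset_forall_eq_imp_mem {ι α X : Type*} [TopologicalSpace α]
    [TopologicalSpace X] {e : X → ι → α} (he : Topology.IsInducing e) {x : X} {U : Set X}
    (hU : U ∈ nhds x) : ∃ J : Finset ι, ∀ y, (∀ i ∈ J, e y i = e x i) → y ∈ U := by
  rw [he.nhds_eq_comap, Filter.mem_comap] at hU
  obtain ⟨V, hV, hVU⟩ := hU
  obtain ⟨W, hWV, hW, hxW⟩ := mem_nhds_iff.1 hV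
  obtain ⟨J, u, hu, hJ⟩ := isOpen_pi_iff.1 hW (e x) hxW
  exact ⟨J, fun y hy => hVU (hWV (hJ fun i hi => hy i hi ▸ (hu i hi).2))⟩

theorem exists_finset_determining {ι α κ X : Type*} [TopologicalSpace α] [DiscreteTopology α]
    [TopologicalSpace κ] [DiscreteTopology κ] [TopologicalSpace X] [CompactSpace X]
    {e : X → ι → α} (he : Topology.IsInducing e) {f : X → κ} (hf : Continuous f) :
    ∃ J : Finset ι, ∀ x y, (∀ i ∈ J, e x i = e y i) → f x = f y := by
  classical
  choose J hJ using fun x =>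
    exists_finset_forall_eq_imp_mem he (continuous_iff_eventually_eq.1 hf x)
  have hcyl : ∀ x, {y | ∀ i ∈ J x, e y i = e x i} ∈ nhds x := fun x =>
    (Filter.eventually_all_finset _).2 fun i _ =>
      continuous_iff_eventually_eq.1 ((continuous_apply i).comp he.continuous) x
  obtain ⟨t, ht⟩ := finite_cover_nhds hcyl
  refine ⟨t.biUnion J, fun x y hxy => ?_⟩
  obtain ⟨z, hz, hxz⟩ := Set.mem_iUnion₂.1 (ht ▸ Set.mem_univ x)
  exact (hJ z x hxz).trans (hJ z y fun i hi =>
    (hxy i (Finset.mem_biUnion.2 ⟨z, hz, hi⟩)).symm.trans (hxz i hi)).symm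

/-- The families of six-colorings of `Γ`, indexed by `Γ`, in which the coloring with index `γ ≠ 1`
is proper for left multiplication by `γ`. This compact free `Γ`-space is the one to which
condition (2) of the theorem is applied. -/
def ColorSpace (Γ : Type u) [Group Γ] : Type u :=
  {c : Γ × Γ → Fin 6 // ∀ γ δ : Γ, γ ≠ 1 → c (γ, γ * δ) ≠ c (γ, δ)}

namespace ColorSpace

variable {Γ : Type u} [Group Γ]

instance : TopologicalSpace (ColorSpace Γ) :=
  inferInstanceAs (TopologicalSpace
    {c : Γ × Γ → Fin 6 // ∀ γ δ : Γ, γ ≠ 1 → c (γ, γ * δ) ≠ c (γ, δ)})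

instance : MulAction Γ (ColorSpace Γ) where
  smul η c := ⟨fun i => c.1 (i.1, i.2 * η), fun γ δ h => by
    simpa only [mul_assoc] using c.2 γ (δ * η) h⟩
  one_smul c := Subtype.ext (funext fun i => congrArg (fun δ => c.1 (i.1, δ)) (mul_one i.2))
  mul_smul η η' c := Subtype.ext (funext fun i =>
    congrArg (fun δ => c.1 (i.1, δ)) (mul_assoc i.2 η η').symm)

theorem smul_apply (η : Γ) (c : ColorSpace Γ) (γ δ : Γ) : (η • c).1 (γ, δ) = c.1 (γ, δ * η) := rfl

theorem isClosed_carrier :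
    IsClosed {c : Γ × Γ → Fin 6 | ∀ γ δ : Γ, γ ≠ 1 → c (γ, γ * δ) ≠ c (γ, δ)} := by
  simp only [Set.ofPred_forall]
  refine isClosed_iInter fun γ => isClosed_iInter fun δ => isClosed_iInter fun _ => ?_
  have hcont : Continuous fun c : Γ × Γ → Fin 6 => (c (γ, γ * δ), c (γ, δ)) :=
    (continuous_apply _).prodMk (continuous_apply _)
  exact (isClosed_discrete {z : Fin 6 × Fin 6 | z.1 ≠ z.2}).preimage hcont

instance : CompactSpace (ColorSpace Γ) :=
  isCompact_iff_compactSpace.1 (isClosed_carrier (Γ := Γ)).isCompact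

instance [Countable Γ] : PolishSpace (ColorSpace Γ) :=
  have : PolishSpace (Fin 6) := inferInstance
  (isClosed_carrier (Γ := Γ)).polishSpace

theorem isInducing_val : Topology.IsInducing fun c : ColorSpace Γ => c.1 := ⟨rfl⟩

instance : ContinuousConstSMul Γ (ColorSpace Γ) where
  continuous_const_smul η := Continuous.subtype_mk
    (continuous_pi fun i : Γ × Γ =>
      (continuous_apply (i.1, i.2 * η)).comp isInducing_val.continuous) _

theorem isZeroDimensional : IsZeroDimensional (ColorSpace Γ) := by
  have : T2Space (ColorSpace Γ) := inferInstanceAs (T2Space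
    {c : Γ × Γ → Fin 6 // ∀ γ δ : Γ, γ ≠ 1 → c (γ, γ * δ) ≠ c (γ, δ)})
  have : TotallyDisconnectedSpace (ColorSpace Γ) := inferInstanceAs (TotallyDisconnectedSpace
    {c : Γ × Γ → Fin 6 // ∀ γ δ : Γ, γ ≠ 1 → c (γ, γ * δ) ≠ c (γ, δ)})
  exact isTopologicalBasis_isClopen

theorem isFreeAction : IsFreeAction Γ (ColorSpace Γ) := by
  intro c
  rw [Subgroup.eq_bot_iff_forall]
  intro η hη
  by_contra h
  refine c.2 η 1 h ?_
  rw [mul_one, ← one_mul η, ← smul_apply, one_mul, MulAction.mem_stabilizer_iff.1 hη]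

variable {q : Γ → ℕ}

theorem cvIter_mul_ne (hq : Function.Injective q) (t : ℕ) {γ : Γ} (hγ : γ ≠ 1) (δ : Γ) :
    cvIter t (fun j => q (γ ^ j * (γ * δ))) ≠ cvIter t (fun j => q (γ ^ j * δ)) := by
  have h := cvIter_ne (t := t) (u := fun j => q (γ ^ j * δ)) fun h => hγ (by
    simpa using (hq h).symm)
  simp only [pow_succ, mul_assoc] at h
  exact h.symm

theorem cvIter_ne_of_mem (hq : Function.Injective q) (t : ℕ) {γ : Γ} (hγ : γ ≠ 1) (δ : Γ) {r : Γ}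
    (hr : r = γ ∨ r = γ⁻¹) :
    cvIter t (fun j => q (γ ^ j * (r * δ))) ≠ cvIter t (fun j => q (γ ^ j * δ)) := by
  rcases hr with rfl | rfl
  · exact cvIter_mul_ne hq t hγ δ
  · simpa only [mul_inv_cancel_left] using (cvIter_mul_ne hq t hγ (γ⁻¹ * δ)).symm

open Classical in
/-- The point of the color space obtained from an injective coloring by `t` steps of color
reduction along every group element, followed by greedy recoloring with six colors; the latter
leaves the colors below `6` unchanged. -/
noncomputable def ofInjective (q : Γ → ℕ) (hq : Function.Injective q) (t : ℕ) : ColorSpace Γ where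
  val i := ⟨greedyColoring {i.1, i.1⁻¹} (fun δ => cvIter t fun j => q (i.1 ^ j * δ)) 6 i.2, by
    by_cases h : cvIter t (fun j => q (i.1 ^ j * i.2)) < 6
    · exact (greedyColoring_of_lt (b := fun δ => cvIter t fun j => q (i.1 ^ j * δ)) h).trans_lt h
    · exact (greedyColoring_le_card (by omega)).trans_lt
        (Finset.card_le_two.trans_lt (by norm_num))⟩
  property γ δ hγ h := by
    refine greedyColoring_ne (R := {γ, γ⁻¹}) (m := 6)
      (b := fun δ => cvIter t fun j => q (γ ^ j * δ)) ?_ ?_ δ (r := γ) (by simp)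
      (congrArg Fin.val h)
    · intro r hr
      simp only [Finset.mem_insert, Finset.mem_singleton] at hr ⊢
      rcases hr with rfl | rfl <;> simp
    · exact fun x r hr => cvIter_ne_of_mem hq t hγ x (by simpa using hr)

theorem ofInjective_apply (hq : Function.Injective q) {t : ℕ} {γ δ : Γ}
    (h : cvIter t (fun j => q (γ ^ j * δ)) < 6) :
    ((ofInjective q hq t).1 (γ, δ) : ℕ) = cvIter t (fun j => q (γ ^ j * δ)) :=
  greedyColoring_of_lt (b := fun δ => cvIter t fun j => q (γ ^ j * δ)) h

theorem ofInjective_apply_eq {q q' : Γ → ℕ} (hq : Function.Injective q)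
    (hq' : Function.Injective q') {n t : ℕ} (hn : 2 ≤ n) (ht : cvBound^[t] n ≤ 6) {γ δ δ' : Γ}
    (h : ∀ j ≤ t, q (γ ^ j * δ) = q' (γ ^ j * δ')) (hlt : ∀ j ≤ t, q (γ ^ j * δ) < n) :
    (ofInjective q hq t).1 (γ, δ) = (ofInjective q' hq' t).1 (γ, δ') := by
  have hlt' := (cvIter_lt hn hlt).trans_le ht
  have heq := cvIter_congr h
  apply Fin.ext
  rw [ofInjective_apply hq hlt', heq, ofInjective_apply hq' (heq ▸ hlt')]

end ColorSpace

open Classical in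
/-- An extension of an injective coloring of a part of a countable group to the whole group; the
new colors are all at least `n`. -/
noncomputable def extendColoring {Γ : Type u} [Countable Γ] {D : Set Γ} {n : ℕ} (q : D ↪ Fin n)
    (g : Γ) : ℕ :=
  if h : g ∈ D then q ⟨g, h⟩ else n + (exists_injective_nat Γ).choose g

theorem extendColoring_of_mem {Γ : Type u} [Countable Γ] {D : Set Γ} {n : ℕ} (q : D ↪ Fin n)
    {g : Γ} (h : g ∈ D) : extendColoring q g = q ⟨g, h⟩ := by
  rw [extendColoring, dif_pos h]

theorem extendColoring_injective {Γ : Type u} [Countable Γ] {D : Set Γ} {n : ℕ} (q : D ↪ Fin n) :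
    Function.Injective (extendColoring q) := by
  intro a b hab
  unfold extendColoring at hab
  split_ifs at hab with ha hb hb
  · exact congrArg Subtype.val (q.injective (Fin.ext hab))
  · exact absurd (q ⟨a, ha⟩).2 (by omega)
  · exact absurd (q ⟨b, hb⟩).2 (by omega)
  · exact (exists_injective_nat Γ).choose_spec (by omega)

/-- The set `D` only grows linearly in `t` while `n = 6 ^ (card D) ^ 2` has `O(t ^ 2)` digits, so
`t` reduction steps, which read the colors at `γ ^ j * W * V` for `j ≤ t`, lead to six colors. -/
theorem exists_finset_cvBound_iterate_le_six {Γ : Type u} [Group Γ] (I W V B : Finset Γ) :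
    ∃ (t : ℕ) (D : Finset Γ), B ⊆ D ∧
      (∀ γ ∈ I, ∀ j ≤ t, ∀ w ∈ W, ∀ v ∈ V, γ ^ j * w * v ∈ D) ∧
      cvBound^[t] (6 ^ D.card ^ 2) ≤ 6 := by
  classical
  obtain ⟨t, ht⟩ := exists_cvBound_iterate_two_pow_le (3 * (I.card * W.card * V.card + B.card) ^ 2)
  set C : ℕ := I.card * W.card * V.card + B.card with hC
  set E : Finset Γ := I.biUnion fun γ => (Finset.range (t + 1)).image fun j => γ ^ j
  have hEcard : E.card ≤ I.card * (t + 1) := Finset.card_biUnion_le_card_mul _ _ _ fun γ _ =>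
    Finset.card_image_le.trans (Finset.card_range _).le
  have hDcard : (E * W * V ∪ B).card ≤ C * (t + 1) := by
    calc (E * W * V ∪ B).card ≤ (E * W * V).card + B.card := Finset.card_union_le _ _
      _ ≤ E.card * W.card * V.card + B.card := by
        gcongr
        exact Finset.card_mul_le.trans (Nat.mul_le_mul_right _ Finset.card_mul_le)
      _ ≤ I.card * (t + 1) * W.card * V.card + B.card * (t + 1) := by
        gcongr
        exact Nat.le_mul_of_pos_right _ t.succ_pos
      _ = C * (t + 1) := by rw [hC]; ring
  refine ⟨t, E * W * V ∪ B, Finset.subset_union_right, fun γ hγ j hj w hw v hv => ?_, ?_⟩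
  · exact Finset.mem_union_left _ (Finset.mul_mem_mul (Finset.mul_mem_mul (Finset.mem_biUnion.2
      ⟨γ, hγ, Finset.mem_image.2 ⟨j, Finset.mem_range.2 (by omega), rfl⟩⟩) hw) hv)
  · refine (Monotone.iterate cvBound_mono t ?_).trans ht
    calc 6 ^ (E * W * V ∪ B).card ^ 2 ≤ (2 ^ 3) ^ (E * W * V ∪ B).card ^ 2 := by
          gcongr
          norm_num
      _ = 2 ^ (3 * (E * W * V ∪ B).card ^ 2) := by rw [pow_mul]
      _ ≤ 2 ^ (3 * (C * (t + 1)) ^ 2) := by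
        gcongr
        norm_num
      _ = 2 ^ (3 * C ^ 2 * (t + 1) ^ 2) := by rw [mul_pow, mul_assoc]

theorem exists_tileGraph_of_colorSpace {Γ : Type u} [Group Γ] [Countable Γ] {S : Set Γ}
    (hS : S.Finite) {k : ℕ} {P : Set (Pattern Γ k)} (hP : P.Finite)
    (hconn : ∀ p ∈ P, p.IsConnected S) (h : HasContinuousAvoidingColoring P (ColorSpace Γ)) :
    ∃ (D : Finset Γ) (hD : S ∪ S⁻¹ ∪ {1} ⊆ (D : Set Γ)),
      ∃ f, AvoidsOnGraph P (tileGraph S D hD (6 ^ (D.card ^ 2))) f := by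
  classical
  obtain ⟨f, hf, hfP⟩ := h
  obtain ⟨J, hJ⟩ := exists_finset_determining ColorSpace.isInducing_val hf
  have hBfin : (S ∪ S⁻¹ ∪ {1}).Finite := (hS.union hS.inv).union (Set.finite_singleton 1)
  have hVfin : (⋃ p ∈ P, p.dom * p.dom⁻¹).Finite :=
    hP.biUnion fun p _ => p.finite_dom.mul p.finite_dom.inv
  obtain ⟨t, D, hBD, hmem, ht⟩ := exists_finset_cvBound_iterate_le_six (J.image Prod.fst)
    (J.image Prod.snd) hVfin.toFinset hBfin.toFinset
  have hD : S ∪ S⁻¹ ∪ {1} ⊆ (D : Set Γ) := by simpa only [Set.Finite.toFinset_subset] using hBD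
  have hn : 2 ≤ 6 ^ D.card ^ 2 := by
    have hpos : 0 < D.card := Finset.card_pos.2 ⟨1, hD (Or.inr rfl)⟩
    exact le_trans (by norm_num) (Nat.pow_le_pow_right (by norm_num) (Nat.pow_pos hpos))
  let c (q : (D : Set Γ) ↪ Fin (6 ^ D.card ^ 2)) : ColorSpace Γ :=
    ColorSpace.ofInjective _ (extendColoring_injective q) t
  refine ⟨D, hD, fun q => f (c q), ?_⟩
  rintro p hp ⟨φ, hφ, hval⟩
  obtain ⟨γ₀⟩ := (hconn p hp).nonempty
  refine hfP p hp ⟨(γ₀ : Γ)⁻¹ • c (φ γ₀), fun γ => ?_⟩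
  rw [← hval γ]
  refine hJ _ _ ?_
  rintro ⟨η, δ⟩ hηδ
  rw [ColorSpace.smul_apply, ColorSpace.smul_apply]
  have hmemD : ∀ j ≤ t, ∀ γ' : p.dom, η ^ j * δ * γ * (γ' : Γ)⁻¹ ∈ (D : Set Γ) := by
    intro j hj γ'
    rw [mul_assoc (η ^ j * δ)]
    refine hmem η (Finset.mem_image_of_mem _ hηδ) j hj δ (Finset.mem_image_of_mem _ hηδ) _ ?_
    exact hVfin.mem_toFinset.2
      (Set.mem_iUnion₂.2 ⟨p, hp, Set.mul_mem_mul γ.2 (Set.inv_mem_inv.2 γ'.2)⟩)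
  refine ColorSpace.ofInjective_apply_eq _ _ hn ht (fun j hj => ?_) fun j hj => ?_
  · rw [← mul_assoc, ← mul_assoc, extendColoring_of_mem _ (hmemD j hj γ₀),
      hφ.tileGraph_apply_eq hD (hconn p hp) _ (hmemD j hj) γ₀ γ, ← extendColoring_of_mem,
      mul_inv_cancel_right]
  · rw [← mul_assoc, ← mul_assoc, extendColoring_of_mem _ (hmemD j hj γ₀)]
    exact Fin.is_lt _

/-! ### Local algorithms from colorings of `H_{D,n}` -/

section GatherAlgorithm

variable {Γ : Type u} {s : Set Γ}

open Classical in
/-- The identifiers of the vertices of a subgraph, extended by `0`, which is not an identifier. -/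
noncomputable def extendIdent (ident : s → ℕ) (x : Γ) : ℕ :=
  if h : x ∈ s then ident ⟨x, h⟩ else 0

theorem extendIdent_coe (ident : s → ℕ) (x : s) : extendIdent ident x = ident x := by
  rw [extendIdent, dif_pos x.2]

theorem extendIdent_le {ident : s → ℕ} {n : ℕ} (h : ∀ x, ident x ≤ n) (x : Γ) :
    extendIdent ident x ≤ n := by
  unfold extendIdent
  split_ifs
  exacts [h _, Nat.zero_le n]

theorem injOn_extendIdent {ident : s → ℕ} (h : Function.Injective ident) :
    Set.InjOn (extendIdent ident) s := by
  intro x hx y hy hxy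
  rw [extendIdent_coe ident ⟨x, hx⟩, extendIdent_coe ident ⟨y, hy⟩] at hxy
  exact congrArg Subtype.val (h hxy)

variable [Group Γ]

/-- The balls of radius `t` around `x` in the graph `G` with identifiers `ι`, and around `x'` in
`G'` with identifiers `ι'`, cannot be distinguished along walks from the center. Edges carry the
labels of the Cayley graph. -/
def BallsAgree (G : SimpleGraph Γ) (ι : Γ → ℕ) (G' : SimpleGraph Γ) (ι' : Γ → ℕ) :
    ℕ → Γ → Γ → Prop
  | 0, x, x' => ι x = ι' x'
  | t + 1, x, x' => ι x = ι' x' ∧ ∀ σ, (G.Adj x (σ * x) ↔ G'.Adj x' (σ * x')) ∧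
      (G.Adj x (σ * x) → BallsAgree G ι G' ι' t (σ * x) (σ * x'))

variable {G G' : SimpleGraph Γ} {ι ι' : Γ → ℕ} {t : ℕ} {x x' : Γ}

theorem BallsAgree.ident_eq (h : BallsAgree G ι G' ι' t x x') : ι x = ι' x' := by
  cases t with
  | zero => exact h
  | succ t => exact h.1

theorem BallsAgree.of_succ (h : BallsAgree G ι G' ι' (t + 1) x x') :
    BallsAgree G ι G' ι' t x x' := by
  induction t generalizing x x' with
  | zero => exact h.1
  | succ t ih => exact ⟨h.1, fun σ => ⟨(h.2 σ).1, fun hσ => ih ((h.2 σ).2 hσ)⟩⟩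

theorem BallsAgree.of_le {s : ℕ} (hst : s ≤ t) (h : BallsAgree G ι G' ι' t x x') :
    BallsAgree G ι G' ι' s x x' := by
  induction t, hst using Nat.le_induction with
  | base => exact h
  | succ t _ ih => exact ih h.of_succ

theorem BallsAgree.symm (h : BallsAgree G ι G' ι' t x x') : BallsAgree G' ι' G ι t x' x := by
  induction t generalizing x x' with
  | zero => exact Eq.symm h
  | succ t ih =>
    exact ⟨h.1.symm, fun σ => ⟨(h.2 σ).1.symm, fun hσ => ih ((h.2 σ).2 ((h.2 σ).1.2 hσ))⟩⟩

/-- All label sequences of walks of length at most `t` from `x`, with the identifiers of the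
ends: what a vertex can learn in `t` rounds. -/
def walkInfo (G : SimpleGraph Γ) (ι : Γ → ℕ) : ℕ → Γ → Set (List Γ × ℕ)
  | 0, x => {([], ι x)}
  | t + 1, x => walkInfo G ι t x ∪
      {z | ∃ σ w, z.1 = σ :: w ∧ G.Adj x (σ * x) ∧ (w, z.2) ∈ walkInfo G ι t (σ * x)}

theorem nil_mem_walkInfo {i : ℕ} : (([] : List Γ), i) ∈ walkInfo G ι t x ↔ i = ι x := by
  induction t with
  | zero => simp [walkInfo]
  | succ t ih => simp [walkInfo, ih]

theorem cons_mem_walkInfo {σ : Γ} {w : List Γ} {i : ℕ} :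
    (σ :: w, i) ∈ walkInfo G ι (t + 1) x ↔
      G.Adj x (σ * x) ∧ (w, i) ∈ walkInfo G ι t (σ * x) := by
  induction t generalizing x σ w with
  | zero =>
    simp only [walkInfo, Set.mem_union, Set.mem_singleton_iff, Set.mem_ofPred_eq]
    grind
  | succ t ih =>
    rw [walkInfo, Set.mem_union, ih]
    constructor
    · rintro (h | ⟨σ', w', e, hadj, hw⟩)
      · exact ⟨h.1, Set.subset_union_left h.2⟩
      · obtain ⟨rfl, rfl⟩ := List.cons.inj e
        exact ⟨hadj, hw⟩
    · rintro ⟨hadj, hw⟩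
      exact Or.inr ⟨σ, w, rfl, hadj, hw⟩

theorem adj_mul_iff_exists_walkInfo {σ : Γ} :
    G.Adj x (σ * x) ↔ ∃ i, ([σ], i) ∈ walkInfo G ι (t + 1) x := by
  simp only [cons_mem_walkInfo, nil_mem_walkInfo, exists_and_left, exists_eq, and_true]

theorem BallsAgree.of_walkInfo_eq (h : walkInfo G ι t x = walkInfo G' ι' t x') :
    BallsAgree G ι G' ι' t x x' := by
  have hident : ι x = ι' x' := nil_mem_walkInfo.1 (h ▸ nil_mem_walkInfo.2 rfl)
  induction t generalizing x x' with
  | zero => exact hident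
  | succ t ih =>
    refine ⟨hident, fun σ => ?_⟩
    have hadj : G.Adj x (σ * x) ↔ G'.Adj x' (σ * x') := by
      rw [adj_mul_iff_exists_walkInfo (ι := ι), adj_mul_iff_exists_walkInfo (ι := ι'), h]
    refine ⟨hadj, fun hx => ?_⟩
    have hinfo : walkInfo G ι t (σ * x) = walkInfo G' ι' t (σ * x') := by
      ext ⟨w, i⟩
      have hcons := Set.ext_iff.1 h (σ :: w, i)
      rw [cons_mem_walkInfo, cons_mem_walkInfo] at hcons
      simpa only [hx, hadj.1 hx, true_and] using hcons
    exact ih hinfo (nil_mem_walkInfo.1 (hinfo ▸ nil_mem_walkInfo.2 rfl))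

open Classical in
/-- The algorithm that collects the walk information of radius `T n`, picks some identified graph
with a vertex that has the same information, and applies the rule `Φ` there. The color `c` is
a default that is never used. -/
noncomputable def gatherAlgorithm {k : ℕ} (T : ℕ → ℕ)
    (Φ : ℕ → SimpleGraph Γ → (Γ → ℕ) → Γ → Fin k) (c : Fin k) : LocalAlgorithm Γ k where
  State := ℕ × Set (List Γ × ℕ)
  Msg := Set (List Γ × ℕ)
  init n i := (n, {([], i)})
  send s := s.2
  update s m := (s.1, s.2 ∪ {z | ∃ σ w, z.1 = σ :: w ∧ ∃ I, (σ, I) ∈ m ∧ (w, z.2) ∈ I})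
  output s := if h : ∃ z : SimpleGraph Γ × (Γ → ℕ) × Γ, walkInfo z.1 z.2.1 (T s.1) z.2.2 = s.2
    then Φ s.1 h.choose.1 h.choose.2.1 h.choose.2.2 else c

variable {k : ℕ} {T : ℕ → ℕ} {Φ : ℕ → SimpleGraph Γ → (Γ → ℕ) → Γ → Fin k}

theorem gatherAlgorithm_stateAfter (c : Fin k) {S : Set Γ} (n : ℕ)
    (H : (cayleyGraph S).graph.Subgraph) (ident : H.verts → ℕ) (t : ℕ) (x : H.verts) :
    (gatherAlgorithm T Φ c).stateAfter n ((cayleyGraph S).ofSubgraph H) ident t x =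
      (n, walkInfo H.spanningCoe (extendIdent ident) t x) := by
  induction t generalizing x with
  | zero =>
    rw [LocalAlgorithm.stateAfter, walkInfo, extendIdent_coe]
    rfl
  | succ t ih =>
    simp only [LocalAlgorithm.stateAfter, walkInfo, ih]
    refine congrArg (Prod.mk n) (congrArg (_ ∪ ·) (Set.ext fun ⟨v, i⟩ => ⟨?_, ?_⟩))
    · rintro ⟨σ, w, e, I, ⟨y, hy, hmsg⟩, hI⟩
      obtain ⟨rfl, rfl⟩ := Prod.mk.inj hmsg
      have hyx : (y : Γ) * (x : Γ)⁻¹ * x = y := inv_mul_cancel_right _ _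
      exact ⟨_, w, e, hyx.symm ▸ hy, hyx.symm ▸ hI⟩
    · rintro ⟨σ, w, e, hadj, hI⟩
      have hadj' : H.Adj x (σ * x) := hadj
      refine ⟨σ, w, e, _, ⟨⟨σ * x, hadj'.snd_mem⟩, hadj', ?_⟩, hI⟩
      exact Prod.ext (mul_inv_cancel_right σ (x : Γ)).symm rfl

theorem gatherAlgorithm_run
    (hΦ : ∀ n G ι G' ι' x x', BallsAgree G ι G' ι' (T n) x x' → Φ n G ι x = Φ n G' ι' x')
    (c : Fin k) {S : Set Γ} (n : ℕ) (H : (cayleyGraph S).graph.Subgraph) (ident : H.verts → ℕ)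
    (x : H.verts) :
    (gatherAlgorithm T Φ c).run n ((cayleyGraph S).ofSubgraph H) ident (T n) x =
      Φ n H.spanningCoe (extendIdent ident) x := by
  rw [LocalAlgorithm.run, gatherAlgorithm_stateAfter]
  have hex : ∃ z : SimpleGraph Γ × (Γ → ℕ) × Γ, walkInfo z.1 z.2.1 (T n) z.2.2 =
      walkInfo H.spanningCoe (extendIdent ident) (T n) x := ⟨(_, _, _), rfl⟩
  exact (dif_pos hex).trans (hΦ _ _ _ _ _ _ _ (.of_walkInfo_eq hex.choose_spec))

end GatherAlgorithm

section Views

variable {Γ : Type u} [Group Γ] {D : Finset Γ} {G G' : SimpleGraph Γ} {ι ι' : Γ → ℕ} {t : ℕ}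
  {p p' x x' : Γ} {δ δ' : D}

/-- A pair `(p, δ)` with `δ ∈ D` stands for the point `p` of the group, which need not be a vertex
of `G`, as seen from the vertex `δ⁻¹ * p`. In this graph two views of `p` are adjacent if the
vertices that they are taken from are adjacent in `G`; connected views are identified. -/
def viewGraph (G : SimpleGraph Γ) (D : Finset Γ) (p : Γ) : SimpleGraph D :=
  G.comap fun δ => (δ : Γ)⁻¹ * p

theorem BallsAgree.of_viewGraph_walk (w : (viewGraph G D p).Walk δ δ')
    (h : BallsAgree G ι G' ι' (t + w.length) ((δ : Γ)⁻¹ * p) ((δ : Γ)⁻¹ * p')) :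
    (viewGraph G' D p').Reachable δ δ' ∧
      BallsAgree G ι G' ι' t ((δ' : Γ)⁻¹ * p) ((δ' : Γ)⁻¹ * p') := by
  induction w with
  | nil => exact ⟨SimpleGraph.Reachable.refl _, h⟩
  | @cons a b c hab w ih =>
    rw [SimpleGraph.Walk.length_cons, ← add_assoc] at h
    have hab' : G.Adj ((a : Γ)⁻¹ * p) ((b : Γ)⁻¹ * p) := hab
    have hmove : ∀ p : Γ, (b : Γ)⁻¹ * (a : Γ) * ((a : Γ)⁻¹ * p) = (b : Γ)⁻¹ * p :=
      fun p => by group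
    have hstep := h.2 ((b : Γ)⁻¹ * (a : Γ))
    rw [hmove, hmove] at hstep
    obtain ⟨hreach, hagree⟩ := ih (hstep.2 hab')
    have hadj : (viewGraph G' D p').Adj a b := hstep.1.1 hab'
    exact ⟨hadj.reachable.trans hreach, hagree⟩

theorem BallsAgree.of_viewGraph_reachable (hr : (viewGraph G D p).Reachable δ δ')
    (h : BallsAgree G ι G' ι' (t + D.card) ((δ : Γ)⁻¹ * p) ((δ : Γ)⁻¹ * p')) :
    (viewGraph G' D p').Reachable δ δ' ∧
      BallsAgree G ι G' ι' t ((δ' : Γ)⁻¹ * p) ((δ' : Γ)⁻¹ * p') := by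
  classical
  obtain ⟨w, hw⟩ := hr.exists_isPath
  have hlen := hw.length_lt
  rw [Fintype.card_coe] at hlen
  exact BallsAgree.of_viewGraph_walk w (h.of_le (by omega))

theorem BallsAgree.viewGraph_reachable_iff
    (h : BallsAgree G ι G' ι' (t + D.card) ((δ : Γ)⁻¹ * p) ((δ : Γ)⁻¹ * p')) :
    (viewGraph G D p).Reachable δ δ' ↔ (viewGraph G' D p').Reachable δ δ' :=
  ⟨fun hr => (BallsAgree.of_viewGraph_reachable hr h).1,
    fun hr => (BallsAgree.of_viewGraph_reachable hr h.symm).1⟩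

/-- An identifier of the view `v`, common to all views connected with it. -/
noncomputable def viewIdent (G : SimpleGraph Γ) (ι : Γ → ℕ) (v : Γ × D) : ℕ :=
  sInf {c | ∃ δ : D, (viewGraph G D v.1).Reachable v.2 δ ∧
    c = D.card * ι ((δ : Γ)⁻¹ * v.1) + D.equivFin δ}

theorem exists_viewIdent_eq (G : SimpleGraph Γ) (ι : Γ → ℕ) (v : Γ × D) :
    ∃ δ : D, (viewGraph G D v.1).Reachable v.2 δ ∧
      viewIdent G ι v = D.card * ι ((δ : Γ)⁻¹ * v.1) + D.equivFin δ :=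
  Nat.sInf_mem (s := {c | ∃ δ : D, (viewGraph G D v.1).Reachable v.2 δ ∧
    c = D.card * ι ((δ : Γ)⁻¹ * v.1) + D.equivFin δ}) ⟨_, v.2, SimpleGraph.Reachable.refl _, rfl⟩

theorem viewIdent_lt {n : ℕ} (hι : ∀ x, ι x ≤ n) (v : Γ × D) :
    viewIdent G ι v < D.card * (n + 1) := by
  obtain ⟨δ, -, e⟩ := exists_viewIdent_eq G ι v
  rw [e, mul_add, mul_one]
  exact add_lt_add_of_le_of_lt (Nat.mul_le_mul_left _ (hι _)) (D.equivFin δ).2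

theorem BallsAgree.viewIdent_eq
    (h : BallsAgree G ι G' ι' D.card ((δ : Γ)⁻¹ * p) ((δ : Γ)⁻¹ * p')) :
    viewIdent G ι (p, δ) = viewIdent G' ι' (p', δ) := by
  rw [← zero_add D.card] at h
  refine congrArg sInf (Set.ext fun c => exists_congr fun δ' => ?_)
  refine (and_congr_left' h.viewGraph_reachable_iff).trans (and_congr_right fun hr => ?_)
  rw [(h.of_viewGraph_reachable (h.viewGraph_reachable_iff.2 hr)).2.ident_eq]

theorem viewIdent_eq_of_reachable (h : (viewGraph G D p).Reachable δ δ') :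
    viewIdent G ι (p, δ) = viewIdent G ι (p, δ') :=
  congrArg sInf (Set.ext fun _ => exists_congr fun _ =>
    and_congr_left fun _ => ⟨h.symm.trans, h.trans⟩)

theorem inv_mul_mem_of_reachable {V : Set Γ} (hV : G.support ⊆ V)
    (h : (viewGraph G D p).Reachable δ δ') (hδ : (δ : Γ)⁻¹ * p ∈ V) : (δ' : Γ)⁻¹ * p ∈ V := by
  obtain ⟨w⟩ := h
  induction w with
  | nil => exact hδ
  | @cons a b _ hab _ ih =>
    exact ih (hV (G.mem_support.2 ⟨(a : Γ)⁻¹ * p, SimpleGraph.Adj.symm hab⟩))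

theorem viewIdent_ne {V : Set Γ} (hV : G.support ⊆ V) (hι : Set.InjOn ι V) (hx : x ∈ V)
    (hne : δ ≠ δ') : viewIdent G ι ((δ : Γ) * x, δ) ≠ viewIdent G ι ((δ' : Γ) * x, δ') := by
  intro h
  obtain ⟨a, ha, hda⟩ := exists_viewIdent_eq G ι ((δ : Γ) * x, δ)
  obtain ⟨b, hb, hdb⟩ := exists_viewIdent_eq G ι ((δ' : Γ) * x, δ')
  simp only at ha hb hda hdb
  rw [hda, hdb] at h
  have hab : a = b := by
    have hmod := congrArg (· % D.card) h
    simp only [Nat.mul_add_mod, Nat.mod_eq_of_lt (D.equivFin _).2] at hmod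
    exact D.equivFin.injective (Fin.ext hmod)
  subst hab
  have hident := Nat.eq_of_mul_eq_mul_left (Fin.pos (D.equivFin a)) (Nat.add_right_cancel h)
  have hpoint := hι (inv_mul_mem_of_reachable hV ha (by simpa using hx))
    (inv_mul_mem_of_reachable hV hb (by simpa using hx)) hident
  exact hne (Subtype.ext (mul_right_cancel (mul_left_cancel hpoint)))

open Classical in
/-- The map along which the identifiers of views are reduced. It sends a view connected with
`(p, s.1)` to `(s.2 * s.1⁻¹ * p, s.2)`, which is taken from the same vertex as `(p, s.1)`, and fixes
all other views. -/
noncomputable def slotMap (G : SimpleGraph Γ) (s : D × D) (v : Γ × D) : Γ × D :=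
  if (viewGraph G D v.1).Reachable v.2 s.1 then ((s.2 : Γ) * (s.1 : Γ)⁻¹ * v.1, s.2) else v

theorem slotMap_mul_right (G : SimpleGraph Γ) (δ δ' : D) (x : Γ) :
    slotMap G (δ, δ') ((δ : Γ) * x, δ) = ((δ' : Γ) * x, δ') := by
  rw [slotMap, if_pos (SimpleGraph.Reachable.refl _), mul_assoc, inv_mul_cancel_left]

theorem BallsAgree.apply_slotMap {s : D × D} {v v' : Γ × D} (hv : v.2 = v'.2)
    (h : BallsAgree G ι G' ι' (t + D.card) ((v.2 : Γ)⁻¹ * v.1) ((v'.2 : Γ)⁻¹ * v'.1)) :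
    (slotMap G s v).2 = (slotMap G' s v').2 ∧
      BallsAgree G ι G' ι' t (((slotMap G s v).2 : Γ)⁻¹ * (slotMap G s v).1)
        (((slotMap G' s v').2 : Γ)⁻¹ * (slotMap G' s v').1) := by
  obtain ⟨p, δ⟩ := v
  obtain ⟨p', δ'⟩ := v'
  obtain rfl : δ = δ' := hv
  have hiff := h.viewGraph_reachable_iff (δ' := s.1)
  unfold slotMap
  by_cases hr : (viewGraph G D p).Reachable δ s.1
  · rw [if_pos hr, if_pos (hiff.1 hr)]
    simp only [mul_assoc, inv_mul_cancel_left, true_and]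
    exact (h.of_viewGraph_reachable hr).2
  · rw [if_neg hr, if_neg (mt hiff.2 hr)]
    exact ⟨rfl, h.of_le (by omega)⟩

theorem BallsAgree.iterate_slotMap {j : ℕ} {s : D × D} {v v' : Γ × D} (hv : v.2 = v'.2)
    (h : BallsAgree G ι G' ι' (t + j * D.card) ((v.2 : Γ)⁻¹ * v.1) ((v'.2 : Γ)⁻¹ * v'.1)) :
    ((slotMap G s)^[j] v).2 = ((slotMap G' s)^[j] v').2 ∧
      BallsAgree G ι G' ι' t
        ((((slotMap G s)^[j] v).2 : Γ)⁻¹ * ((slotMap G s)^[j] v).1)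
        ((((slotMap G' s)^[j] v').2 : Γ)⁻¹ * ((slotMap G' s)^[j] v').1) := by
  induction j generalizing v v' with
  | zero => exact ⟨hv, by simpa using h⟩
  | succ j ih =>
    rw [Nat.succ_mul, ← add_assoc] at h
    obtain ⟨hsnd, hagree⟩ := BallsAgree.apply_slotMap (s := s) hv h
    exact ih hsnd hagree

theorem viewIdent_slotMap_iterate {s : D × D} (h : (viewGraph G D p).Reachable δ δ') (j : ℕ) :
    viewIdent G ι ((slotMap G s)^[j] (p, δ)) = viewIdent G ι ((slotMap G s)^[j] (p, δ')) := by
  induction j with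
  | zero => exact viewIdent_eq_of_reachable h
  | succ j ih =>
    rw [Function.iterate_succ_apply, Function.iterate_succ_apply]
    by_cases hr : (viewGraph G D p).Reachable δ s.1
    · rw [slotMap, slotMap, if_pos hr, if_pos (h.symm.trans hr)]
    · rw [slotMap, slotMap, if_neg hr, if_neg fun h' => hr (h.trans h')]
      exact ih

/-- The result of `t` steps of color reduction along `slotMap G s`, from the identifiers of the
views. -/
noncomputable def slotColor (G : SimpleGraph Γ) (ι : Γ → ℕ) (t : ℕ) (s : D × D) (v : Γ × D) : ℕ :=
  cvIter t fun j => viewIdent G ι ((slotMap G s)^[j] v)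

theorem BallsAgree.slotColor_eq {s : D × D}
    (h : BallsAgree G ι G' ι' ((t + 1) * D.card) ((δ : Γ)⁻¹ * p) ((δ : Γ)⁻¹ * p')) :
    slotColor G ι t s (p, δ) = slotColor G' ι' t s (p', δ) := by
  refine cvIter_congr fun j hj => ?_
  have hj' : BallsAgree G ι G' ι' (D.card + j * D.card) ((δ : Γ)⁻¹ * p) ((δ : Γ)⁻¹ * p') :=
    h.of_le (by nlinarith)
  obtain ⟨hsnd, hagree⟩ :=
    BallsAgree.iterate_slotMap (s := s) (v := (p, δ)) (v' := (p', δ)) rfl hj'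
  rw [← hsnd] at hagree
  exact hagree.viewIdent_eq.trans (congrArg (viewIdent G' ι') (Prod.ext rfl hsnd))

theorem slotColor_eq_of_reachable {s : D × D} (h : (viewGraph G D p).Reachable δ δ') :
    slotColor G ι t s (p, δ) = slotColor G ι t s (p, δ') :=
  cvIter_congr fun j _ => viewIdent_slotMap_iterate h j

theorem slotColor_ne {V : Set Γ} (hV : G.support ⊆ V) (hι : Set.InjOn ι V) (hx : x ∈ V)
    (hne : δ ≠ δ') (t : ℕ) :
    slotColor G ι t (δ, δ') ((δ : Γ) * x, δ) ≠ slotColor G ι t (δ, δ') ((δ' : Γ) * x, δ') := by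
  have h := cvIter_ne (t := t)
    (u := fun j => viewIdent G ι ((slotMap G (δ, δ'))^[j] ((δ : Γ) * x, δ))) (by
      simp only [Function.iterate_zero_apply, Function.iterate_one, slotMap_mul_right]
      exact viewIdent_ne hV hι hx hne)
  simp only [Function.iterate_succ_apply, slotMap_mul_right] at h
  exact h

theorem slotColor_lt_six {n : ℕ} (hn : 1 ≤ n) (hι : ∀ x, ι x ≤ n)
    (ht : cvBound^[t] (D.card * (n + 1)) ≤ 6) (s : D × D) (v : Γ × D) :
    slotColor G ι t s v < 6 := by
  have hD : 0 < D.card := Finset.card_pos.2 ⟨_, v.2.2⟩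
  exact (cvIter_lt (by nlinarith) fun j _ => viewIdent_lt hι _).trans_le ht

/-- An enumeration of the families of six-colorings indexed by `D × D`, whose number explains the
choice of `n` in `H_{D,n}`. -/
noncomputable def slotColorsEquiv (D : Finset Γ) : (D × D → Fin 6) ≃ Fin (6 ^ D.card ^ 2) := by
  classical
  exact Fintype.equivFinOfCardEq (by simp [sq])

/-- The colors of the views `(δ * x, δ)` from `x`, for all slots together. Colors that are still
at least `6` are reduced modulo `6`. -/
noncomputable def viewColor (G : SimpleGraph Γ) (ι : Γ → ℕ) (D : Finset Γ) (t : ℕ) (x : Γ) (δ : D) :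
    Fin (6 ^ D.card ^ 2) :=
  slotColorsEquiv D fun s => Fin.ofNat 6 (slotColor G ι t s ((δ : Γ) * x, δ))

theorem viewColor_eq_of_slotColor_eq
    (h : ∀ s, slotColor G ι t s ((δ : Γ) * x, δ) = slotColor G' ι' t s ((δ' : Γ) * x', δ')) :
    viewColor G ι D t x δ = viewColor G' ι' D t x' δ' :=
  congrArg (slotColorsEquiv D) (funext fun s => congrArg (Fin.ofNat 6) (h s))

theorem BallsAgree.viewColor_eq (h : BallsAgree G ι G' ι' ((t + 1) * D.card) x x') :
    viewColor G ι D t x = viewColor G' ι' D t x' :=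
  funext fun δ => viewColor_eq_of_slotColor_eq fun _ => BallsAgree.slotColor_eq (by simpa using h)

theorem viewColor_eq_of_adj (hadj : G.Adj x x') (h : (δ : Γ) * x = δ' * x') :
    viewColor G ι D t x δ = viewColor G ι D t x' δ' := by
  refine viewColor_eq_of_slotColor_eq fun s => ?_
  rw [h]
  refine slotColor_eq_of_reachable (SimpleGraph.Adj.reachable ?_)
  change G.Adj ((δ : Γ)⁻¹ * (δ' * x')) ((δ' : Γ)⁻¹ * (δ' * x'))
  rwa [← h, inv_mul_cancel_left, h, inv_mul_cancel_left]

theorem viewColor_injective {V : Set Γ} (hV : G.support ⊆ V) (hι : Set.InjOn ι V) (hx : x ∈ V)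
    (hlt : ∀ (s : D × D) v, slotColor G ι t s v < 6) :
    Function.Injective (viewColor G ι D t x) := by
  intro δ δ' h
  by_contra hne
  have hmod := congrArg Fin.val (congrFun ((slotColorsEquiv D).injective h) (δ, δ'))
  simp only [Fin.ofNat_eq_cast, Fin.val_natCast, Nat.mod_eq_of_lt (hlt _ _)] at hmod
  exact slotColor_ne hV hι hx hne t hmod

open Classical in
/-- The rule that applies the coloring `F` of `H_{D,n}` to the colors of the views from `x`. The
color `c` is a default. -/
noncomputable def viewRule {k : ℕ} (F : ((D : Set Γ) ↪ Fin (6 ^ D.card ^ 2)) → Fin k)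
    (c : Fin k) (t : ℕ) (G : SimpleGraph Γ) (ι : Γ → ℕ) (x : Γ) : Fin k :=
  if h : Function.Injective (viewColor G ι D t x) then F ⟨viewColor G ι D t x, h⟩ else c

theorem BallsAgree.viewRule_eq {k : ℕ} (F : ((D : Set Γ) ↪ Fin (6 ^ D.card ^ 2)) → Fin k)
    (c : Fin k) (h : BallsAgree G ι G' ι' ((t + 1) * D.card) x x') :
    viewRule F c t G ι x = viewRule F c t G' ι' x' := by
  unfold viewRule
  simp only [h.viewColor_eq]

end Views

theorem isBigO_logStar_add_mul (c d : ℕ) :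
    (fun n => (((logStar n + c) * d : ℕ) : ℝ)) =O[Filter.atTop] fun n => (logStar n : ℝ) := by
  refine Asymptotics.IsBigO.of_bound (((c + 1) * d : ℕ) : ℝ) ?_
  filter_upwards [Filter.eventually_ge_atTop 2] with n hn
  rw [Real.norm_natCast, Real.norm_natCast]
  have hlog := one_le_logStar hn
  have hle : (logStar n + c) * d ≤ (c + 1) * d * logStar n := by
    calc (logStar n + c) * d ≤ ((c + 1) * logStar n) * d := by
          gcongr
          nlinarith
      _ = (c + 1) * d * logStar n := by ring
  exact_mod_cast hle

section

variable {Γ : Type u} [Group Γ] {S : Set Γ} {k : ℕ} {P : Set (Pattern Γ k)} {D : Finset Γ}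

theorem avoidsOnGraph_viewRule (hD : S ∪ S⁻¹ ∪ {1} ⊆ (D : Set Γ))
    {F : ((D : Set Γ) ↪ Fin (6 ^ D.card ^ 2)) → Fin k}
    (hF : AvoidsOnGraph P (tileGraph S D hD (6 ^ D.card ^ 2)) F) (c : Fin k) {t : ℕ}
    {H : (cayleyGraph S).graph.Subgraph} {ι : Γ → ℕ} (hι : Set.InjOn ι H.verts)
    (hlt : ∀ x ∈ H.verts, ∀ (s : D × D) v, slotColor H.spanningCoe ι t s v < 6) :
    AvoidsOnGraph P ((cayleyGraph S).ofSubgraph H)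
      fun x : H.verts => viewRule F c t H.spanningCoe ι x := by
  have hV : H.spanningCoe.support ⊆ H.verts := by
    intro x hx
    obtain ⟨y, hxy⟩ := (SimpleGraph.mem_support _).1 hx
    exact SimpleGraph.Subgraph.Adj.fst_mem hxy
  have hinj : ∀ x : H.verts, Function.Injective (viewColor H.spanningCoe ι D t x) :=
    fun x => viewColor_injective hV hι x.2 (hlt x x.2)
  let q (x : H.verts) : (D : Set Γ) ↪ Fin (6 ^ D.card ^ 2) := ⟨_, hinj x⟩
  have hq : (fun x : H.verts => viewRule F c t H.spanningCoe ι x) = F ∘ q :=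
    funext fun x => dif_pos (hinj x)
  rw [hq]
  refine hF.comp (isHom_tileGraph hD ?_ ?_)
  · exact fun x y h => mul_inv_ne_one_of_adj (H.coe_adj_sub _ _ h)
  · intro x y h δ δ' e
    have hpoint : (δ : Γ) * x = δ' * y := by
      rw [show (δ : Γ) = δ' * ((y : Γ) * (x : Γ)⁻¹) from e, mul_assoc, inv_mul_cancel_right]
    exact viewColor_eq_of_adj h hpoint

theorem exists_localAlgorithm_of_tileGraph (hk : 1 ≤ k) (hD : S ∪ S⁻¹ ∪ {1} ⊆ (D : Set Γ))
    {F : ((D : Set Γ) ↪ Fin (6 ^ D.card ^ 2)) → Fin k}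
    (hF : AvoidsOnGraph P (tileGraph S D hD (6 ^ D.card ^ 2)) F) :
    ∃ (A : LocalAlgorithm Γ k) (T : ℕ → ℕ),
      (fun n => (T n : ℝ)) =O[Filter.atTop] (fun n => (logStar n : ℝ)) ∧ A.Solves S P T := by
  obtain ⟨c, hc⟩ := exists_cvBound_iterate_logStar_le D.card
  let T : ℕ → ℕ := fun n => (logStar n + c + 1) * D.card
  refine ⟨gatherAlgorithm T (fun n => viewRule F ⟨0, hk⟩ (logStar n + c)) ⟨0, hk⟩, T,
    isBigO_logStar_add_mul (c + 1) D.card, ?_⟩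
  intro n H hfin hcard ident hinj hident
  rw [show (gatherAlgorithm T _ _).run n _ ident (T n) = _ from
    funext (gatherAlgorithm_run (fun _ _ _ _ _ _ _ h => h.viewRule_eq F _) _ n H ident)]
  refine avoidsOnGraph_viewRule hD hF _ (injOn_extendIdent hinj) fun x hx => ?_
  exact slotColor_lt_six (hcard ▸ (Set.ncard_pos hfin).2 ⟨x, hx⟩)
    (extendIdent_le fun x => (hident x).2) (hc n)

end

/-! ### Generic translates -/

section Generic

theorem exists_seq_notMem {α : Type*} [Infinite α] [DecidableEq α] (f : Finset α → Finset α) :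
    ∃ t : ℕ → α, ∀ m, t m ∉ f ((Finset.range m).image t) := by
  choose pick hpick using fun A => Infinite.exists_notMem_finset (f A)
  let A : ℕ → Finset α := fun m => Nat.rec ∅ (fun _ A => insert (pick A) A) m
  have hA (m : ℕ) : A m = (Finset.range m).image fun i => pick (A i) := by
    induction m with
    | zero => rfl
    | succ m ih => rw [Finset.range_add_one, Finset.image_insert, ← ih]
  exact ⟨fun m => pick (A m), fun m => hA m ▸ hpick (A m)⟩

variable {Γ : Type u} [Group Γ]

/-- The set `T t_l y` meets `T t_m x` for some `m ≠ l`. -/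
def MeetsOther {X : Type*} [MulAction Γ X] (T : Finset Γ) (t : ℕ → Γ) (x y : X) (l : ℕ) : Prop :=
  ∃ m ≠ l, ∃ a ∈ T, ∃ a' ∈ T, (a * t l) • y = (a' * t m) • x

/-- The translates `T t_m` are in general position: they are pairwise disjoint, even after
multiplication by elements of `P ∪ T T⁻¹`, and for each `θ` at most two of the sets `T t_l θ` meet a
translate with a different index. -/
structure IsGeneric [DecidableEq Γ] (T P : Finset Γ) (t : ℕ → Γ) : Prop where
  spread : ∀ {m m' : ℕ} {a a' p : Γ}, a ∈ T → a' ∈ T → p ∈ P ∪ T * T⁻¹ →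
    a * t m = p * (a' * t m') → m = m'
  meets : ∀ {θ : Γ} {l₁ l₂ l₃ : ℕ}, MeetsOther T t 1 θ l₁ → MeetsOther T t 1 θ l₂ →
    MeetsOther T t 1 θ l₃ → l₁ = l₂ ∨ l₁ = l₃ ∨ l₂ = l₃

/-- The inductive form of general position: no element of `T t_m` is obtained from elements of
earlier translates by one of the finitely many products which have to be excluded. -/
structure IsInductivelyGeneric [DecidableEq Γ] (T R : Finset Γ) (t : ℕ → Γ) : Prop where
  ne_mul : ∀ {m i : ℕ} {a b p : Γ}, i < m → a ∈ T → b ∈ T → p ∈ R ∪ R⁻¹ →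
    a * t m ≠ p * (b * t i)
  ne_mul_inv_mul : ∀ {m i j l : ℕ} {a b c d : Γ}, i < m → j < m → l < m → a ∈ T → b ∈ T →
    c ∈ T → d ∈ T → a * t m ≠ b * t i * (c * t j)⁻¹ * (d * t l)

theorem exists_isInductivelyGeneric [Infinite Γ] [DecidableEq Γ] (T R : Finset Γ) :
    ∃ t : ℕ → Γ, IsInductivelyGeneric T R t := by
  obtain ⟨t, ht⟩ := exists_seq_notMem fun A : Finset Γ =>
    T⁻¹ * ((R ∪ R⁻¹) * (T * A)) ∪ T⁻¹ * (T * A * (T * A)⁻¹ * (T * A))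
  have hmem {i m : ℕ} {a : Γ} (hi : i < m) (ha : a ∈ T) :
      a * t i ∈ T * (Finset.range m).image t :=
    Finset.mul_mem_mul ha (Finset.mem_image_of_mem t (Finset.mem_range.2 hi))
  refine ⟨t, ?_, ?_⟩
  · intro m i a b p him ha hb hp h
    refine ht m (Finset.mem_union_left _ ?_)
    rw [eq_inv_mul_of_mul_eq h]
    exact Finset.mul_mem_mul (Finset.inv_mem_inv ha) (Finset.mul_mem_mul hp (hmem him hb))
  · intro m i j l a b c d him hjm hlm ha hb hc hd h
    refine ht m (Finset.mem_union_right _ ?_)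
    rw [eq_inv_mul_of_mul_eq h]
    exact Finset.mul_mem_mul (Finset.inv_mem_inv ha) (Finset.mul_mem_mul (Finset.mul_mem_mul
      (hmem him hb) (Finset.inv_mem_inv (hmem hjm hc))) (hmem hlm hd))

namespace IsInductivelyGeneric

variable [DecidableEq Γ] {T R : Finset Γ} {t : ℕ → Γ} {m m' l l' : ℕ} {a a' b b' p θ : Γ}

theorem eq_of_eq_mul (h : IsInductivelyGeneric T R t) (ha : a ∈ T) (ha' : a' ∈ T) (hp : p ∈ R)
    (e : a * t m = p * (a' * t m')) : m = m' := by
  rcases lt_trichotomy m m' with hlt | rfl | hlt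
  · exact absurd (eq_inv_mul_of_mul_eq e.symm)
      (h.ne_mul hlt ha' ha (Finset.mem_union_right _ (Finset.inv_mem_inv hp)))
  · rfl
  · exact absurd e (h.ne_mul hlt ha ha' (Finset.mem_union_left _ hp))

theorem max_le_max (h : IsInductivelyGeneric T R t) (ha : a ∈ T) (ha' : a' ∈ T) (hb : b ∈ T)
    (hb' : b' ∈ T) (hne : l ≠ m) (e : a * t l * θ = a' * t m) (e' : b * t l' * θ = b' * t m') :
    max l m ≤ max l' m' := by
  by_contra! hlt
  obtain ⟨hl', hm'⟩ := max_lt_iff.1 hlt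
  have hθ : θ = (b * t l')⁻¹ * (b' * t m') := eq_inv_mul_of_mul_eq e'
  rcases lt_or_gt_of_ne hne with hlm | hml
  · rw [max_eq_right hlm.le] at hl' hm'
    refine h.ne_mul_inv_mul hlm hl' hm' ha' ha hb hb' ?_
    rw [← e, hθ, mul_assoc (a * t l)]
  · rw [max_eq_left hml.le] at hl' hm'
    refine h.ne_mul_inv_mul hml hm' hl' ha ha' hb' hb ?_
    rw [eq_mul_inv_of_mul_eq e, hθ, mul_inv_rev, inv_inv, mul_assoc (a' * t m)]

/-- Whenever `T t_l θ` meets `T t_m` with `m ≠ l`, the maximum of `l` and `m` is the same, so that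
at most two values of `l` are possible. -/
theorem isGeneric {P : Finset Γ} (h : IsInductivelyGeneric T (P ∪ T * T⁻¹) t) :
    IsGeneric T P t := by
  refine ⟨h.eq_of_eq_mul, ?_⟩
  have heq {θ : Γ} {l l' m : ℕ} {a a' b b' : Γ} (ha : a ∈ T) (ha' : a' ∈ T) (hb : b ∈ T)
      (hb' : b' ∈ T) (e : a * t l * θ = a' * t m) (e' : b * t l' * θ = b' * t m) : l = l' := by
    refine h.eq_of_eq_mul ha hb (p := a' * b'⁻¹)
      (Finset.mem_union_right _ (Finset.mul_mem_mul ha' (Finset.inv_mem_inv hb'))) ?_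
    rw [eq_mul_inv_of_mul_eq e, eq_mul_inv_of_mul_eq e']
    group
  rintro θ l₁ l₂ l₃ ⟨m₁, n₁, a₁, ha₁, b₁, hb₁, e₁⟩ ⟨m₂, n₂, a₂, ha₂, b₂, hb₂, e₂⟩
    ⟨m₃, n₃, a₃, ha₃, b₃, hb₃, e₃⟩
  simp only [smul_eq_mul, mul_one] at e₁ e₂ e₃
  have hmax₁₂ : max l₁ m₁ = max l₂ m₂ := le_antisymm (h.max_le_max ha₁ hb₁ ha₂ hb₂ n₁.symm e₁ e₂)
    (h.max_le_max ha₂ hb₂ ha₁ hb₁ n₂.symm e₂ e₁)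
  have hmax₁₃ : max l₁ m₁ = max l₃ m₃ := le_antisymm (h.max_le_max ha₁ hb₁ ha₃ hb₃ n₁.symm e₁ e₃)
    (h.max_le_max ha₃ hb₃ ha₁ hb₁ n₃.symm e₃ e₁)
  have h₁₂ : m₁ = m₂ → l₁ = l₂ := by rintro rfl; exact heq ha₁ hb₁ ha₂ hb₂ e₁ e₂
  have h₁₃ : m₁ = m₃ → l₁ = l₃ := by rintro rfl; exact heq ha₁ hb₁ ha₃ hb₃ e₁ e₃
  have h₂₃ : m₂ = m₃ → l₂ = l₃ := by rintro rfl; exact heq ha₂ hb₂ ha₃ hb₃ e₂ e₃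
  lia

end IsInductivelyGeneric

theorem exists_isGeneric [Infinite Γ] [DecidableEq Γ] (T P : Finset Γ) :
    ∃ t : ℕ → Γ, IsGeneric T P t :=
  (exists_isInductivelyGeneric T (P ∪ T * T⁻¹)).imp fun _ h => h.isGeneric

variable {X : Type*} [MulAction Γ X] {T : Finset Γ} {t : ℕ → Γ} {x y : X} {l l₁ l₂ l₃ : ℕ}

theorem MeetsOther.exists_eq_smul (h : MeetsOther T t x y l) : ∃ θ : Γ, y = θ • x := by
  obtain ⟨m, -, a, -, a', -, e⟩ := h
  exact ⟨(a * t l)⁻¹ * (a' * t m), by rw [mul_smul, ← e, inv_smul_smul]⟩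

theorem MeetsOther.of_smul (hfree : IsFreeAction Γ X) {θ : Γ} (h : MeetsOther T t x (θ • x) l) :
    MeetsOther T t 1 θ l := by
  obtain ⟨m, hm, a, ha, a', ha', e⟩ := h
  rw [smul_smul] at e
  exact ⟨m, hm, a, ha, a', ha', by simpa using hfree.eq_of_smul_eq e⟩

theorem IsGeneric.meets_smul [DecidableEq Γ] {P : Finset Γ} (h : IsGeneric T P t)
    (hfree : IsFreeAction Γ X) (h₁ : MeetsOther T t x y l₁) (h₂ : MeetsOther T t x y l₂)
    (h₃ : MeetsOther T t x y l₃) : l₁ = l₂ ∨ l₁ = l₃ ∨ l₂ = l₃ := by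
  obtain ⟨θ, rfl⟩ := h₁.exists_eq_smul
  exact h.meets (h₁.of_smul hfree) (h₂.of_smul hfree) (h₃.of_smul hfree)

theorem IsGeneric.card_filter_meetsOther_le_two [DecidableEq Γ] {P : Finset Γ}
    (h : IsGeneric T P t) (hfree : IsFreeAction Γ X) (s : Finset ℕ)
    [DecidablePred (MeetsOther T t x y)] : (s.filter (MeetsOther T t x y)).card ≤ 2 := by
  by_contra! hlt
  obtain ⟨a, ha, b, hb, c, hc, hab, hac, hbc⟩ := Finset.two_lt_card.1 hlt
  simp only [Finset.mem_filter] at ha hb hc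
  rcases h.meets_smul hfree ha.2 hb.2 hc.2 with e | e | e
  · exact hab e
  · exact hac e
  · exact hbc e

end Generic

/-! ### Levels -/

/-- The parameters of one level of the coding of markers: positions `T t_l` for the bits that are
written around a marker, the set `P` of displacements from earlier levels, the number `n` of bits of
a marker color, and the translations `s` by which `T` is enlarged for the next level. -/
structure Level (Γ : Type u) where
  T : Finset Γ
  P : Finset Γ
  n : ℕ
  t : ℕ → Γ
  s : ℕ → Γ

namespace Level

variable {Γ : Type u} [Group Γ] [DecidableEq Γ] (L : Level Γ) (γ : Γ)

/-- The positions around a marker in which bits may be written. -/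
def Q : Finset Γ := L.T * (Finset.range (8 * L.n)).image L.t

/-- The positions around a marker which later levels have to avoid. -/
def K : Finset Γ := L.P * L.Q

/-- The set `T` of the next level, which has to contain an unreserved position in every window. -/
def nextT : Finset Γ := L.T * (Finset.range 5).image L.s

/-- The set `P` of the next level. -/
def nextP : Finset Γ := L.P ∪ L.Q * L.Q⁻¹

/-- The displacements from a marker within which it influences its surroundings. -/
def reach : Finset Γ := L.nextT⁻¹ * L.K ∪ L.Q⁻¹ * L.Q ∪ L.K

/-- Distinct markers do not differ by elements of this set. -/
def sep : Finset Γ := L.reach⁻¹ * L.reach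

/-- The conjugates of `γ` that have to be detected at markers. -/
def conjugates : Finset Γ := (insert 1 L.sep).image fun δ => δ * γ * δ⁻¹

/-- Distinct markers that differ by elements of this set get distinct colors. -/
def colorSep : Finset Γ := L.Q⁻¹ * L.Q * L.conjugates γ ∪ (L.Q⁻¹ * L.Q * L.conjugates γ)⁻¹

/-- The translations of a level are generic, and its colors have enough bits. -/
structure IsGood : Prop where
  t_generic : IsGeneric L.T L.P L.t
  s_generic : IsGeneric L.T (L.P ∪ L.K * L.K⁻¹) L.s
  one_le_n : 1 ≤ L.n
  card_lt : (L.colorSep γ).card < 2 ^ L.n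

variable {γ}

theorem card_mul_image_range_le (T : Finset Γ) (m : ℕ) (t : ℕ → Γ) :
    (T * (Finset.range m).image t).card ≤ m * T.card :=
  calc (T * (Finset.range m).image t).card
    _ ≤ T.card * ((Finset.range m).image t).card := Finset.card_mul_le
    _ ≤ T.card * m := by
      gcongr
      exact Finset.card_image_le.trans_eq (Finset.card_range m)
    _ = m * T.card := mul_comm _ _

theorem card_inv_mul_le (A B : Finset Γ) : (A⁻¹ * B).card ≤ A.card * B.card :=
  Finset.card_mul_le.trans_eq (by rw [Finset.card_inv])

theorem card_reach_le {q : ℕ} (hQ : L.Q.card ≤ q) (hq : 1 ≤ q) :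
    L.reach.card ≤ (5 * L.T.card * L.P.card + 1 + L.P.card) * q ^ 2 := by
  have hK : L.K.card ≤ L.P.card * q := Finset.card_mul_le.trans (by gcongr)
  have hT : L.nextT.card ≤ 5 * L.T.card := card_mul_image_range_le _ _ _
  calc L.reach.card
    _ ≤ (L.nextT⁻¹ * L.K).card + (L.Q⁻¹ * L.Q).card + L.K.card :=
      (Finset.card_union_le _ _).trans (by gcongr; exact Finset.card_union_le _ _)
    _ ≤ 5 * L.T.card * (L.P.card * q) + q * q + L.P.card * q := by
      gcongr
      · exact (card_inv_mul_le _ _).trans (by gcongr)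
      · exact (card_inv_mul_le _ _).trans (by gcongr)
    _ ≤ 5 * L.T.card * (L.P.card * (q * q)) + q * q + L.P.card * (q * q) := by
      gcongr <;> exact Nat.le_mul_of_pos_left q hq
    _ = (5 * L.T.card * L.P.card + 1 + L.P.card) * q ^ 2 := by ring

theorem card_colorSep_le (γ : Γ) : (L.colorSep γ).card ≤
    4 * (5 * L.T.card * L.P.card + 1 + L.P.card) ^ 2 * (8 * L.n * L.T.card + 1) ^ 6 := by
  set q := 8 * L.n * L.T.card + 1
  set c := 5 * L.T.card * L.P.card + 1 + L.P.card
  have hQ : L.Q.card ≤ q := (card_mul_image_range_le _ _ _).trans (Nat.le_succ _)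
  have hreach : L.reach.card ≤ c * q ^ 2 := L.card_reach_le hQ (Nat.le_add_left 1 _)
  have hsep : L.sep.card ≤ c ^ 2 * q ^ 4 :=
    calc L.sep.card ≤ L.reach.card * L.reach.card := card_inv_mul_le _ _
      _ ≤ (c * q ^ 2) * (c * q ^ 2) := by gcongr
      _ = c ^ 2 * q ^ 4 := by ring
  have hpos : 1 ≤ c ^ 2 * q ^ 4 := Nat.one_le_iff_ne_zero.2 (by positivity)
  have hconj : (L.conjugates γ).card ≤ 2 * (c ^ 2 * q ^ 4) :=
    calc (L.conjugates γ).card ≤ (insert 1 L.sep).card := Finset.card_image_le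
      _ ≤ L.sep.card + 1 := Finset.card_insert_le _ _
      _ ≤ 2 * (c ^ 2 * q ^ 4) := by lia
  have hmul : (L.Q⁻¹ * L.Q * L.conjugates γ).card ≤ q * q * (2 * (c ^ 2 * q ^ 4)) :=
    Finset.card_mul_le.trans (Nat.mul_le_mul ((card_inv_mul_le _ _).trans (by gcongr)) hconj)
  calc (L.colorSep γ).card ≤ _ := Finset.card_union_le _ _
    _ ≤ q * q * (2 * (c ^ 2 * q ^ 4)) + q * q * (2 * (c ^ 2 * q ^ 4)) := by
      rw [Finset.card_inv]
      gcongr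
    _ = 4 * c ^ 2 * q ^ 6 := by ring

variable {L}

theorem mul_t_mem_Q {l : ℕ} {a : Γ} (ha : a ∈ L.T) (hl : l < 8 * L.n) : a * L.t l ∈ L.Q :=
  Finset.mul_mem_mul ha (Finset.mem_image_of_mem _ (Finset.mem_range.2 hl))

theorem IsGood.eq_of_mul_t_mul_mem_T (hL : L.IsGood γ) {l l' : ℕ} {a a' θ : Γ} (ha : a ∈ L.T)
    (ha' : a' ∈ L.T) (h : a * L.t l * θ ∈ L.T) (h' : a' * L.t l' * θ ∈ L.T) : l = l' := by
  refine hL.t_generic.spread ha ha'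
    (Finset.mem_union_right _ (Finset.mul_mem_mul h (Finset.inv_mem_inv h'))) ?_
  group

theorem IsGood.exists_mul_mem_T (hL : L.IsGood γ) {q q' θ : Γ}
    (hq : q * q'⁻¹ ∈ L.P ∪ L.K * L.K⁻¹) (h : q * θ ∈ L.nextT) (h' : q' * θ ∈ L.nextT) :
    ∃ θ', q * θ' ∈ L.T ∧ q' * θ' ∈ L.T := by
  obtain ⟨c, hc, _, hr, e⟩ := Finset.mem_mul.1 h
  obtain ⟨c', hc', _, hr', e'⟩ := Finset.mem_mul.1 h'
  obtain ⟨r, -, rfl⟩ := Finset.mem_image.1 hr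
  obtain ⟨r', -, rfl⟩ := Finset.mem_image.1 hr'
  obtain rfl : r = r' := by
    refine hL.s_generic.spread hc hc' (Finset.mem_union_left _ hq) ?_
    rw [e, e']
    group
  refine ⟨θ * (L.s r)⁻¹, ?_, ?_⟩
  · rwa [← mul_assoc, ← e, mul_inv_cancel_right]
  · rwa [← mul_assoc, ← e', mul_inv_cancel_right]

end Level

theorem exists_level {Γ : Type u} [Group Γ] [Infinite Γ] [DecidableEq Γ] (γ : Γ)
    (T P : Finset Γ) : ∃ L : Level Γ, L.T = T ∧ L.P = P ∧ L.IsGood γ := by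
  set C := 4 * (5 * T.card * P.card + 1 + P.card) ^ 2
  obtain ⟨t, ht⟩ := exists_isGeneric T P
  obtain ⟨n, hn, hn1⟩ := ((eventually_mul_pow_lt_two_pow (C * (8 * T.card + 1) ^ 6) 6).and
    (Filter.eventually_ge_atTop 1)).exists
  obtain ⟨s, hs⟩ := exists_isGeneric T (P ∪ (Level.mk T P n t t).K * (Level.mk T P n t t).K⁻¹)
  refine ⟨⟨T, P, n, t, s⟩, rfl, rfl, ht, hs, hn1, lt_of_le_of_lt ?_ hn⟩
  calc ((Level.mk T P n t s).colorSep γ).card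
    _ ≤ C * (8 * n * T.card + 1) ^ 6 := Level.card_colorSep_le _ γ
    _ ≤ C * ((8 * T.card + 1) * (n + 1)) ^ 6 := by gcongr; nlinarith
    _ = C * (8 * T.card + 1) ^ 6 * (n + 1) ^ 6 := by ring

/-- A sequence of levels, each of which starts from the output of the previous one. -/
structure IsLevelSeq {Γ : Type u} [Group Γ] [DecidableEq Γ] (γ : ℕ → Γ) (L : ℕ → Level Γ) :
    Prop where
  T_zero : (L 0).T = {1}
  P_zero : (L 0).P = {1}
  T_succ : ∀ j, (L (j + 1)).T = (L j).nextT
  P_succ : ∀ j, (L (j + 1)).P = (L j).nextP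
  good : ∀ j, (L j).IsGood (γ j)

theorem exists_isLevelSeq {Γ : Type u} [Group Γ] [Infinite Γ] [DecidableEq Γ] (γ : ℕ → Γ) :
    ∃ L, IsLevelSeq γ L := by
  choose f hT hP hf using fun γ : Γ => exists_level γ
  let L : ℕ → Level Γ := fun j =>
    Nat.rec (f (γ 0) {1} {1}) (fun i M => f (γ (i + 1)) M.nextT M.nextP) j
  refine ⟨L, hT _ _ _, hP _ _ _, fun j => hT _ _ _, fun j => hP _ _ _, fun j => ?_⟩
  cases j <;> exact hf _ _ _

namespace IsLevelSeq

variable {Γ : Type u} [Group Γ] [DecidableEq Γ] {γ : ℕ → Γ} {L : ℕ → Level Γ} {i j : ℕ}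

theorem P_subset (h : IsLevelSeq γ L) (hij : i ≤ j) : (L i).P ⊆ (L j).P := by
  induction j, hij using Nat.le_induction with
  | base => exact subset_rfl
  | succ j _ ih => rw [h.P_succ]; exact ih.trans Finset.subset_union_left

theorem one_mem_P (h : IsLevelSeq γ L) (j : ℕ) : 1 ∈ (L j).P :=
  h.P_subset (Nat.zero_le j) (by rw [h.P_zero]; exact Finset.mem_singleton_self 1)

theorem mul_inv_mem_P (h : IsLevelSeq γ L) (hij : i < j) {a b : Γ} (ha : a ∈ (L i).Q)
    (hb : b ∈ (L i).Q) : a * b⁻¹ ∈ (L j).P := by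
  refine h.P_subset (Nat.succ_le_of_lt hij) ?_
  rw [h.P_succ]
  exact Finset.mem_union_right _ (Finset.mul_mem_mul ha (Finset.inv_mem_inv hb))

theorem Q_subset_K (h : IsLevelSeq γ L) (j : ℕ) : (L j).Q ⊆ (L j).K := fun a ha => by
  rw [← one_mul a]
  exact Finset.mul_mem_mul (h.one_mem_P j) ha

theorem mul_inv_mem_P_union (h : IsLevelSeq γ L) (hij : i ≤ j) {a b : Γ} (ha : a ∈ (L i).Q)
    (hb : b ∈ (L i).Q) : a * b⁻¹ ∈ (L j).P ∪ (L j).K * (L j).K⁻¹ := by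
  rcases hij.eq_or_lt with rfl | hlt
  · exact Finset.mem_union_right _ (Finset.mul_mem_mul (h.Q_subset_K _ ha)
      (Finset.inv_mem_inv (h.Q_subset_K _ hb)))
  · exact Finset.mem_union_left _ (h.mul_inv_mem_P hlt ha hb)

theorem exists_mul_mem_T (h : IsLevelSeq γ L) (hij : i ≤ j) {a b θ : Γ} (ha : a ∈ (L i).Q)
    (hb : b ∈ (L i).Q) (haT : a * θ ∈ (L j).T) (hbT : b * θ ∈ (L j).T) :
    ∃ θ', a * θ' ∈ (L i).T ∧ b * θ' ∈ (L i).T := by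
  induction j, hij using Nat.le_induction generalizing θ with
  | base => exact ⟨θ, haT, hbT⟩
  | succ j hij ih =>
    rw [h.T_succ] at haT hbT
    obtain ⟨θ', haT', hbT'⟩ :=
      (h.good j).exists_mul_mem_T (h.mul_inv_mem_P_union hij ha hb) haT hbT
    exact ih haT' hbT'

theorem eq_of_mul_t_mul_mem_T (h : IsLevelSeq γ L) (hij : i ≤ j) {l l' : ℕ}
    (hl : l < 8 * (L i).n) (hl' : l' < 8 * (L i).n) {a a' θ : Γ} (ha : a ∈ (L i).T)
    (ha' : a' ∈ (L i).T) (hT : a * (L i).t l * θ ∈ (L j).T)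
    (hT' : a' * (L i).t l' * θ ∈ (L j).T) : l = l' := by
  obtain ⟨θ', hθ, hθ'⟩ :=
    h.exists_mul_mem_T hij (Level.mul_t_mem_Q ha hl) (Level.mul_t_mem_Q ha' hl') hT hT'
  exact (h.good i).eq_of_mul_t_mul_mem_T ha ha' hθ hθ'

end IsLevelSeq

/-! ### Writing marker colors at generic positions -/

/-- The `l`-th bit of the code of the color `κ` is `1`. The code repeats every bit of `κ` and every
complement of a bit four times. -/
def codeBit (κ l : ℕ) : Prop := κ.testBit (l / 8) = decide (l / 4 % 2 = 0)

theorem exists_codeBit (κ : ℕ) {i n : ℕ} (hi : i < n) : ∃ l₀, ∀ l ∈ Finset.Ico l₀ (l₀ + 4),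
    l < 8 * n ∧ codeBit κ l ∧ ∀ κ' : ℕ, κ'.testBit i ≠ κ.testBit i → ¬ codeBit κ' l := by
  obtain ⟨e, he, hbit⟩ : ∃ e < 2, κ.testBit i = decide (e = 0) := by
    cases κ.testBit i
    · exact ⟨1, by norm_num, rfl⟩
    · exact ⟨0, by norm_num, rfl⟩
  refine ⟨8 * i + 4 * e, fun l hl => ?_⟩
  rw [Finset.mem_Ico] at hl
  have hindex : l / 8 = i := by lia
  have hhalf : l / 4 % 2 = e := by lia
  refine ⟨by lia, ?_, fun κ' hκ' => ?_⟩
  · rw [codeBit, hindex, hhalf, hbit]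
  · rwa [codeBit, hindex, hhalf, ← hbit]

theorem exists_testBit_ne {κ κ' n : ℕ} (hκ : κ < 2 ^ n) (hκ' : κ' < 2 ^ n) (h : κ' ≠ κ) :
    ∃ i < n, κ'.testBit i ≠ κ.testBit i := by
  by_contra! hcon
  refine h (Nat.eq_of_testBit_eq fun i => ?_)
  by_cases hi : i < n
  · exact hcon i hi
  · have hpow := Nat.pow_le_pow_right two_pos (not_lt.1 hi)
    rw [Nat.testBit_lt_two_pow (hκ.trans_le hpow), Nat.testBit_lt_two_pow (hκ'.trans_le hpow)]

theorem exists_mem_not_and_not {α : Type*} {s : Finset α} {p q : α → Prop} [DecidablePred p]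
    [DecidablePred q] (h : (s.filter p).card + (s.filter q).card < s.card) :
    ∃ x ∈ s, ¬ p x ∧ ¬ q x := by
  classical
  by_contra! hcon
  refine h.not_ge (le_trans (Finset.card_le_card fun x hx => ?_) (Finset.card_union_le _ _))
  rw [← Finset.filter_or, Finset.mem_filter]
  exact ⟨hx, or_iff_not_imp_left.2 (hcon x hx)⟩

namespace Level

variable {Γ : Type u} [Group Γ] [DecidableEq Γ] {L : Level Γ} {a b : Γ}

theorem inv_mul_mem_sep (ha : a ∈ L.reach) (hb : b ∈ L.reach) : a⁻¹ * b ∈ L.sep :=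
  Finset.mul_mem_mul (Finset.inv_mem_inv ha) hb

theorem mul_s_mem_nextT {r : ℕ} (ha : a ∈ L.T) (hr : r < 5) : a * L.s r ∈ L.nextT :=
  Finset.mul_mem_mul ha (Finset.mem_image_of_mem _ (Finset.mem_range.2 hr))

theorem inv_mul_mem_reach_of_mem_nextT (ha : a ∈ L.nextT) (hb : b ∈ L.K) : a⁻¹ * b ∈ L.reach :=
  Finset.mem_union_left _
    (Finset.mem_union_left _ (Finset.mul_mem_mul (Finset.inv_mem_inv ha) hb))

theorem inv_mul_mem_reach_of_mem_Q (ha : a ∈ L.Q) (hb : b ∈ L.Q) : a⁻¹ * b ∈ L.reach :=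
  Finset.mem_union_left _
    (Finset.mem_union_right _ (Finset.mul_mem_mul (Finset.inv_mem_inv ha) hb))

theorem mem_reach_of_mem_K (ha : a ∈ L.K) : a ∈ L.reach := Finset.mem_union_right _ ha

variable (L) in
/-- The window in which the failure of an element to be a period is detected: it extends
from any point to the positions around a nearby marker. -/
def window : Finset Γ := L.Q * insert 1 L.sep

end Level

/-- Sets of markers and colorings for each level, such that the markers are separated and syndetic
and markers which influence the same region have distinct colors. -/
structure MarkerSystem {Γ : Type u} [Group Γ] [DecidableEq Γ] (γ : ℕ → Γ) (L : ℕ → Level Γ)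
    (X : Type*) [MulAction Γ X] where
  markers : ℕ → Set X
  color : ℕ → X → ℕ
  separated : ∀ j, ∀ y ∈ markers j, ∀ r ∈ (L j).sep, r • y ∈ markers j → r • y = y
  syndetic : ∀ j x, ∃ δ ∈ insert 1 (L j).sep, δ • x ∈ markers j
  color_ne : ∀ j x, ∀ r ∈ (L j).colorSep (γ j), r • x ≠ x → color j (r • x) ≠ color j x
  color_lt : ∀ j x, color j x < 2 ^ (L j).n

namespace MarkerSystem

variable {Γ : Type u} [Group Γ] [DecidableEq Γ] {γ : ℕ → Γ} {L : ℕ → Level Γ}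
  {X : Type*} [MulAction Γ X] (m : MarkerSystem γ L X)

/-- The points that are reserved before level `j`. -/
def reserved (j : ℕ) : Set X := {x | ∃ i < j, ∃ a ∈ (L i).K, a⁻¹ • x ∈ m.markers i}

/-- The points where a `1` is written at level `j`. -/
def ones (j : ℕ) : Set X := {x | x ∉ m.reserved j ∧ ∃ a ∈ (L j).T, ∃ l < 8 * (L j).n,
  (a * (L j).t l)⁻¹ • x ∈ m.markers j ∧ codeBit (m.color j ((a * (L j).t l)⁻¹ • x)) l}

variable {m} {i i' j : ℕ} {w x y z z' : X}

theorem smul_mem_reserved (hij : i < j) {a : Γ} (ha : a ∈ (L i).K) (hy : y ∈ m.markers i) :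
    a • y ∈ m.reserved j := ⟨i, hij, a, ha, by rwa [inv_smul_smul]⟩

theorem notMem_reserved_zero (x : X) : x ∉ m.reserved 0 := by
  rintro ⟨i, hi, -⟩
  exact Nat.not_lt_zero i hi

theorem exists_eq_smul_of_mem_reserved_succ (hx : x ∉ m.reserved j)
    (hx' : x ∈ m.reserved (j + 1)) : ∃ a ∈ (L j).K, ∃ y ∈ m.markers j, x = a • y := by
  obtain ⟨i, hi, a, ha, hy⟩ := hx'
  obtain rfl | hlt := (Nat.le_of_lt_succ hi).eq_or_lt
  · exact ⟨a, ha, _, hy, (smul_inv_smul a x).symm⟩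
  · exact absurd ⟨i, hlt, a, ha, hy⟩ hx

theorem smul_mem_ones {a : Γ} {l : ℕ} (ha : a ∈ (L j).T) (hl : l < 8 * (L j).n)
    (hy : y ∈ m.markers j) (hres : (a * (L j).t l) • y ∉ m.reserved j)
    (hbit : codeBit (m.color j y) l) : (a * (L j).t l) • y ∈ m.ones j :=
  ⟨hres, a, ha, l, hl, by rwa [inv_smul_smul], by rwa [inv_smul_smul]⟩

theorem exists_of_mem_ones (hx : x ∈ m.ones j) : ∃ y ∈ m.markers j, ∃ a ∈ (L j).T,
    ∃ l < 8 * (L j).n, x = (a * (L j).t l) • y ∧ codeBit (m.color j y) l := by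
  obtain ⟨-, a, ha, l, hl, hy, hbit⟩ := hx
  exact ⟨_, hy, a, ha, l, hl, (smul_inv_smul _ x).symm, hbit⟩

theorem notMem_ones_of_lt (h : IsLevelSeq γ L) (hij : i < j) (hx : x ∉ m.reserved j) :
    x ∉ m.ones i := by
  intro hones
  obtain ⟨y, hy, a, ha, l, hl, rfl, -⟩ := exists_of_mem_ones hones
  exact hx (smul_mem_reserved hij (h.Q_subset_K i (Level.mul_t_mem_Q ha hl)) hy)

theorem eq_of_smul_eq_smul (hz : z ∈ m.markers j) (hz' : z' ∈ m.markers j) {a b a' b' : Γ}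
    (h : a⁻¹ * b ∈ (L j).reach) (h' : a'⁻¹ * b' ∈ (L j).reach) (e : a • w = b • z)
    (e' : a' • w = b' • z') : z' = z := by
  have hw : w = (a⁻¹ * b) • z := by rw [mul_smul, ← e, inv_smul_smul]
  have hw' : w = (a'⁻¹ * b') • z' := by rw [mul_smul, ← e', inv_smul_smul]
  have hzz : z' = ((a'⁻¹ * b')⁻¹ * (a⁻¹ * b)) • z := by
    rw [mul_smul, ← hw, hw', inv_smul_smul]
  rw [hzz]
  exact m.separated j z hz _ (Level.inv_mul_mem_sep h' h) (hzz ▸ hz')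

/-! ### Unreserved positions -/

theorem eq_of_mul_s_smul_eq (h : IsLevelSeq γ L) (hfree : IsFreeAction Γ X) {r r' : ℕ}
    (hr : r < 5) (hr' : r' < 5) {a a' b b' : Γ} (ha : a ∈ (L j).T) (ha' : a' ∈ (L j).T)
    (hb : b ∈ (L j).K) (hb' : b' ∈ (L j).K) (hz : z ∈ m.markers j) (hz' : z' ∈ m.markers j)
    (e : (a * (L j).s r) • w = b • z) (e' : (a' * (L j).s r') • w = b' • z') : r = r' := by
  obtain rfl : z' = z := eq_of_smul_eq_smul hz hz'
    (Level.inv_mul_mem_reach_of_mem_nextT (Level.mul_s_mem_nextT ha hr) hb)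
    (Level.inv_mul_mem_reach_of_mem_nextT (Level.mul_s_mem_nextT ha' hr') hb') e e'
  have hmul : a * (L j).s r = b * b'⁻¹ * (a' * (L j).s r') := by
    refine hfree.eq_of_smul_eq (x := w) ?_
    rw [e, mul_smul, e', smul_smul, inv_mul_cancel_right]
  exact (h.good j).s_generic.spread ha ha' (Finset.mem_union_left _ (Finset.mem_union_right _
    (Finset.mul_mem_mul hb (Finset.inv_mem_inv hb')))) hmul

theorem card_filter_mem_reserved_le_one (h : IsLevelSeq γ L) (hfree : IsFreeAction Γ X)
    {a : ℕ → Γ} (ha : ∀ r, a r ∈ (L j).T) (hx : ∀ r, (a r * (L j).s r) • x ∉ m.reserved j)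
    [DecidablePred fun r => (a r * (L j).s r) • x ∈ m.reserved (j + 1)] :
    ((Finset.range 5).filter fun r => (a r * (L j).s r) • x ∈ m.reserved (j + 1)).card ≤ 1 := by
  simp only [Finset.card_le_one, Finset.mem_filter, Finset.mem_range]
  intro r hr r' hr'
  obtain ⟨b, hb, z, hz, e⟩ := exists_eq_smul_of_mem_reserved_succ (hx r) hr.2
  obtain ⟨b', hb', z', hz', e'⟩ := exists_eq_smul_of_mem_reserved_succ (hx r') hr'.2
  exact eq_of_mul_s_smul_eq h hfree hr.1 hr'.1 (ha r) (ha r') hb hb' hz hz' e e'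

/-- Of the five translates of `T` which make up the next `T`, one may be lost to reserved positions
around `x`, one to those around `y`, and two to coincidences. -/
theorem exists_mem_T (h : IsLevelSeq γ L) (hfree : IsFreeAction Γ X) (j : ℕ) (hxy : x ≠ y) :
    ∃ a ∈ (L j).T, a • x ∉ m.reserved j ∧ a • y ∉ m.reserved j ∧ ∀ b ∈ (L j).T, a • y ≠ b • x := by
  classical
  induction j generalizing x y with
  | zero =>
    rw [h.T_zero]
    exact ⟨1, Finset.mem_singleton_self 1, notMem_reserved_zero _, notMem_reserved_zero _,
      fun b hb => by rw [Finset.mem_singleton.1 hb, one_smul, one_smul]; exact hxy.symm⟩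
  | succ j ih =>
    choose a ha hax hay hne using fun r => ih (x := (L j).s r • x) (y := (L j).s r • y)
      ((MulAction.injective _).ne hxy)
    simp only [smul_smul] at hax hay hne
    have hcard : ((Finset.range 5).filter fun r => (a r * (L j).s r) • x ∈ m.reserved (j + 1) ∨
          (a r * (L j).s r) • y ∈ m.reserved (j + 1)).card +
        ((Finset.range 5).filter (MeetsOther (L j).T (L j).s x y)).card < 5 := by
      rw [Finset.filter_or]
      linarith [card_filter_mem_reserved_le_one h hfree ha hax,
        card_filter_mem_reserved_le_one h hfree ha hay,
        (h.good j).s_generic.card_filter_meetsOther_le_two hfree (x := x) (y := y)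
          (Finset.range 5),
        Finset.card_union_le
          ((Finset.range 5).filter fun r => (a r * (L j).s r) • x ∈ m.reserved (j + 1))
          ((Finset.range 5).filter fun r => (a r * (L j).s r) • y ∈ m.reserved (j + 1))]
    obtain ⟨r, hr, hres, hmeets⟩ :=
      exists_mem_not_and_not (hcard.trans_eq (Finset.card_range 5).symm)
    rw [not_or] at hres
    rw [h.T_succ]
    refine ⟨a r * (L j).s r, Level.mul_s_mem_nextT (ha r) (Finset.mem_range.1 hr), hres.1, hres.2,
      fun b hb e => ?_⟩
    obtain ⟨c, hc, _, hr', rfl⟩ := Finset.mem_mul.1 hb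
    obtain ⟨r', -, rfl⟩ := Finset.mem_image.1 hr'
    refine hmeets ⟨r', ?_, a r, ha r, c, hc, e⟩
    rintro rfl
    exact hne r' c hc e

/-! ### Detection at markers -/

theorem level_eq_of_smul_mem_ones (h : IsLevelSeq γ L) (hi : j < i) (hii : i ≤ i') {q q' : Γ}
    (hq : q ∈ (L j).Q) (hq' : q' ∈ (L j).Q) (hx : q • x ∈ m.ones i) (hx' : q' • x ∈ m.ones i') :
    i = i' := by
  refine hii.eq_of_not_lt fun hlt => hx'.1 ?_
  obtain ⟨y, hy, b, hb, k, hk, e, -⟩ := exists_of_mem_ones hx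
  have hshift : q' • x = (q' * q⁻¹ * (b * (L i).t k)) • y := by
    rw [mul_smul _ (b * _), ← e, smul_smul, inv_mul_cancel_right]
  exact hshift ▸ smul_mem_reserved hlt
    (Finset.mul_mem_mul (h.mul_inv_mem_P hi hq' hq) (Level.mul_t_mem_Q hb hk)) hy

theorem exists_smul_eq_of_mem_ones (h : IsLevelSeq γ L) (hfree : IsFreeAction Γ X) (hi : j < i)
    {q q' : Γ} (hq : q ∈ (L j).Q) (hq' : q' ∈ (L j).Q) (hx : q • x ∈ m.ones i)
    (hx' : q' • x ∈ m.ones i) : ∃ θ, q * θ ∈ (L i).T ∧ q' * θ ∈ (L i).T := by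
  obtain ⟨y, hy, b, hb, k, hk, e, -⟩ := exists_of_mem_ones hx
  obtain ⟨y', hy', b', hb', k', hk', e', -⟩ := exists_of_mem_ones hx'
  have hP := h.mul_inv_mem_P hi hq' hq
  have hshift : (1 : Γ) • q' • x = (q' * q⁻¹ * (b * (L i).t k)) • y := by
    rw [one_smul, mul_smul _ (b * _), ← e, smul_smul, inv_mul_cancel_right]
  obtain rfl : y' = y := by
    refine eq_of_smul_eq_smul hy hy' ?_ ?_ hshift ((one_smul Γ _).trans e')
    · rw [inv_one, one_mul]
      exact Level.mem_reach_of_mem_K (Finset.mul_mem_mul hP (Level.mul_t_mem_Q hb hk))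
    · rw [inv_one, one_mul]
      exact Level.mem_reach_of_mem_K (h.Q_subset_K i (Level.mul_t_mem_Q hb' hk'))
  obtain rfl : k' = k := by
    refine (h.good i).t_generic.spread hb' hb (Finset.mem_union_left _ hP) ?_
    refine hfree.eq_of_smul_eq (x := y') ?_
    rw [← hshift, one_smul, e']
  obtain ⟨ζ, rfl⟩ : ∃ ζ : Γ, x = ζ • y' := ⟨q⁻¹ * (b * (L i).t k'), by
    rw [mul_smul, ← e, inv_smul_smul]⟩
  rw [smul_smul] at e e'
  refine ⟨ζ * ((L i).t k')⁻¹, ?_, ?_⟩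
  · rwa [← mul_assoc, hfree.eq_of_smul_eq e, mul_inv_cancel_right]
  · rwa [← mul_assoc, hfree.eq_of_smul_eq e', mul_inv_cancel_right]

theorem eq_of_mul_t_smul_mem_ones (h : IsLevelSeq γ L) (hfree : IsFreeAction Γ X) (hi : j < i)
    (hii : i ≤ i') {l l' : ℕ} (hl : l < 8 * (L j).n) (hl' : l' < 8 * (L j).n) {a a' : Γ}
    (ha : a ∈ (L j).T) (ha' : a' ∈ (L j).T) (hx : (a * (L j).t l) • x ∈ m.ones i)
    (hx' : (a' * (L j).t l') • x ∈ m.ones i') : l = l' := by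
  have hq := Level.mul_t_mem_Q ha hl
  have hq' := Level.mul_t_mem_Q ha' hl'
  obtain rfl := level_eq_of_smul_mem_ones h hi hii hq hq' hx hx'
  obtain ⟨θ, hθ, hθ'⟩ := exists_smul_eq_of_mem_ones h hfree hi hq hq' hx hx'
  exact h.eq_of_mul_t_mul_mem_T hi.le hl hl' ha ha' hθ hθ'

theorem card_filter_mem_ones_le_one (h : IsLevelSeq γ L) (hfree : IsFreeAction Γ X) {s : Finset ℕ}
    (hs : ∀ l ∈ s, l < 8 * (L j).n) {a : ℕ → Γ} (ha : ∀ l, a l ∈ (L j).T)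
    [DecidablePred fun l => ∃ i > j, (a l * (L j).t l) • x ∈ m.ones i] :
    (s.filter fun l => ∃ i > j, (a l * (L j).t l) • x ∈ m.ones i).card ≤ 1 := by
  simp only [Finset.card_le_one, Finset.mem_filter]
  rintro l ⟨hl, i, hi, hx⟩ l' ⟨hl', i', hi', hx'⟩
  rcases le_total i i' with hii | hii
  · exact eq_of_mul_t_smul_mem_ones h hfree hi hii (hs l hl) (hs l' hl') (ha l) (ha l') hx hx'
  · exact (eq_of_mul_t_smul_mem_ones h hfree hi' hii (hs l' hl') (hs l hl) (ha l') (ha l)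
      hx' hx).symm

theorem eq_of_mem_Q_of_smul_eq_smul (hz : z ∈ m.markers j) (hz' : z' ∈ m.markers j)
    {a b a' b' : Γ} (ha : a ∈ (L j).Q) (hb : b ∈ (L j).Q) (ha' : a' ∈ (L j).Q)
    (hb' : b' ∈ (L j).Q) (e : a • w = b • z) (e' : a' • w = b' • z') : z' = z :=
  eq_of_smul_eq_smul hz hz' (Level.inv_mul_mem_reach_of_mem_Q ha hb)
    (Level.inv_mul_mem_reach_of_mem_Q ha' hb') e e'

theorem exists_forall_eq_of_smul_eq_smul (j : ℕ) (w : X) : ∃ z, ∀ z' ∈ m.markers j,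
    ∀ a ∈ (L j).Q, ∀ b ∈ (L j).Q, a • w = b • z' → z' = z := by
  by_cases hz : ∃ z ∈ m.markers j, ∃ a ∈ (L j).Q, ∃ b ∈ (L j).Q, a • w = b • z
  · obtain ⟨z, hz, a, ha, b, hb, e⟩ := hz
    exact ⟨z, fun z' hz' a' ha' b' hb' e' =>
      eq_of_mem_Q_of_smul_eq_smul hz hz' ha hb ha' hb' e e'⟩
  · exact ⟨w, fun z' hz' a ha b hb e => absurd ⟨z', hz', a, ha, b, hb, e⟩ hz⟩

theorem exists_codeBit_color (h : IsLevelSeq γ L) {β : Γ} (hβ : β ∈ (L j).conjugates (γ j))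
    (y : X) : ∃ l₀, ∀ l ∈ Finset.Ico l₀ (l₀ + 4),
      l < 8 * (L j).n ∧ codeBit (m.color j y) l ∧ ∀ z ∈ m.markers j, z ≠ y →
        ∀ a ∈ (L j).Q, ∀ b ∈ (L j).Q, a • β • y = b • z → ¬ codeBit (m.color j z) l := by
  by_cases hz : ∃ z ∈ m.markers j, z ≠ y ∧ ∃ a ∈ (L j).Q, ∃ b ∈ (L j).Q, a • β • y = b • z
  · obtain ⟨z, hz, hzy, a, ha, b, hb, e⟩ := hz
    have hzβ : z = (b⁻¹ * a * β) • y := by rw [mul_smul, mul_smul, e, inv_smul_smul]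
    have hmem : b⁻¹ * a * β ∈ (L j).colorSep (γ j) := Finset.mem_union_left _
      (Finset.mul_mem_mul (Finset.mul_mem_mul (Finset.inv_mem_inv hb) ha) hβ)
    have hne : m.color j z ≠ m.color j y := by
      rw [hzβ]
      exact m.color_ne j y _ hmem (hzβ ▸ hzy)
    obtain ⟨i, hi, hbit⟩ := exists_testBit_ne (m.color_lt j y) (m.color_lt j z) hne
    obtain ⟨l₀, hl₀⟩ := exists_codeBit (m.color j y) hi
    refine ⟨l₀, fun l hl => ⟨(hl₀ l hl).1, (hl₀ l hl).2.1, fun z' hz' _ a' ha' b' hb' e' => ?_⟩⟩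
    obtain rfl := eq_of_mem_Q_of_smul_eq_smul hz hz' ha hb ha' hb' e e'
    exact (hl₀ l hl).2.2 _ hbit
  · obtain ⟨l₀, hl₀⟩ := exists_codeBit (m.color j y) (h.good j).one_le_n
    exact ⟨l₀, fun l hl => ⟨(hl₀ l hl).1, (hl₀ l hl).2.1, fun z' hz' hzy a ha b hb e =>
      absurd ⟨z', hz', hzy, a, ha, b, hb, e⟩ hz⟩⟩

/-- Of four positions, one may be lost to later levels and two to coincidences. -/
theorem exists_mem_forall_notMem_ones (h : IsLevelSeq γ L) (hfree : IsFreeAction Γ X) {s : Finset ℕ}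
    (hcard : 3 < s.card) (hs : ∀ l ∈ s, l < 8 * (L j).n) {a : ℕ → Γ} (ha : ∀ l, a l ∈ (L j).T)
    (w : X) : ∃ l ∈ s, (∀ i > j, (a l * (L j).t l) • w ∉ m.ones i) ∧
      ∀ z ∈ m.markers j, ∀ b ∈ (L j).T, ∀ l' < 8 * (L j).n,
        (a l * (L j).t l) • w = (b * (L j).t l') • z → l' = l := by
  classical
  obtain ⟨z, hz⟩ := exists_forall_eq_of_smul_eq_smul (m := m) j w
  obtain ⟨l, hl, hlater, hmeets⟩ := exists_mem_not_and_not (s := s)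
    (p := fun l => ∃ i > j, (a l * (L j).t l) • w ∈ m.ones i)
    (q := MeetsOther (L j).T (L j).t z w)
    (lt_of_le_of_lt (add_le_add (card_filter_mem_ones_le_one h hfree hs ha)
      ((h.good j).t_generic.card_filter_meetsOther_le_two hfree s)) hcard)
  refine ⟨l, hl, fun i hi hx => hlater ⟨i, hi, hx⟩, fun z' hz' b hb l' hl' e => ?_⟩
  obtain rfl := hz z' hz' _ (Level.mul_t_mem_Q (ha l) (hs l hl)) _ (Level.mul_t_mem_Q hb hl') e
  by_contra hne
  exact hmeets ⟨l', hne, a l, ha l, b, hb, e⟩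

theorem exists_mem_Q (h : IsLevelSeq γ L) (hfree : IsFreeAction Γ X) (hy : y ∈ m.markers j) {β : Γ}
    (hβ : β ∈ (L j).conjugates (γ j)) (hβ1 : β ≠ 1) :
    ∃ q ∈ (L j).Q, q • y ∈ m.ones j ∧ ∀ i, q • β • y ∉ m.ones i := by
  choose a ha hay haβ hne using fun l => exists_mem_T (m := m) h hfree j
    (x := (L j).t l • y) (y := (L j).t l • β • y)
    ((MulAction.injective _).ne (hfree.smul_ne hβ1 y).symm)
  obtain ⟨l₀, hl₀⟩ := exists_codeBit_color (m := m) h hβ y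
  obtain ⟨l, hl, hlater, hindex⟩ := exists_mem_forall_notMem_ones (m := m) h hfree
    (s := Finset.Ico l₀ (l₀ + 4)) (by simp) (fun l hl => (hl₀ l hl).1) ha (β • y)
  obtain ⟨hln, hbit, hcolor⟩ := hl₀ l hl
  have hQ := Level.mul_t_mem_Q (ha l) hln
  refine ⟨a l * (L j).t l, hQ, smul_mem_ones (ha l) hln hy (by rw [mul_smul]; exact hay l) hbit,
    fun i => ?_⟩
  rcases lt_trichotomy i j with hi | rfl | hi
  · exact notMem_ones_of_lt h hi (by rw [mul_smul]; exact haβ l)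
  · intro hones
    obtain ⟨z, hz, b, hb, l', hl', e, hbit'⟩ := exists_of_mem_ones hones
    obtain rfl := hindex z hz b hb l' hl' e
    by_cases hzy : z = y
    · rw [hzy, mul_smul, mul_smul] at e
      exact hne l' b hb e
    · exact hcolor z hz hzy _ hQ _ (Level.mul_t_mem_Q hb hl') e hbit'
  · exact hlater i hi

theorem exists_mem_window (m : MarkerSystem γ L X) (h : IsLevelSeq γ L) (hfree : IsFreeAction Γ X)
    {j : ℕ} (hγ : γ j ≠ 1) (x : X) : ∃ w ∈ (L j).window,
      w • x ∈ m.ones j ∧ ∀ i, (w * γ j) • x ∉ m.ones i := by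
  obtain ⟨δ, hδ, hy⟩ := m.syndetic j x
  have hconj : δ * γ j * δ⁻¹ ∈ (L j).conjugates (γ j) :=
    Finset.mem_image_of_mem (fun δ => δ * γ j * δ⁻¹) hδ
  obtain ⟨q, hq, hones, hnot⟩ := exists_mem_Q h hfree hy hconj (conj_eq_one_iff.not.2 hγ)
  refine ⟨q * δ, Finset.mul_mem_mul hq hδ, by rwa [mul_smul], fun i => ?_⟩
  simpa only [smul_smul, mul_assoc, inv_mul_cancel, mul_one] using hnot i

end MarkerSystem

/-! ### Continuous colorings without periods -/

theorem inv_mem_erase_one {Γ : Type u} [Group Γ] [DecidableEq Γ] {R : Finset Γ} (hR : R⁻¹ = R)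
    {r : Γ} (hr : r ∈ R.erase 1) : r⁻¹ ∈ R.erase 1 := by
  rw [Finset.mem_erase, ← Finset.mem_inv', hR]
  exact ⟨inv_ne_one.2 (Finset.ne_of_mem_erase hr), Finset.mem_of_mem_erase hr⟩

theorem mem_erase_one_of_smul_ne {Γ X : Type*} [Group Γ] [DecidableEq Γ] [MulAction Γ X]
    {R : Finset Γ} {r : Γ} {x : X} (hr : r ∈ R) (hne : r • x ≠ x) : r ∈ R.erase 1 := by
  refine Finset.mem_erase.2 ⟨?_, hr⟩
  rintro rfl
  exact hne (one_smul _ x)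

namespace Level

variable {Γ : Type u} [Group Γ] [DecidableEq Γ] (L : Level Γ)

theorem inv_sep : L.sep⁻¹ = L.sep := by rw [sep, mul_inv_rev, inv_inv]

theorem inv_colorSep (γ : Γ) : (L.colorSep γ)⁻¹ = L.colorSep γ := by
  ext x
  simp only [colorSep, Finset.mem_inv', Finset.mem_union, inv_inv, or_comm]

end Level

section Detection

variable {Γ : Type u} [Group Γ] [DecidableEq Γ] {γ : ℕ → Γ} {L : ℕ → Level Γ} {X : Type*}
  [TopologicalSpace X] [MulAction Γ X] [ContinuousConstSMul Γ X]

theorem exists_markerSystem [LindelofSpace X] [T2Space X] (hX : IsZeroDimensional X)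
    (hfree : IsFreeAction Γ X) (h : IsLevelSeq γ L) :
    ∃ m : MarkerSystem γ L X, (∀ j, IsClopen (m.markers j)) ∧ ∀ j, Continuous (m.color j) := by
  choose c hc hcne _ hc0 using fun j => exists_continuous_coloring hX hfree
    (Finset.notMem_erase 1 (L j).sep) fun _ => inv_mem_erase_one (L j).inv_sep
  choose d hd hdne hdle _ using fun j => exists_continuous_coloring hX hfree
    (Finset.notMem_erase 1 ((L j).colorSep (γ j)))
    fun _ => inv_mem_erase_one ((L j).inv_colorSep (γ j))
  refine ⟨⟨fun j => c j ⁻¹' {0}, d, fun j y hy r hr hry => ?_, fun j x => ?_,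
    fun j x r hr hne => hdne j x r (mem_erase_one_of_smul_ne hr hne),
    fun j x => (hdle j x).trans_lt (Finset.card_erase_le.trans_lt (h.good j).card_lt)⟩,
    fun j => (isClopen_discrete {0}).preimage (hc j), hd⟩
  · by_contra hne
    exact hcne j y r (mem_erase_one_of_smul_ne hr hne) (hry.trans hy.symm)
  · by_cases hx : c j x = 0
    · exact ⟨1, Finset.mem_insert_self _ _, by rwa [one_smul]⟩
    · obtain ⟨r, hr, hr0⟩ := hc0 j x hx
      exact ⟨r, Finset.mem_insert_of_mem (Finset.mem_of_mem_erase hr), hr0⟩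

namespace MarkerSystem

variable {m : MarkerSystem γ L X}

theorem isClopen_reserved (hm : ∀ j, IsClopen (m.markers j)) (j : ℕ) :
    IsClopen (m.reserved j) := by
  have hunion : m.reserved j =
      ⋃ i ∈ Finset.range j, ⋃ a ∈ (L i).K, (fun x => a⁻¹ • x) ⁻¹' m.markers i := by
    ext x
    simp [reserved]
  rw [hunion]
  exact isClopen_biUnion_finset fun i _ => isClopen_biUnion_finset fun a _ =>
    (hm i).preimage (continuous_const_smul _)

theorem isClopen_ones (hm : ∀ j, IsClopen (m.markers j)) (hcolor : ∀ j, Continuous (m.color j))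
    (j : ℕ) : IsClopen (m.ones j) := by
  have hinter : m.ones j = (m.reserved j)ᶜ ∩ ⋃ a ∈ (L j).T, ⋃ l ∈ Finset.range (8 * (L j).n),
      (fun x => (a * (L j).t l)⁻¹ • x) ⁻¹' (m.markers j ∩ m.color j ⁻¹' {κ | codeBit κ l}) := by
    ext x
    simp only [ones, Set.mem_ofPred_eq, Set.mem_inter_iff, Set.mem_compl_iff, Set.mem_iUnion,
      Set.mem_preimage, Finset.mem_range, exists_prop]
  rw [hinter]
  exact (isClopen_reserved hm j).compl.inter (isClopen_biUnion_finset fun a _ =>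
    isClopen_biUnion_finset fun l _ =>
      ((hm j).inter ((isClopen_discrete _).preimage (hcolor j))).preimage
        (continuous_const_smul _))

end MarkerSystem

theorem exists_continuous_detecting [LindelofSpace X] [T2Space X] (hX : IsZeroDimensional X)
    (hfree : IsFreeAction Γ X) (h : IsLevelSeq γ L) (hγ : ∀ j, γ j ≠ 1) (J : ℕ) :
    ∃ g : X → Fin 2, Continuous g ∧
      ∀ j < J, ∀ x, ∃ w ∈ (L j).window, g (w • x) ≠ g ((w * γ j) • x) := by
  obtain ⟨m, hm, hcolor⟩ := exists_markerSystem hX hfree h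
  have hclopen : IsClopen (⋃ i ∈ Finset.range J, m.ones i) :=
    isClopen_biUnion_finset fun i _ => MarkerSystem.isClopen_ones hm hcolor i
  refine ⟨Set.indicator (⋃ i ∈ Finset.range J, m.ones i) 1,
    hclopen.continuous_indicator continuous_one, fun j hj x => ?_⟩
  obtain ⟨w, hw, hones, hnot⟩ := m.exists_mem_window h hfree (hγ j) x
  have hmem : w • x ∈ ⋃ i ∈ Finset.range J, m.ones i :=
    Set.mem_biUnion (Finset.mem_coe.2 (Finset.mem_range.2 hj)) hones
  have hnotMem : (w * γ j) • x ∉ ⋃ i ∈ Finset.range J, m.ones i := by simp [hnot]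
  refine ⟨w, hw, ?_⟩
  rw [Set.indicator_of_mem hmem, Set.indicator_of_notMem hnotMem]
  exact one_ne_zero

end Detection

/-! ### From the free part of the shift to all free zero-dimensional spaces -/

namespace Shift

variable {Γ : Type u} {k : ℕ}

instance : CompactSpace (Shift Γ k) := inferInstanceAs (CompactSpace (Γ → Fin k))

instance : T2Space (Shift Γ k) := inferInstanceAs (T2Space (Γ → Fin k))

instance : TotallyDisconnectedSpace (Shift Γ k) :=
  inferInstanceAs (TotallyDisconnectedSpace (Γ → Fin k))

instance [Countable Γ] : SecondCountableTopology (Shift Γ k) :=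
  inferInstanceAs (SecondCountableTopology (Γ → Fin k))

theorem continuous_eval (δ : Γ) : Continuous fun z : Shift Γ k => z δ :=
  continuous_apply (A := fun _ : Γ => Fin k) δ

theorem exists_continuous_extension {κ : Type*} [Nonempty κ] [TopologicalSpace κ]
    [DiscreteTopology κ] {Z : Set (Shift Γ k)} (hZ : IsClosed Z) {f : Z → κ} (hf : Continuous f) :
    ∃ φ : Shift Γ k → κ, Continuous φ ∧ ∀ z : Z, φ z = f z := by
  have : CompactSpace Z := isCompact_iff_compactSpace.1 hZ.isCompact
  have hind : Topology.IsInducing fun (z : Z) (δ : Γ) => z.1 δ := ⟨rfl⟩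
  obtain ⟨I, hI⟩ := exists_finset_determining hind hf
  have hfactors : f.FactorsThrough fun (z : Z) (i : I) => z.1 i :=
    fun z z' h => hI z z' fun i hi => congrFun h ⟨i, hi⟩
  let F := Function.extend (fun (z : Z) (i : I) => z.1 i) f fun _ => Classical.arbitrary κ
  have hF : Continuous F := continuous_of_discreteTopology
  exact ⟨fun z => F fun i => z i,
    hF.comp (continuous_pi fun i : I => continuous_eval (i : Γ)),
    fun z => hfactors.extend_apply _ z⟩

variable [Group Γ]

theorem smul_apply (γ δ : Γ) (z : Shift Γ k) : (γ • z) δ = z (δ * γ) := rfl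

instance : ContinuousConstSMul Γ (Shift Γ k) where
  continuous_const_smul γ := continuous_pi fun δ => continuous_eval (δ * γ)

/-- The points without the periods `γ j`, `j < J`, as witnessed in all translates of the windows
`W j`. -/
def detecting (γ : ℕ → Γ) (W : ℕ → Finset Γ) (J : ℕ) : Set (Shift Γ k) :=
  {z | ∀ j < J, ∀ δ, ∃ w ∈ W j, z (w * δ) ≠ z (w * γ j * δ)}

variable {γ : ℕ → Γ} {W : ℕ → Finset Γ} {J : ℕ}

theorem isClosed_detecting (J : ℕ) : IsClosed (detecting (k := k) γ W J) := by
  have hinter : detecting (k := k) γ W J = ⋂ (j : ℕ) (_ : j < J) (δ : Γ), ⋃ w ∈ W j,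
      (fun z : Shift Γ k => (z (w * δ), z (w * γ j * δ))) ⁻¹' {y | y.1 ≠ y.2} := by
    ext z
    simp [detecting]
  rw [hinter]
  exact isClosed_iInter fun j => isClosed_iInter fun _ => isClosed_iInter fun δ =>
    isClosed_biUnion_finset fun w _ =>
      (isClosed_discrete _).preimage ((continuous_eval _).prodMk (continuous_eval _))

theorem detecting_antitone : Antitone (detecting (k := k) γ W) :=
  fun _ _ hJ _ hz j hj => hz j (hj.trans_le hJ)

theorem smul_mem_detecting {z : Shift Γ k} (hz : z ∈ detecting γ W J) (η : Γ) :
    η • z ∈ detecting γ W J := by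
  intro j hj δ
  obtain ⟨w, hw, hne⟩ := hz j hj (δ * η)
  exact ⟨w, hw, by rwa [smul_apply, smul_apply, mul_assoc, mul_assoc _ δ]⟩

theorem mem_freePart_of_mem_detecting (hγ : ∀ η : Γ, η ≠ 1 → ∃ j, γ j = η) {z : Shift Γ k}
    (hz : ∀ J, z ∈ detecting γ W J) : z ∈ freePart Γ (Shift Γ k) := by
  change MulAction.stabilizer Γ z = ⊥
  rw [Subgroup.eq_bot_iff_forall]
  intro η hη
  by_contra hne
  obtain ⟨j, rfl⟩ := hγ η hne
  obtain ⟨w, -, hw⟩ := hz (j + 1) j (Nat.lt_succ_self j) 1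
  rw [mul_one, mul_one] at hw
  exact hw (congrArg (fun y : Shift Γ k => y w) (MulAction.mem_stabilizer_iff.1 hη)).symm

variable {X : Type*} [MulAction Γ X]

/-- The equivariant map to the shift that is induced by a coloring. -/
def orbitMap (g : X → Fin k) (x : X) : Shift Γ k := fun δ => g (δ • x)

theorem orbitMap_smul (g : X → Fin k) (η : Γ) (x : X) :
    orbitMap g (η • x) = η • (orbitMap g x : Shift Γ k) :=
  funext fun δ => congrArg g (smul_smul δ η x)

theorem continuous_orbitMap [TopologicalSpace X] [ContinuousConstSMul Γ X] {g : X → Fin k}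
    (hg : Continuous g) : Continuous (orbitMap (Γ := Γ) g) :=
  continuous_pi fun δ => hg.comp (continuous_const_smul δ)

theorem orbitMap_mem_detecting {g : X → Fin k}
    (hg : ∀ j < J, ∀ x, ∃ w ∈ W j, g (w • x) ≠ g ((w * γ j) • x)) (x : X) :
    orbitMap g x ∈ detecting γ W J := by
  intro j hj δ
  obtain ⟨w, hw, hne⟩ := hg j hj (δ • x)
  exact ⟨w, hw, by rwa [smul_smul, smul_smul] at hne⟩

end Shift

section FreePart

theorem IsZeroDimensional.of_isInducing {X Y : Type*} [TopologicalSpace X] [TopologicalSpace Y]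
    {e : X → Y} (he : Topology.IsInducing e) (hY : IsZeroDimensional Y) : IsZeroDimensional X := by
  refine TopologicalSpace.isTopologicalBasis_of_isOpen_of_nhds (fun s hs => hs.isOpen) ?_
  intro x U hx hU
  obtain ⟨V, hV, rfl⟩ := he.isOpen_iff.1 hU
  obtain ⟨s, hs, hxs, hsV⟩ := hY.exists_subset_of_mem_open hx hV
  exact ⟨e ⁻¹' s, IsClopen.preimage hs he.continuous, hxs, Set.preimage_mono hsV⟩

variable {Γ : Type u} [Group Γ]

theorem isZeroDimensional_freePart {k : ℕ} : IsZeroDimensional (freePart Γ (Shift Γ k)) :=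
  IsZeroDimensional.of_isInducing Topology.IsInducing.subtypeVal
    (isTopologicalBasis_isClopen (X := Shift Γ k))

theorem isFreeAction_freePart (X : Type*) [MulAction Γ X] : IsFreeAction Γ (freePart Γ X) :=
  fun x => (SubMulAction.stabilizer_of_subMul x).trans x.2

variable {X : Type*} [MulAction Γ X] [TopologicalSpace X]

instance [ContinuousConstSMul Γ X] : ContinuousConstSMul Γ (freePart Γ X) where
  continuous_const_smul γ :=
    ((continuous_const_smul γ).comp continuous_subtype_val).subtype_mk _

end FreePart

/-- The pattern `p` occurs in the coloring `f` at the point `x`. -/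
def Pattern.OccursAt {Γ : Type u} [Group Γ] {k : ℕ} {X : Type*} [MulAction Γ X] (p : Pattern Γ k)
    (f : X → Fin k) (x : X) : Prop :=
  ∀ γ : p.dom, f ((γ : Γ) • x) = p.val γ

theorem exists_forall_not_occursAt {Γ : Type u} [Group Γ] {X : Type*} [TopologicalSpace X]
    [CompactSpace X] [MulAction Γ X] [ContinuousConstSMul Γ X] {k : ℕ} {P : Set (Pattern Γ k)}
    (hP : P.Finite) {φ : X → Fin k} (hφ : Continuous φ) {C : ℕ → Set X}
    (hC : ∀ j, IsClosed (C j)) (hanti : Antitone C)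
    (h : ∀ x ∈ ⋂ j, C j, ∀ p ∈ P, ¬ p.OccursAt φ x) :
    ∃ j, ∀ x ∈ C j, ∀ p ∈ P, ¬ p.OccursAt φ x := by
  have hclosed : IsClosed (⋃ p ∈ P, ⋂ γ : p.dom, {x | φ ((γ : Γ) • x) = p.val γ}) :=
    hP.isClosed_biUnion fun p _ => isClosed_iInter fun γ =>
      isClosed_eq (hφ.comp (continuous_const_smul _)) continuous_const
  obtain ⟨j, hj⟩ := hclosed.isCompact.elim_directed_family_closed C hC
    (Set.eq_empty_iff_forall_notMem.2 fun x ⟨hx, hxC⟩ => by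
      obtain ⟨p, hp, hxp⟩ := Set.mem_iUnion₂.1 hx
      exact h x hxC p hp (Set.mem_iInter.1 hxp)) hanti.directed_ge
  exact ⟨j, fun x hx p hp hxp => Set.eq_empty_iff_forall_notMem.1 hj x
    ⟨Set.mem_iUnion₂.2 ⟨p, hp, Set.mem_iInter.2 hxp⟩, hx⟩⟩

theorem exists_continuous_avoiding_detecting {Γ : Type u} [Group Γ] {k l : ℕ} (hk : 1 ≤ k)
    {P : Set (Pattern Γ k)} (hP : P.Finite)
    (h : HasContinuousAvoidingColoring P (freePart Γ (Shift Γ l))) {γ : ℕ → Γ}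
    (hγ : ∀ η : Γ, η ≠ 1 → ∃ j, γ j = η) (W : ℕ → Finset Γ) :
    ∃ φ : Shift Γ l → Fin k, Continuous φ ∧ ∃ J, ∀ z ∈ Shift.detecting γ W J, ∀ p ∈ P,
      ¬ p.OccursAt φ z := by
  have : Nonempty (Fin k) := ⟨⟨0, hk⟩⟩
  obtain ⟨f, hf, hfP⟩ := h
  have hfreePart : ∀ z ∈ ⋂ J, Shift.detecting γ W J, z ∈ freePart Γ (Shift Γ l) :=
    fun z hz => Shift.mem_freePart_of_mem_detecting hγ (Set.mem_iInter.1 hz)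
  obtain ⟨φ, hφ, hφf⟩ := Shift.exists_continuous_extension
    (isClosed_iInter Shift.isClosed_detecting)
    (hf.comp (continuous_inclusion hfreePart))
  refine ⟨φ, hφ, exists_forall_not_occursAt hP hφ Shift.isClosed_detecting
    Shift.detecting_antitone fun z hz p hp hzp => hfP p hp ⟨⟨z, hfreePart z hz⟩, fun δ => ?_⟩⟩
  have hsmul : (δ : Γ) • z ∈ ⋂ J, Shift.detecting γ W J :=
    Set.mem_iInter.2 fun J => Shift.smul_mem_detecting (Set.mem_iInter.1 hz J) δ
  exact (hφf ⟨_, hsmul⟩).symm.trans (hzp δ)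

theorem hasContinuousAvoidingColoring_of_freePart {Γ : Type u} [Group Γ] [Countable Γ] [Infinite Γ]
    {k : ℕ} (hk : 1 ≤ k) {P : Set (Pattern Γ k)} (hP : P.Finite)
    (h : HasContinuousAvoidingColoring P (freePart Γ (Shift Γ 2))) {X : Type*} [TopologicalSpace X]
    [LindelofSpace X] [T2Space X] [MulAction Γ X] [ContinuousConstSMul Γ X]
    (hX : IsZeroDimensional X) (hfree : IsFreeAction Γ X) : HasContinuousAvoidingColoring P X := by
  classical
  have : Nonempty {γ : Γ // γ ≠ 1} := nonempty_subtype.2 (exists_ne 1)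
  obtain ⟨e, he⟩ := exists_surjective_nat {γ : Γ // γ ≠ 1}
  obtain ⟨L, hL⟩ := exists_isLevelSeq fun j => (e j : Γ)
  obtain ⟨φ, hφ, J, hJ⟩ := exists_continuous_avoiding_detecting hk hP h (γ := fun j => (e j : Γ))
    (fun η hη => (he ⟨η, hη⟩).imp fun j => congrArg Subtype.val) fun j => (L j).window
  obtain ⟨g, hg, hdetect⟩ := exists_continuous_detecting hX hfree hL (fun j => (e j).2) J
  refine ⟨φ ∘ Shift.orbitMap g, hφ.comp (Shift.continuous_orbitMap hg), ?_⟩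
  rintro p hp ⟨x, hx⟩
  refine hJ _ (Shift.orbitMap_mem_detecting hdetect x) p hp fun δ => ?_
  rw [← Shift.orbitMap_smul]
  exact hx δ

theorem exists_localAlgorithm_of_colorSpace {Γ : Type u} [Group Γ] [Countable Γ] {k : ℕ}
    (hk : 1 ≤ k) {S : Set Γ} (hS : S.Finite) {P : Set (Pattern Γ k)} (hP : P.Finite)
    (hconn : ∀ p ∈ P, p.IsConnected S) (h : HasContinuousAvoidingColoring P (ColorSpace Γ)) :
    ∃ (A : LocalAlgorithm Γ k) (T : ℕ → ℕ),
      (fun n => (T n : ℝ)) =O[Filter.atTop] (fun n => (logStar n : ℝ)) ∧ A.Solves S P T := by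
  obtain ⟨D, hD, f, hf⟩ := exists_tileGraph_of_colorSpace hS hP hconn h
  exact exists_localAlgorithm_of_tileGraph hk hD hf

end ContinuousLocal

open ContinuousLocal in
theorem theorem1p10 {Γ : Type u} [Group Γ] [Countable Γ] [Infinite Γ]
    (k : ℕ) (hk : 1 ≤ k) (S : Set Γ) (hS : S.Finite)
    (P : Set (Pattern Γ k)) (hP : P.Finite) (hconn : ∀ p ∈ P, p.IsConnected S) :
    List.TFAE
      [ -- the free part of the Bernoulli shift `2^Γ`
        HasContinuousAvoidingColoring P (freePart Γ (Shift Γ 2)),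
        -- all free zero-dimensional Polish `Γ`-spaces (`Γ` is discrete)
        ∀ (X : Type u) [TopologicalSpace X] [PolishSpace X] [MulAction Γ X]
          [ContinuousConstSMul Γ X], IsZeroDimensional X → IsFreeAction Γ X →
            HasContinuousAvoidingColoring P X,
        -- deterministic `LOCAL` algorithms with `O(log* n)` rounds
        ∃ (A : LocalAlgorithm Γ k) (T : ℕ → ℕ),
          (fun n => (T n : ℝ)) =O[Filter.atTop] (fun n => (logStar n : ℝ)) ∧ A.Solves S P T ] ∧
    -- the two conditions on the family of finite graphs `H_{D i, m i}` with `D i = F i ^ log* (m i)`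
    ∀ (F : ℕ → Set Γ) (m : ℕ → ℕ), (∀ i, (F i).Finite) → Monotone F → ⋃ i, F i = Set.univ →
      (∀ i, S ∪ S⁻¹ ∪ {1} ⊆ F i) → (∀ i, (F i).ncard ^ (2 * logStar (m i)) ≤ m i) →
      ∀ hD : ∀ i, S ∪ S⁻¹ ∪ {1} ⊆ F i ^ logStar (m i),
        List.TFAE
          [ ∃ (A : LocalAlgorithm Γ k) (T : ℕ → ℕ),
              (fun n => (T n : ℝ)) =O[Filter.atTop] (fun n => (logStar n : ℝ)) ∧ A.Solves S P T,
            ∃ i, ∃ f, AvoidsOnGraph P (tileGraph S (F i ^ logStar (m i)) (hD i) (m i)) f,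
            {i | ¬ ∃ f, AvoidsOnGraph P
              (tileGraph S (F i ^ logStar (m i)) (hD i) (m i)) f}.Finite ] := by
  constructor
  · tfae_have 1 → 2 := fun h X _ _ _ _ hX hfree =>
      hasContinuousAvoidingColoring_of_freePart hk hP h hX hfree
    tfae_have 2 → 3 := fun h => exists_localAlgorithm_of_colorSpace hk hS hP hconn
      (h (ColorSpace Γ) ColorSpace.isZeroDimensional ColorSpace.isFreeAction)
    tfae_have 3 → 1 := by
      rintro ⟨A, T, hT, hA⟩
      obtain ⟨D, hD, n, hfin, hn, f, hf⟩ := exists_tileGraph_of_solves hS hP hconn hT hA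
      exact hasContinuousAvoidingColoring_of_tileGraph hfin hD hn hf
        isZeroDimensional_freePart (isFreeAction_freePart _)
    tfae_finish
  · intro F m hFfin hF hFu _ hm hD
    tfae_have 1 → 3 := fun ⟨A, T, hT, hA⟩ =>
      finite_not_tileGraph_of_solves hS hP hconn hT hA hFfin hF hFu hm hD
    tfae_have 3 → 2 := fun h => h.exists_notMem.imp fun i => not_not.1
    tfae_have 2 → 1 := fun ⟨i, f, hf⟩ =>
      exists_localAlgorithm_of_colorSpace hk hS hP hconn
        (hasContinuousAvoidingColoring_of_tileGraph (finite_pow (hFfin i) _) (hD i)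
          (sq_ncard_pow_le (hFfin i) (hm i)) hf ColorSpace.isZeroDimensional
          ColorSpace.isFreeAction)
    tfae_finish
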